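/- **The calculus.** Fix a family of data types $T$, each with finitely many constructors $D$; each field of a constructor has a simple type, and each constructor has an output refinement $r_D$ (a term over its fields $\bar y$ and the constructed value $v$). Base types are $B ::= \mathrm{Int}\mid \mathrm{Bool}\mid T$; $B$ is *first order* if no function can occur inside its values. Constants are $c ::= \mathrm{true}\mid\mathrm{false}\mid 0,\pm1,\dots\mid \lnot\mid\land\mid {=_B}\ (B \text{ first order})\mid {<}\mid +\mid -$. Terms and types are $$p,e ::= x\mid c\mid D\mid \lambda x{:}\tau.e\mid e\,e\mid \mathsf{case}\ x=e\ \mathsf{of}\ \{\dots\}\mid \mathsf{let}\ x{:}\tau=e\ \mathsf{in}\ p\mid \mathsf{reflect}\ x{:}\tau=e\ \mathsf{in}\ p\mid \mathsf{fix}\,x.e,\qquad \tau ::= \{v:B^{l}\mid r\}\mid x{:}\tau_x\to\tau ,$$ where $\mathsf{case}$ branches on booleans or on the constructors of a data type, $r$ is a term, and the label $l$ is $\Downarrow$ (must terminate) or absent. The *result label* of $\tau$ is the label of its final result. Binders of $\mathsf{let}$ and $\mathsf{reflect}$ are recursive. Values $w$ are constants, abstractions, and constructors applied to values (a binary constant applied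 to one value counts as a constant, and constructors may be partially applied). *Evaluation* $\hookrightarrow$ is small-step and call-by-name, with contexts $C ::= \bullet\mid C\,e\mid c\,C\mid D\,\bar e\,C\,\bar e\mid \mathsf{case}\ y=C\ \mathsf{of}\ \{\dots\}$ and the rules: a primitive applied to values computes; $(\lambda x{:}\tau.e)\,e'\hookrightarrow e[x\mapsto e']$; $\mathsf{case}\ y=D_j\,\bar e\ \mathsf{of}\ \{D_i\,\bar x\to e_i\}\hookrightarrow e_j[\bar x\mapsto\bar e][y\mapsto D_j\,\bar e]$ and likewise for booleans; $\mathsf{let}\ x{:}\tau=e\ \mathsf{in}\ p$ and $\mathsf{reflect}\ x{:}\tau=e\ \mathsf{in}\ p$ step to $p[x\mapsto\mathsf{fix}\,x.e]$; $\mathsf{fix}\,x.e\hookrightarrow e[x\mapsto\mathsf{fix}\,x.e]$. Equality compares fully evaluated function-free values syntactically. "$p$ evaluates to $w$" means $p\hookrightarrow^*w$ and $w$ is a value. *Denotations.* $\lfloor\tau\rfloor$ erases refinements and labels. $[\![\{v:B^{l}\mid r\}]\!]$ is the set of closed $e$ of simple type $B$ such that $r[v\mapsto w]\hookrightarrow^*\mathrm{true}$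 whenever $e$ evaluates to $w$, and, if $l$ is $\Downarrow$, $e$ evaluates to some value. $[\![x{:}\tau_x\to\tau]\!]$ is the set of closed $e$ of simple type $\lfloor x{:}\tau_x\to\tau\rfloor$ such that $e\,e_x\in[\![\tau[x\mapsto e_x]]\!]$ for all $e_x\in[\![\tau_x]\!]$. $[\![\Gamma]\!]$ is the set of closing substitutions $\theta$ with $\theta(x)\in[\![\theta\tau]\!]$ for all $x{:}\tau$ in $\Gamma$. *Subtyping.* $\Gamma\vdash\{v:B^{l_1}\mid r_1\}\preceq\{v:B^{l_2}\mid r_2\}$ iff $[\![\theta\{v:B^{l_1}\mid r_1\}]\!]\subseteq[\![\theta\{v:B^{l_2}\mid r_2\}]\!]$ for all $\theta\in[\![\Gamma]\!]$; function types are contravariant in the argument and covariant in the result, the latter being compared under the smaller argument type. *Well-formedness* $\Gamma\vdash\tau$: every refinement in $\tau$ has type $\mathrm{Bool}^{\Downarrow}$, its $v$ having type $B^{\Downarrow}$. *Types of constants.* A literal has type $\{v:B^{\Downarrow}\mid v=c\}$, an operator $\bar x{:}\bar B^{\Downarrow}\to\{v:B^{\Downarrow}\mid v=c\,\bar x\}$.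 A constructor $D$ of $T$ has type $\bar y{:}\bar s\to\{v:T\mid r_D\}$ with the simple field types $\bar s$ taken as trivially refined and unlabelled; if all fields have base types it also has this type with $\Downarrow$ on all fields and on the result. *Typing* $\Gamma\vdash p:\tau$ is generated, mutually with well-formedness, by the usual rules for variables, constants, subsumption, abstraction ($\Gamma\vdash\tau_x$ and $\Gamma,x{:}\tau_x\vdash e:\tau$ give $\Gamma\vdash\lambda x{:}\tau_x.e : x{:}\tau_x\to\tau$) and application (result type $\tau[x\mapsto e_x]$), and by: - (exact) if $\Gamma\vdash e:\{v:B^{l}\mid r\}$, $B$ first order, then $\Gamma\vdash e:\{v:B^{l}\mid r\land v=e\}$; - (case) if $\Gamma\vdash e:\{v:T^{l}\mid r\}$, $\Gamma\vdash\tau$, $l$ is $\Downarrow$ or the result label of $\tau$ is absent, and for each $i$, $\Gamma,\bar y{:}\bar s^{\,l},x{:}\{v:T^{l}\mid r\land r_{D_i}\}\vdash e_i:\tau$, where $\bar s^{\,l}$ puts $l$ on base field types, then $\Gamma\vdash\mathsf{case}\ x=e\ \mathsf{of}\ \{D_i\,\bar y\to e_i\}:\tau$; similarly for $\mathrm{Bool}$,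 with $v=\mathrm{true}$, $v=\mathrm{false}$ in place of $r_{D_i}$; - (let) if $\Gamma,x{:}\tau_x\vdash e_x:\tau_x$, the recursion is admitted, $\Gamma,x{:}\tau_x\vdash p:\tau$ and $\Gamma\vdash\tau$, then $\Gamma\vdash\mathsf{let}\ x{:}\tau_x=e_x\ \mathsf{in}\ p:\tau$ (here $\tau_x$ may mention $x$); - (reflect) if $\Gamma\vdash\mathsf{let}\ f{:}\mathrm{Reflect}(\tau_f,e)=e\ \mathsf{in}\ p:\tau$ then $\Gamma\vdash\mathsf{reflect}\ f{:}\tau_f=e\ \mathsf{in}\ p:\tau$, where $\mathrm{Reflect}(\{v:B^l\mid r\},e)=\{v:B^l\mid r\land v=e\}$ ($B$ first order) and $\mathrm{Reflect}(x{:}\tau_x\to\tau,\lambda x.e)=x{:}\tau_x\to\mathrm{Reflect}(\tau,e)$; - (fix) if $\Gamma,x{:}\tau_x\vdash e:\tau_x$ and the recursion is admitted, then $\Gamma\vdash\mathsf{fix}\,x.e:\tau_x[x\mapsto\mathsf{fix}\,x.e]$. A recursion $x{:}\tau_x=e$ is *admitted* in $\Gamma$ if the result label of $\tau_x$ is absent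 and $x$ does not occur in the argument types of $\tau_x$; or if it passes the termination check: for all $\theta\in[\![\Gamma]\!]$, with $\theta'=\theta[x\mapsto a]$, if $\theta' e\in[\![\theta'\tau_x]\!]$ for every $a\in[\![\theta'\tau_x]\!]$, then $\theta(\mathsf{fix}\,x.e)\in[\![\theta(\tau_x[x\mapsto\mathsf{fix}\,x.e])]\!]$. **Theorem (Preservation).** Suppose that every constructor $D$ lies in the denotation of its (unlabelled) type. If $\emptyset\vdash p:\tau$ and $p\hookrightarrow^* w$ with $w$ a value, then $\emptyset\vdash w:\tau$. -/

import Mathlib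

/-! A call-by-name refinement calculus with reflection. Terms are well scoped de Bruijn terms:
`Term S n` has free variables in `Fin n`, and `0 : Fin (n + 1)` is the innermost binder. -/

namespace RefinementReflection

/-- Base types: integers, booleans and data types. -/
inductive BaseTy (D : Type) : Type
  | int : BaseTy D
  | bool : BaseTy D
  | data : D → BaseTy D

/-- Simple (unrefined) types. -/
inductive SimpleTy (D : Type) : Type
  | base : BaseTy D → SimpleTy D
  | arr : SimpleTy D → SimpleTy D → SimpleTy D

/-- The data types of a program: each has finitely many constructors, each constructor has
finitely many fields, and each field has a simple type. -/
structure DataSig : Type 1 where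
  Data : Type
  ctors : Data → ℕ
  arity : (T : Data) → Fin (ctors T) → ℕ
  field : (T : Data) → (i : Fin (ctors T)) → Fin (arity T i) → SimpleTy Data

/-- A base type is first order when no function can occur inside its values. It is these types
whose equality is implementable, and that carry a primitive equality. -/
def FirstOrder (S : DataSig) (B : BaseTy S.Data) : Prop :=
  ∃ X : Set (BaseTy S.Data), B ∈ X ∧
    ∀ T, BaseTy.data T ∈ X → ∀ i j, ∃ B' ∈ X, S.field T i j = SimpleTy.base B'

/-- Primitive constants. -/
inductive Const (S : DataSig) : Type
  | bool : Bool → Const S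
  | int : ℤ → Const S
  | not : Const S
  | and : Const S
  | eq : (B : BaseTy S.Data) → FirstOrder S B → Const S
  | lt : Const S
  | add : Const S
  | sub : Const S

/-- The number of arguments a primitive waits for. -/
def Const.arity {S : DataSig} : Const S → ℕ
  | .bool _ => 0
  | .int _ => 0
  | .not => 1
  | .and => 2
  | .eq _ _ => 2
  | .lt => 2
  | .add => 2
  | .sub => 2

/-- Termination labels: `tot` is the label `⇓`; `part` is the absence of a label. -/
inductive Label : Type
  | tot : Label
  | part : Label

mutual

/-- Terms. One category holds expressions, binders (`letRec`) and programs (`reflect`), and the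
`fix` terms that arise during evaluation. -/
inductive Term (S : DataSig) : ℕ → Type
  | var {n : ℕ} : Fin n → Term S n
  | const {n : ℕ} : Const S → Term S n
  /-- the `i`-th data constructor of `T`, a curried constant -/
  | con {n : ℕ} (T : S.Data) (i : Fin (S.ctors T)) : Term S n
  /-- `λ x : τ. e` -/
  | lam {n : ℕ} : Ty S n → Term S (n + 1) → Term S n
  | app {n : ℕ} : Term S n → Term S n → Term S n
  /-- `case x = e of {true → e₁; false → e₂}` -/
  | caseBool {n : ℕ} : Term S n → Term S (n + 1) → Term S (n + 1) → Term S n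
  /-- `case x = e of {Dᵢ ȳᵢ → eᵢ}`; the variables of a branch are `ȳᵢ`, then `x` (innermost) -/
  | caseData {n : ℕ} (T : S.Data) : Term S n →
      ((i : Fin (S.ctors T)) → Term S (n + S.arity T i + 1)) → Term S n
  /-- `let rec x : τ = b in p`; `τ` and `b` may mention `x` (`τ` does when it is the type of a
  reflected function) -/
  | letRec {n : ℕ} : Ty S (n + 1) → Term S (n + 1) → Term S (n + 1) → Term S n
  /-- `reflect f : τ = e in p` -/
  | reflect {n : ℕ} : Ty S n → Term S (n + 1) → Term S (n + 1) → Term S n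
  /-- `fix x. e` -/
  | fix {n : ℕ} : Term S (n + 1) → Term S n

/-- Refinement types: `base l B r` is `{v : Bˡ | r}`, and `fn τ₁ τ₂` is `x : τ₁ → τ₂`. -/
inductive Ty (S : DataSig) : ℕ → Type
  | base {n : ℕ} : Label → BaseTy S.Data → Term S (n + 1) → Ty S n
  | fn {n : ℕ} : Ty S n → Ty S (n + 1) → Ty S n

end

/-! ### Renaming and substitution -/

/-- Extension of a tuple by an innermost entry. -/
def snoc {A : Type} {n : ℕ} (σ : Fin n → A) (a : A) : Fin (n + 1) → A :=
  fun i => Fin.cases a σ i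

/-- Extension of a tuple by `k` entries, `args 0` outermost. -/
def extend {A : Type} {n : ℕ} (σ : Fin n → A) : {k : ℕ} → (Fin k → A) → Fin (n + k) → A
  | 0, _ => σ
  | _ + 1, args => snoc (extend σ fun j => args j.castSucc) (args (Fin.last _))

/-- A renaming under one binder. -/
def liftRen {n m : ℕ} (ρ : Fin n → Fin m) : Fin (n + 1) → Fin (m + 1) :=
  snoc (fun i => (ρ i).succ) 0

/-- A renaming under `k` binders. -/
def liftRenN {n m : ℕ} (ρ : Fin n → Fin m) : (k : ℕ) → Fin (n + k) → Fin (m + k)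
  | 0 => ρ
  | k + 1 => liftRen (liftRenN ρ k)

mutual

def Term.rename {S : DataSig} {n m : ℕ} (ρ : Fin n → Fin m) : Term S n → Term S m
  | .var i => .var (ρ i)
  | .const c => .const c
  | .con T i => .con T i
  | .lam τ e => .lam (τ.rename ρ) (e.rename (liftRen ρ))
  | .app f a => .app (f.rename ρ) (a.rename ρ)
  | .caseBool e a b => .caseBool (e.rename ρ) (a.rename (liftRen ρ)) (b.rename (liftRen ρ))
  | .caseData T e br =>
      .caseData T (e.rename ρ) fun i => (br i).rename (liftRen (liftRenN ρ (S.arity T i)))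
  | .letRec τ b p => .letRec (τ.rename (liftRen ρ)) (b.rename (liftRen ρ)) (p.rename (liftRen ρ))
  | .reflect τ e p => .reflect (τ.rename ρ) (e.rename (liftRen ρ)) (p.rename (liftRen ρ))
  | .fix e => .fix (e.rename (liftRen ρ))

def Ty.rename {S : DataSig} {n m : ℕ} (ρ : Fin n → Fin m) : Ty S n → Ty S m
  | .base l B r => .base l B (r.rename (liftRen ρ))
  | .fn τ₁ τ₂ => .fn (τ₁.rename ρ) (τ₂.rename (liftRen ρ))

end

/-- Weakening by one variable. -/
def Term.wk {S : DataSig} {n : ℕ} (e : Term S n) : Term S (n + 1) := e.rename Fin.succ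

/-- Weakening by one variable. -/
def Ty.wk {S : DataSig} {n : ℕ} (τ : Ty S n) : Ty S (n + 1) := τ.rename Fin.succ

/-- Weakening by `k` variables. -/
def wkRen {n : ℕ} : (k : ℕ) → Fin n → Fin (n + k)
  | 0 => id
  | k + 1 => fun i => (wkRen k i).succ

/-- A substitution under one binder. -/
def liftSub {S : DataSig} {n m : ℕ} (σ : Fin n → Term S m) : Fin (n + 1) → Term S (m + 1) :=
  snoc (fun i => (σ i).wk) (.var 0)

/-- A substitution under `k` binders. -/
def liftSubN {S : DataSig} {n m : ℕ} (σ : Fin n → Term S m) :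
    (k : ℕ) → Fin (n + k) → Term S (m + k)
  | 0 => σ
  | k + 1 => liftSub (liftSubN σ k)

mutual

def Term.subst {S : DataSig} {n m : ℕ} (σ : Fin n → Term S m) : Term S n → Term S m
  | .var i => σ i
  | .const c => .const c
  | .con T i => .con T i
  | .lam τ e => .lam (τ.subst σ) (e.subst (liftSub σ))
  | .app f a => .app (f.subst σ) (a.subst σ)
  | .caseBool e a b => .caseBool (e.subst σ) (a.subst (liftSub σ)) (b.subst (liftSub σ))
  | .caseData T e br =>
      .caseData T (e.subst σ) fun i => (br i).subst (liftSub (liftSubN σ (S.arity T i)))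
  | .letRec τ b p => .letRec (τ.subst (liftSub σ)) (b.subst (liftSub σ)) (p.subst (liftSub σ))
  | .reflect τ e p => .reflect (τ.subst σ) (e.subst (liftSub σ)) (p.subst (liftSub σ))
  | .fix e => .fix (e.subst (liftSub σ))

def Ty.subst {S : DataSig} {n m : ℕ} (σ : Fin n → Term S m) : Ty S n → Ty S m
  | .base l B r => .base l B (r.subst (liftSub σ))
  | .fn τ₁ τ₂ => .fn (τ₁.subst σ) (τ₂.subst (liftSub σ))

end

/-- `e[x ↦ a]` for the innermost variable `x`. -/
def Term.inst {S : DataSig} {n : ℕ} (e : Term S (n + 1)) (a : Term S n) : Term S n :=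
  e.subst (snoc Term.var a)

/-- `τ[x ↦ a]` for the innermost variable `x`. -/
def Ty.inst {S : DataSig} {n : ℕ} (τ : Ty S (n + 1)) (a : Term S n) : Ty S n :=
  τ.subst (snoc Term.var a)

/-! ### Abbreviations for terms -/

section Abbreviations

variable {S : DataSig} {n : ℕ}

def Term.tt : Term S n := .const (.bool true)

def Term.not (a : Term S n) : Term S n := .app (.const .not) a

/-- A binary primitive applied to two arguments. -/
def Term.op (c : Const S) (a b : Term S n) : Term S n := .app (.app (.const c) a) b

/-- `a ∧ b` -/
def Term.and (a b : Term S n) : Term S n := .op .and a b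

/-- `a = b` at the base type `B` -/
def Term.eq (B : BaseTy S.Data) (h : FirstOrder S B) (a b : Term S n) : Term S n :=
  .op (.eq B h) a b

/-- `D ē`, the constructor applied to its first `k` arguments -/
def Term.conApp (T : S.Data) (i : Fin (S.ctors T)) : {k : ℕ} → (Fin k → Term S n) → Term S n
  | 0, _ => .con T i
  | _ + 1, args => .app (Term.conApp T i fun j => args j.castSucc) (args (Fin.last _))

end Abbreviations

theorem firstOrder_int (S : DataSig) : FirstOrder S .int :=
  ⟨{.int}, rfl, fun _ h => by cases h⟩

theorem firstOrder_bool (S : DataSig) : FirstOrder S .bool :=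
  ⟨{.bool}, rfl, fun _ h => by cases h⟩

/-! ### Operational semantics -/

/-- Values: constants, abstractions, constructors applied to values. A primitive that has received
the first of its two arguments (the constant written `c_w`, such as `=_n`) is represented by the
application `c w`, and a constructor may likewise be partially applied. -/
inductive Value {S : DataSig} {n : ℕ} : Term S n → Prop
  | const (c : Const S) : Value (.const c)
  | partialOp {c : Const S} {w : Term S n} : c.arity = 2 → Value w → Value (.app (.const c) w)
  | lam (τ : Ty S n) (e : Term S (n + 1)) : Value (.lam τ e)
  | con (T : S.Data) (i : Fin (S.ctors T)) {k : ℕ} (args : Fin k → Term S n) :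
      k ≤ S.arity T i → (∀ j, Value (args j)) → Value (.conApp T i args)

/-- Fully evaluated data without functions. -/
inductive Ground {S : DataSig} {n : ℕ} : Term S n → Prop
  | bool (b : Bool) : Ground (.const (.bool b))
  | int (z : ℤ) : Ground (.const (.int z))
  | con (T : S.Data) (i : Fin (S.ctors T)) (args : Fin (S.arity T i) → Term S n) :
      (∀ j, Ground (args j)) → Ground (.conApp T i args)

/-- `Delta t r`: the saturated primitive application `t` to values computes to `r`. -/
inductive Delta {S : DataSig} {n : ℕ} : Term S n → Term S n → Prop
  | not (b : Bool) : Delta (.not (.const (.bool b))) (.const (.bool (!b)))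
  | and (b b' : Bool) :
      Delta (.and (.const (.bool b)) (.const (.bool b'))) (.const (.bool (b && b')))
  | lt (z z' : ℤ) :
      Delta (.op .lt (.const (.int z)) (.const (.int z'))) (.const (.bool (decide (z < z'))))
  | add (z z' : ℤ) :
      Delta (.op .add (.const (.int z)) (.const (.int z'))) (.const (.int (z + z')))
  | sub (z z' : ℤ) :
      Delta (.op .sub (.const (.int z)) (.const (.int z'))) (.const (.int (z - z')))
  | eqTrue (B : BaseTy S.Data) (h : FirstOrder S B) {w : Term S n} :
      Ground w → Delta (.eq B h w w) (.const (.bool true))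
  | eqFalse (B : BaseTy S.Data) (h : FirstOrder S B) {w w' : Term S n} :
      Ground w → Ground w' → w ≠ w' → Delta (.eq B h w w') (.const (.bool false))

/-- One evaluation step `p ↪ p'`. The first six rules are the evaluation contexts
`C ::= • | C e | c C | D ē C ē | case x = C of {…}`. -/
inductive Step {S : DataSig} {n : ℕ} : Term S n → Term S n → Prop
  | appFun {f f' a : Term S n} : Step f f' → Step (.app f a) (.app f' a)
  | appConst {c : Const S} {a a' : Term S n} :
      Step a a' → Step (.app (.const c) a) (.app (.const c) a')
  | appPartialOp {c : Const S} {w a a' : Term S n} : c.arity = 2 → Value w →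
      Step a a' → Step (.app (.app (.const c) w) a) (.app (.app (.const c) w) a')
  | appCon {T : S.Data} {i : Fin (S.ctors T)} {k : ℕ} {args : Fin k → Term S n}
      {a a' : Term S n} : k < S.arity T i →
      Step a a' → Step (.app (.conApp T i args) a) (.app (.conApp T i args) a')
  | caseBoolScrut {e e' : Term S n} {a b : Term S (n + 1)} :
      Step e e' → Step (.caseBool e a b) (.caseBool e' a b)
  | caseDataScrut {T : S.Data} {e e' : Term S n}
      {br : (i : Fin (S.ctors T)) → Term S (n + S.arity T i + 1)} :
      Step e e' → Step (.caseData T e br) (.caseData T e' br)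
  | delta {t r : Term S n} : Delta t r → Step t r
  | beta (τ : Ty S n) (e : Term S (n + 1)) (a : Term S n) :
      Step (.app (.lam τ e) a) (e.inst a)
  | caseTrue (a b : Term S (n + 1)) :
      Step (.caseBool (.const (.bool true)) a b) (a.inst (.const (.bool true)))
  | caseFalse (a b : Term S (n + 1)) :
      Step (.caseBool (.const (.bool false)) a b) (b.inst (.const (.bool false)))
  | caseCon (T : S.Data) (i : Fin (S.ctors T)) (args : Fin (S.arity T i) → Term S n)
      (br : (i : Fin (S.ctors T)) → Term S (n + S.arity T i + 1)) :
      Step (.caseData T (.conApp T i args) br)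
        ((br i).subst (snoc (extend Term.var args) (.conApp T i args)))
  | letRec (τ : Ty S (n + 1)) (b p : Term S (n + 1)) :
      Step (.letRec τ b p) (p.inst (.fix b))
  | reflect (τ : Ty S n) (e p : Term S (n + 1)) :
      Step (.reflect τ e p) (p.inst (.fix e))
  | fix (e : Term S (n + 1)) : Step (.fix e) (e.inst (.fix e))

/-- `p ↪* p'` -/
def Steps {S : DataSig} {n : ℕ} : Term S n → Term S n → Prop := Relation.ReflTransGen Step

/-- `p` evaluates to the value `w`. -/
def EvaluatesTo {S : DataSig} {n : ℕ} (p w : Term S n) : Prop := Steps p w ∧ Value w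

/-! ### Simple typing -/

/-- Erasure of refinements and labels. -/
def Ty.erase {S : DataSig} {n : ℕ} : Ty S n → SimpleTy S.Data
  | .base _ B _ => .base B
  | .fn τ₁ τ₂ => .arr τ₁.erase τ₂.erase

def Const.simpleTy {S : DataSig} : Const S → SimpleTy S.Data
  | .bool _ => .base .bool
  | .int _ => .base .int
  | .not => .arr (.base .bool) (.base .bool)
  | .and => .arr (.base .bool) (.arr (.base .bool) (.base .bool))
  | .eq B _ => .arr (.base B) (.arr (.base B) (.base .bool))
  | .lt => .arr (.base .int) (.arr (.base .int) (.base .bool))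
  | .add => .arr (.base .int) (.arr (.base .int) (.base .int))
  | .sub => .arr (.base .int) (.arr (.base .int) (.base .int))

/-- `s₀ → ⋯ → sₖ₋₁ → t` -/
def SimpleTy.arrs {D : Type} : {k : ℕ} → (Fin k → SimpleTy D) → SimpleTy D → SimpleTy D
  | 0, _, t => t
  | _ + 1, s, t => SimpleTy.arrs (fun j => s j.castSucc) (.arr (s (Fin.last _)) t)

/-- The standard simple typing relation `Δ ⊢ e : s`, which ignores refinements. -/
inductive SimplyTyped {S : DataSig} :
    {n : ℕ} → (Fin n → SimpleTy S.Data) → Term S n → SimpleTy S.Data → Prop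
  | var {n : ℕ} {Δ : Fin n → SimpleTy S.Data} (i : Fin n) : SimplyTyped Δ (.var i) (Δ i)
  | const {n : ℕ} {Δ : Fin n → SimpleTy S.Data} (c : Const S) :
      SimplyTyped Δ (.const c) c.simpleTy
  | con {n : ℕ} {Δ : Fin n → SimpleTy S.Data} (T : S.Data) (i : Fin (S.ctors T)) :
      SimplyTyped Δ (.con T i) (.arrs (S.field T i) (.base (.data T)))
  | lam {n : ℕ} {Δ : Fin n → SimpleTy S.Data} {τ : Ty S n} {e : Term S (n + 1)}
      {s : SimpleTy S.Data} :
      SimplyTyped (snoc Δ τ.erase) e s → SimplyTyped Δ (.lam τ e) (.arr τ.erase s)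
  | app {n : ℕ} {Δ : Fin n → SimpleTy S.Data} {f a : Term S n} {s t : SimpleTy S.Data} :
      SimplyTyped Δ f (.arr s t) → SimplyTyped Δ a s → SimplyTyped Δ (.app f a) t
  | caseBool {n : ℕ} {Δ : Fin n → SimpleTy S.Data} {e : Term S n} {a b : Term S (n + 1)}
      {s : SimpleTy S.Data} :
      SimplyTyped Δ e (.base .bool) → SimplyTyped (snoc Δ (.base .bool)) a s →
      SimplyTyped (snoc Δ (.base .bool)) b s → SimplyTyped Δ (.caseBool e a b) s
  | caseData {n : ℕ} {Δ : Fin n → SimpleTy S.Data} {T : S.Data} {e : Term S n}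
      {br : (i : Fin (S.ctors T)) → Term S (n + S.arity T i + 1)} {s : SimpleTy S.Data} :
      SimplyTyped Δ e (.base (.data T)) →
      (∀ i, SimplyTyped (snoc (extend Δ (S.field T i)) (.base (.data T))) (br i) s) →
      SimplyTyped Δ (.caseData T e br) s
  | letRec {n : ℕ} {Δ : Fin n → SimpleTy S.Data} {τ : Ty S (n + 1)} {b p : Term S (n + 1)}
      {s : SimpleTy S.Data} :
      SimplyTyped (snoc Δ τ.erase) b τ.erase → SimplyTyped (snoc Δ τ.erase) p s →
      SimplyTyped Δ (.letRec τ b p) s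
  | reflect {n : ℕ} {Δ : Fin n → SimpleTy S.Data} {τ : Ty S n} {e p : Term S (n + 1)}
      {s : SimpleTy S.Data} :
      SimplyTyped (snoc Δ τ.erase) e τ.erase → SimplyTyped (snoc Δ τ.erase) p s →
      SimplyTyped Δ (.reflect τ e p) s
  | fix {n : ℕ} {Δ : Fin n → SimpleTy S.Data} {e : Term S (n + 1)} {s : SimpleTy S.Data} :
      SimplyTyped (snoc Δ s) e s → SimplyTyped Δ (.fix e) s

/-! ### Denotations -/

/-- `Den τ θ` is the set `⟦θ·τ⟧` of closed terms, for a closing substitution `θ`. -/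
def Den {S : DataSig} {n : ℕ} : Ty S n → (Fin n → Term S 0) → Set (Term S 0)
  | .base l B r, θ => {e | SimplyTyped Fin.elim0 e (.base B) ∧
      (∀ w, EvaluatesTo e w → Steps (r.subst (snoc θ w)) .tt) ∧
      (l = .tot → ∃ w, EvaluatesTo e w)}
  | .fn τ₁ τ₂, θ => {e | SimplyTyped Fin.elim0 e (.arr τ₁.erase τ₂.erase) ∧
      ∀ a ∈ Den τ₁ θ, .app e a ∈ Den τ₂ (snoc θ a)}

/-- Environments, outermost binding first. All types are weakened to the whole scope, so that the
type of a recursive binder may mention the binder itself. -/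
abbrev Ctx (S : DataSig) (n : ℕ) : Type := Fin n → Ty S n

/-- `Γ, x : τ`, where `τ` may mention `x`. -/
def Ctx.snocRec {S : DataSig} {n : ℕ} (Γ : Ctx S n) (τ : Ty S (n + 1)) : Ctx S (n + 1) :=
  snoc (fun i => (Γ i).wk) τ

/-- `Γ, x : τ`. -/
def Ctx.snoc {S : DataSig} {n : ℕ} (Γ : Ctx S n) (τ : Ty S n) : Ctx S (n + 1) :=
  Γ.snocRec τ.wk

/-- The empty environment. -/
def Ctx.empty {S : DataSig} : Ctx S 0 := Fin.elim0

/-- `⟦Γ⟧`, the closing substitutions of `Γ`. -/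
def Ctx.den {S : DataSig} {n : ℕ} (Γ : Ctx S n) : Set (Fin n → Term S 0) :=
  {θ | ∀ i, θ i ∈ Den (Γ i) θ}

/-- Subtyping `Γ ⊢ τ₁ ⪯ τ₂`. -/
inductive Subtype {S : DataSig} : {n : ℕ} → Ctx S n → Ty S n → Ty S n → Prop
  | base {n : ℕ} {Γ : Ctx S n} {l₁ l₂ : Label} {B : BaseTy S.Data} {r₁ r₂ : Term S (n + 1)} :
      (∀ θ ∈ Γ.den, Den (.base l₁ B r₁) θ ⊆ Den (.base l₂ B r₂) θ) →
      Subtype Γ (.base l₁ B r₁) (.base l₂ B r₂)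
  | fn {n : ℕ} {Γ : Ctx S n} {τ₁ τ₁' : Ty S n} {τ₂ τ₂' : Ty S (n + 1)} :
      Subtype Γ τ₁' τ₁ → Subtype (Γ.snoc τ₁') τ₂ τ₂' → Subtype Γ (.fn τ₁ τ₂) (.fn τ₁' τ₂')

/-! ### Types of constants and constructors -/

section ConstantTypes

variable {S : DataSig} {n : ℕ}

/-- `Bˡ`, that is `{v : Bˡ | true}` -/
def Ty.plain (l : Label) (B : BaseTy S.Data) : Ty S n := .base l B .tt

/-- The types of the primitive constants: `{v | v = c}` for literals, and
`x̄ : B̄⇓ → {v : B⇓ | v = c x̄}` for operators. -/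
def Const.ty : Const S → Ty S n
  | .bool b => .base .tot .bool (.eq .bool (firstOrder_bool S) (.var 0) (.const (.bool b)))
  | .int z => .base .tot .int (.eq .int (firstOrder_int S) (.var 0) (.const (.int z)))
  | .not => .fn (.plain .tot .bool)
      (.base .tot .bool (.eq .bool (firstOrder_bool S) (.var 0) (.not (.var 1))))
  | .and => .fn (.plain .tot .bool) (.fn (.plain .tot .bool)
      (.base .tot .bool (.eq .bool (firstOrder_bool S) (.var 0) (.op .and (.var 2) (.var 1)))))
  | .eq B h => .fn (.plain .tot B) (.fn (.plain .tot B)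
      (.base .tot .bool
        (.eq .bool (firstOrder_bool S) (.var 0) (.op (.eq B h) (.var 2) (.var 1)))))
  | .lt => .fn (.plain .tot .int) (.fn (.plain .tot .int)
      (.base .tot .bool (.eq .bool (firstOrder_bool S) (.var 0) (.op .lt (.var 2) (.var 1)))))
  | .add => .fn (.plain .tot .int) (.fn (.plain .tot .int)
      (.base .tot .int (.eq .int (firstOrder_int S) (.var 0) (.op .add (.var 2) (.var 1)))))
  | .sub => .fn (.plain .tot .int) (.fn (.plain .tot .int)
      (.base .tot .int (.eq .int (firstOrder_int S) (.var 0) (.op .sub (.var 2) (.var 1)))))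

/-- A simple type as a trivially refined type; a base type gets the label `l`. -/
def SimpleTy.toTy : Label → SimpleTy S.Data → {n : ℕ} → Ty S n
  | l, .base B, _ => .plain l B
  | _, .arr s t, _ => .fn (SimpleTy.toTy .part s) (SimpleTy.toTy .part t)

/-- `Γ, y₀ : s₀, …, yₖ₋₁ : sₖ₋₁` -/
def Ctx.snocFields (l : Label) (Γ : Ctx S n) : {k : ℕ} → (Fin k → SimpleTy S.Data) → Ctx S (n + k)
  | 0, _ => Γ
  | _ + 1, s => (Ctx.snocFields l Γ fun j => s j.castSucc).snoc ((s (Fin.last _)).toTy l)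

/-- `y₀ : s₀ → ⋯ → yₖ₋₁ : sₖ₋₁ → τ` -/
def Ty.fnFields (l : Label) : {k : ℕ} → (Fin k → SimpleTy S.Data) → Ty S (n + k) → Ty S n
  | 0, _, τ => τ
  | _ + 1, s, τ => Ty.fnFields l (fun j => s j.castSucc) (.fn ((s (Fin.last _)).toTy l) τ)

end ConstantTypes

/-- Data types whose constructors carry an output refinement: `ref T i` is a predicate on the
fields `ȳ` of the `i`-th constructor and on the constructed value `v` (innermost). -/
structure Signature : Type 1 where
  sig : DataSig
  ref : (T : sig.Data) → (i : Fin (sig.ctors T)) → Term sig (sig.arity T i + 1)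

/-- The output refinement of a constructor, in a scope of `n` further outer variables. -/
def Signature.refIn (P : Signature) (n : ℕ) (T : P.sig.Data) (i : Fin (P.sig.ctors T)) :
    Term P.sig (n + P.sig.arity T i + 1) :=
  (P.ref T i).rename (Fin.castLE (by omega))

/-- The type `ȳ : s̄ → {v : Tˡ | r}` of a constructor. With `l = part`, fields and result may
diverge; with `l = tot`, base fields and result are both labelled `⇓`. -/
def Signature.conTy (P : Signature) {n : ℕ} (l : Label) (T : P.sig.Data)
    (i : Fin (P.sig.ctors T)) : Ty P.sig n :=
  .fnFields l (P.sig.field T i) (.base l (.data T) (P.refIn n T i))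

/-- Every constructor inhabits the denotation of its type (for primitive constants this is a
fact; for the constructors it says that their output refinements are true of them). -/
def Signature.Sound (P : Signature) : Prop :=
  ∀ (T : P.sig.Data) (i : Fin (P.sig.ctors T)),
    Term.con T i ∈ Den (P.conTy .part T i : Ty P.sig 0) Fin.elim0

/-! ### Reflection and recursion -/

/-- `Reflect τ e τ'`: strengthening the result of `τ` with the definition `e` gives `τ'`:
`{v : Bˡ | r}` becomes `{v : Bˡ | r ∧ v = e}`, and at `x : τ₁ → τ₂` with `e = λ x. e'` the result
`τ₂` is strengthened with `e'`. -/
inductive Reflect {S : DataSig} : {n : ℕ} → Ty S n → Term S n → Ty S n → Prop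
  | base {n : ℕ} {l : Label} {B : BaseTy S.Data} (h : FirstOrder S B) {r : Term S (n + 1)}
      {e : Term S n} :
      Reflect (.base l B r) e (.base l B (.and r (.eq B h (.var 0) e.wk)))
  | fn {n : ℕ} {τ₁ σ : Ty S n} {τ₂ τ₂' : Ty S (n + 1)} {e : Term S (n + 1)} :
      Reflect τ₂ e τ₂' → Reflect (.fn τ₁ τ₂) (.lam σ e) (.fn τ₁ τ₂')

/-- The label of the final result of a type. -/
def Ty.resultLabel {S : DataSig} {n : ℕ} : Ty S n → Label
  | .base l _ _ => l
  | .fn _ τ₂ => τ₂.resultLabel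

/-- The argument types of `τ` only use the variables in the range of `ρ` and preceding arguments;
the refinement of the final result may use all variables. -/
def Ty.ArgsAlong {S : DataSig} {n m : ℕ} (ρ : Fin m → Fin n) : Ty S n → Prop
  | .base _ _ _ => True
  | .fn τ₁ τ₂ => (∃ τ₁' : Ty S m, τ₁ = τ₁'.rename ρ) ∧ τ₂.ArgsAlong (liftRen ρ)

/-- Recursive definitions `x : τ = b` that are admitted. At a type whose result may diverge,
nothing is checked, except that `x` does not occur in the argument types of its own type (it may
occur in the result refinement, as it does after reflection). At other types, such as one with a
`⇓` result, unrestricted recursion is unsound, and the termination checker has to accept the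
definition: `fix x. b` inhabits `τ` as soon as `b` maps `τ` to `τ`. -/
def RecursionOk {S : DataSig} {n : ℕ} (Γ : Ctx S n) (τ : Ty S (n + 1)) (b : Term S (n + 1)) :
    Prop :=
  (τ.resultLabel = .part ∧ τ.ArgsAlong Fin.succ) ∨
    ∀ θ ∈ Γ.den,
      (∀ e ∈ Den τ (snoc θ e), b.subst (snoc θ e) ∈ Den τ (snoc θ e)) →
      Term.subst θ (.fix b) ∈ Den τ (snoc θ (Term.subst θ (.fix b)))

/-! ### Typing -/

mutual

/-- Typing `Γ ⊢ p : τ`. -/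
inductive HasType (P : Signature) : {n : ℕ} → Ctx P.sig n → Term P.sig n → Ty P.sig n → Prop
  | var {n : ℕ} {Γ : Ctx P.sig n} (i : Fin n) : HasType P Γ (.var i) (Γ i)
  | const {n : ℕ} {Γ : Ctx P.sig n} (c : Const P.sig) : HasType P Γ (.const c) c.ty
  | con {n : ℕ} {Γ : Ctx P.sig n} (l : Label) (T : P.sig.Data) (i : Fin (P.sig.ctors T)) :
      (l = .tot → ∀ j, ∃ B, P.sig.field T i j = .base B) →
      HasType P Γ (.con T i) (P.conTy l T i)
  | sub {n : ℕ} {Γ : Ctx P.sig n} {p : Term P.sig n} {τ τ' : Ty P.sig n} :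
      HasType P Γ p τ' → Subtype Γ τ' τ → HasType P Γ p τ
  | exact {n : ℕ} {Γ : Ctx P.sig n} {e : Term P.sig n} {l : Label} {B : BaseTy P.sig.Data}
      (h : FirstOrder P.sig B) {r : Term P.sig (n + 1)} :
      HasType P Γ e (.base l B r) →
      HasType P Γ e (.base l B (.and r (.eq B h (.var 0) e.wk)))
  | lam {n : ℕ} {Γ : Ctx P.sig n} {τ₁ : Ty P.sig n} {τ₂ : Ty P.sig (n + 1)}
      {e : Term P.sig (n + 1)} :
      WellFormed P Γ τ₁ → HasType P (Γ.snoc τ₁) e τ₂ → HasType P Γ (.lam τ₁ e) (.fn τ₁ τ₂)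
  | app {n : ℕ} {Γ : Ctx P.sig n} {e a : Term P.sig n} {τ₁ : Ty P.sig n}
      {τ₂ : Ty P.sig (n + 1)} :
      HasType P Γ e (.fn τ₁ τ₂) → HasType P Γ a τ₁ → HasType P Γ (.app e a) (τ₂.inst a)
  /-- A `case` on a scrutinee that may diverge has a type whose result may diverge. -/
  | caseBool {n : ℕ} {Γ : Ctx P.sig n} {e : Term P.sig n} {l : Label} {r : Term P.sig (n + 1)}
      {a b : Term P.sig (n + 1)} {τ : Ty P.sig n} :
      HasType P Γ e (.base l .bool r) → WellFormed P Γ τ → (l = .tot ∨ τ.resultLabel = .part) →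
      HasType P (Γ.snoc (.base l .bool
        (.and r (.eq .bool (firstOrder_bool P.sig) (.var 0) (.const (.bool true)))))) a τ.wk →
      HasType P (Γ.snoc (.base l .bool
        (.and r (.eq .bool (firstOrder_bool P.sig) (.var 0) (.const (.bool false)))))) b τ.wk →
      HasType P Γ (.caseBool e a b) τ
  /-- The variables of a branch are the fields `ȳ : s̄ˡ` and `x : {v : Tˡ | r ∧ rᵢ}`. -/
  | caseData {n : ℕ} {Γ : Ctx P.sig n} {T : P.sig.Data} {e : Term P.sig n} {l : Label}
      {r : Term P.sig (n + 1)}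
      {br : (i : Fin (P.sig.ctors T)) → Term P.sig (n + P.sig.arity T i + 1)} {τ : Ty P.sig n} :
      HasType P Γ e (.base l (.data T) r) → WellFormed P Γ τ →
      (l = .tot ∨ τ.resultLabel = .part) →
      (∀ i, HasType P
        ((Γ.snocFields l (P.sig.field T i)).snoc (.base l (.data T)
          (.and (r.rename (liftRen (wkRen (P.sig.arity T i)))) (P.refIn n T i))))
        (br i) (τ.rename (wkRen (P.sig.arity T i))).wk) →
      HasType P Γ (.caseData T e br) τ
  | letRec {n : ℕ} {Γ : Ctx P.sig n} {τx : Ty P.sig (n + 1)} {b p : Term P.sig (n + 1)}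
      {τ : Ty P.sig n} :
      HasType P (Γ.snocRec τx) b τx → RecursionOk Γ τx b →
      HasType P (Γ.snocRec τx) p τ.wk → WellFormed P Γ τ →
      HasType P Γ (.letRec τx b p) τ
  | reflect {n : ℕ} {Γ : Ctx P.sig n} {τf : Ty P.sig n} {τf' : Ty P.sig (n + 1)}
      {e p : Term P.sig (n + 1)} {τ : Ty P.sig n} :
      Reflect τf.wk e τf' → HasType P Γ (.letRec τf' e p) τ →
      HasType P Γ (.reflect τf e p) τ
  | fix {n : ℕ} {Γ : Ctx P.sig n} {τx : Ty P.sig (n + 1)} {b : Term P.sig (n + 1)} :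
      HasType P (Γ.snocRec τx) b τx → RecursionOk Γ τx b →
      HasType P Γ (.fix b) (τx.inst (.fix b))

/-- Well-formedness `Γ ⊢ τ`: all refinements are terminating boolean terms. -/
inductive WellFormed (P : Signature) : {n : ℕ} → Ctx P.sig n → Ty P.sig n → Prop
  | base {n : ℕ} {Γ : Ctx P.sig n} {l : Label} {B : BaseTy P.sig.Data} {r : Term P.sig (n + 1)} :
      HasType P (Γ.snoc (.plain .tot B)) r (.plain .tot .bool) →
      WellFormed P Γ (.base l B r)
  | fn {n : ℕ} {Γ : Ctx P.sig n} {τ₁ : Ty P.sig n} {τ₂ : Ty P.sig (n + 1)} :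
      WellFormed P Γ τ₁ → WellFormed P (Γ.snoc τ₁) τ₂ → WellFormed P Γ (.fn τ₁ τ₂)

end

end RefinementReflection

namespace RefinementReflection

/-! ### Renaming and substitution lemmas -/

section SyntaxLemmas

variable {S : DataSig}

@[simp] theorem snoc_succ {A : Type} {n : ℕ} (σ : Fin n → A) (a : A) (i : Fin n) :
    snoc σ a i.succ = σ i := rfl

theorem snoc_ext {A : Type} {n : ℕ} {f g : Fin (n + 1) → A} (h0 : f 0 = g 0)
    (hs : ∀ i : Fin n, f i.succ = g i.succ) : f = g :=
  funext fun i => Fin.cases h0 hs i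

theorem comp_snoc {A B : Type} {n : ℕ} (f : A → B) (σ : Fin n → A) (a : A) :
    (fun i => f (snoc σ a i)) = snoc (fun i => f (σ i)) (f a) :=
  snoc_ext rfl fun _ => rfl

theorem liftRen_comp {n m k : ℕ} (ρ : Fin n → Fin m) (ρ' : Fin m → Fin k) :
    (fun i => liftRen ρ' (liftRen ρ i)) = liftRen fun i => ρ' (ρ i) :=
  snoc_ext rfl fun _ => rfl

theorem liftRenN_comp {n m k : ℕ} (ρ : Fin n → Fin m) (ρ' : Fin m → Fin k) (j : ℕ) :
    (fun i => liftRenN ρ' j (liftRenN ρ j i)) = liftRenN (fun i => ρ' (ρ i)) j := by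
  induction j with
  | zero => rfl
  | succ j ih => simp only [liftRenN, ← ih]; exact liftRen_comp _ _

mutual

theorem Term.rename_rename {n m k : ℕ} (ρ : Fin n → Fin m) (ρ' : Fin m → Fin k) :
    ∀ t : Term S n, (t.rename ρ).rename ρ' = t.rename fun i => ρ' (ρ i)
  | .var i => rfl
  | .const c => rfl
  | .con T i => rfl
  | .lam τ e => by
      simp only [Term.rename, τ.rename_rename, e.rename_rename, liftRen_comp]
  | .app f a => by simp only [Term.rename, f.rename_rename, a.rename_rename]
  | .caseBool e a b => by
      simp only [Term.rename, e.rename_rename, a.rename_rename, b.rename_rename, liftRen_comp]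
  | .caseData T e br => by
      simp only [Term.rename, e.rename_rename, (br _).rename_rename, liftRen_comp, liftRenN_comp]
  | .letRec τ b p => by
      simp only [Term.rename, τ.rename_rename, b.rename_rename, p.rename_rename, liftRen_comp]
  | .reflect τ b p => by
      simp only [Term.rename, τ.rename_rename, b.rename_rename, p.rename_rename, liftRen_comp]
  | .fix e => by simp only [Term.rename, e.rename_rename, liftRen_comp]

theorem Ty.rename_rename {n m k : ℕ} (ρ : Fin n → Fin m) (ρ' : Fin m → Fin k) :
    ∀ t : Ty S n, (t.rename ρ).rename ρ' = t.rename fun i => ρ' (ρ i)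
  | .base l B r => by simp only [Ty.rename, r.rename_rename, liftRen_comp]
  | .fn τ₁ τ₂ => by simp only [Ty.rename, τ₁.rename_rename, τ₂.rename_rename, liftRen_comp]

end

theorem liftSub_liftRen {n m k : ℕ} (ρ : Fin n → Fin m) (σ : Fin m → Term S k) :
    (fun i => liftSub σ (liftRen ρ i)) = liftSub fun i => σ (ρ i) :=
  snoc_ext rfl fun _ => rfl

theorem liftSubN_liftRenN {n m k : ℕ} (ρ : Fin n → Fin m) (σ : Fin m → Term S k) (j : ℕ) :
    (fun i => liftSubN σ j (liftRenN ρ j i)) = liftSubN (fun i => σ (ρ i)) j := by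
  induction j with
  | zero => rfl
  | succ j ih => simp only [liftRenN, liftSubN, ← ih]; exact liftSub_liftRen _ _

mutual

theorem Term.rename_subst {n m k : ℕ} (ρ : Fin n → Fin m) (σ : Fin m → Term S k) :
    ∀ t : Term S n, (t.rename ρ).subst σ = t.subst fun i => σ (ρ i)
  | .var i => rfl
  | .const c => rfl
  | .con T i => rfl
  | .lam τ e => by
      simp only [Term.rename, Term.subst, τ.rename_subst, e.rename_subst, liftSub_liftRen]
  | .app f a => by simp only [Term.rename, Term.subst, f.rename_subst, a.rename_subst]
  | .caseBool e a b => by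
      simp only [Term.rename, Term.subst, e.rename_subst, a.rename_subst, b.rename_subst,
        liftSub_liftRen]
  | .caseData T e br => by
      simp only [Term.rename, Term.subst, e.rename_subst, (br _).rename_subst, liftSub_liftRen,
        liftSubN_liftRenN]
  | .letRec τ b p => by
      simp only [Term.rename, Term.subst, τ.rename_subst, b.rename_subst, p.rename_subst,
        liftSub_liftRen]
  | .reflect τ b p => by
      simp only [Term.rename, Term.subst, τ.rename_subst, b.rename_subst, p.rename_subst,
        liftSub_liftRen]
  | .fix e => by simp only [Term.rename, Term.subst, e.rename_subst, liftSub_liftRen]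

theorem Ty.rename_subst {n m k : ℕ} (ρ : Fin n → Fin m) (σ : Fin m → Term S k) :
    ∀ t : Ty S n, (t.rename ρ).subst σ = t.subst fun i => σ (ρ i)
  | .base l B r => by simp only [Ty.rename, Ty.subst, r.rename_subst, liftSub_liftRen]
  | .fn τ₁ τ₂ => by
      simp only [Ty.rename, Ty.subst, τ₁.rename_subst, τ₂.rename_subst, liftSub_liftRen]

end

theorem Term.wk_rename {n m : ℕ} (ρ : Fin n → Fin m) (t : Term S n) :
    t.wk.rename (liftRen ρ) = (t.rename ρ).wk := by
  simp only [Term.wk, Term.rename_rename]; rfl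

theorem Ty.wk_rename {n m : ℕ} (ρ : Fin n → Fin m) (t : Ty S n) :
    t.wk.rename (liftRen ρ) = (t.rename ρ).wk := by
  simp only [Ty.wk, Ty.rename_rename]; rfl

theorem liftSub_rename {n m k : ℕ} (σ : Fin n → Term S m) (ρ : Fin m → Fin k) :
    (fun i => (liftSub σ i).rename (liftRen ρ)) = liftSub fun i => (σ i).rename ρ :=
  snoc_ext rfl fun i => Term.wk_rename ρ (σ i)

theorem liftSubN_rename {n m k : ℕ} (σ : Fin n → Term S m) (ρ : Fin m → Fin k) (j : ℕ) :
    (fun i => (liftSubN σ j i).rename (liftRenN ρ j)) = liftSubN (fun i => (σ i).rename ρ) j := by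
  induction j with
  | zero => rfl
  | succ j ih => simp only [liftRenN, liftSubN, ← ih]; exact liftSub_rename _ _

mutual

theorem Term.subst_rename {n m k : ℕ} (σ : Fin n → Term S m) (ρ : Fin m → Fin k) :
    ∀ t : Term S n, (t.subst σ).rename ρ = t.subst fun i => (σ i).rename ρ
  | .var i => rfl
  | .const c => rfl
  | .con T i => rfl
  | .lam τ e => by
      simp only [Term.rename, Term.subst, τ.subst_rename, e.subst_rename, liftSub_rename]
  | .app f a => by simp only [Term.rename, Term.subst, f.subst_rename, a.subst_rename]
  | .caseBool e a b => by
      simp only [Term.rename, Term.subst, e.subst_rename, a.subst_rename, b.subst_rename,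
        liftSub_rename]
  | .caseData T e br => by
      simp only [Term.rename, Term.subst, e.subst_rename, (br _).subst_rename, liftSub_rename,
        liftSubN_rename]
  | .letRec τ b p => by
      simp only [Term.rename, Term.subst, τ.subst_rename, b.subst_rename, p.subst_rename,
        liftSub_rename]
  | .reflect τ b p => by
      simp only [Term.rename, Term.subst, τ.subst_rename, b.subst_rename, p.subst_rename,
        liftSub_rename]
  | .fix e => by simp only [Term.rename, Term.subst, e.subst_rename, liftSub_rename]

theorem Ty.subst_rename {n m k : ℕ} (σ : Fin n → Term S m) (ρ : Fin m → Fin k) :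
    ∀ t : Ty S n, (t.subst σ).rename ρ = t.subst fun i => (σ i).rename ρ
  | .base l B r => by simp only [Ty.rename, Ty.subst, r.subst_rename, liftSub_rename]
  | .fn τ₁ τ₂ => by
      simp only [Ty.rename, Ty.subst, τ₁.subst_rename, τ₂.subst_rename, liftSub_rename]

end

theorem Term.wk_subst {n m : ℕ} (σ : Fin (n + 1) → Term S m) (t : Term S n) :
    t.wk.subst σ = t.subst fun i => σ i.succ := Term.rename_subst _ _ _

theorem Ty.wk_subst {n m : ℕ} (σ : Fin (n + 1) → Term S m) (t : Ty S n) :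
    t.wk.subst σ = t.subst fun i => σ i.succ := Ty.rename_subst _ _ _

theorem Term.wk_subst_liftSub {n m : ℕ} (σ : Fin n → Term S m) (t : Term S n) :
    t.wk.subst (liftSub σ) = (t.subst σ).wk := by
  rw [Term.wk_subst, Term.wk, Term.subst_rename]; rfl

theorem Ty.wk_subst_liftSub {n m : ℕ} (σ : Fin n → Term S m) (t : Ty S n) :
    t.wk.subst (liftSub σ) = (t.subst σ).wk := by
  rw [Ty.wk_subst, Ty.wk, Ty.subst_rename]; rfl

theorem liftSub_comp {n m k : ℕ} (σ : Fin n → Term S m) (σ' : Fin m → Term S k) :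
    (fun i => (liftSub σ i).subst (liftSub σ')) = liftSub fun i => (σ i).subst σ' :=
  snoc_ext rfl fun i => Term.wk_subst_liftSub σ' (σ i)

theorem liftSubN_comp {n m k : ℕ} (σ : Fin n → Term S m) (σ' : Fin m → Term S k) (j : ℕ) :
    (fun i => (liftSubN σ j i).subst (liftSubN σ' j)) =
      liftSubN (fun i => (σ i).subst σ') j := by
  induction j with
  | zero => rfl
  | succ j ih => simp only [liftSubN, ← ih]; exact liftSub_comp _ _

mutual

theorem Term.subst_subst {n m k : ℕ} (σ : Fin n → Term S m) (σ' : Fin m → Term S k) :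
    ∀ t : Term S n, (t.subst σ).subst σ' = t.subst fun i => (σ i).subst σ'
  | .var i => rfl
  | .const c => rfl
  | .con T i => rfl
  | .lam τ e => by
      simp only [Term.subst, τ.subst_subst, e.subst_subst, liftSub_comp]
  | .app f a => by simp only [Term.subst, f.subst_subst, a.subst_subst]
  | .caseBool e a b => by
      simp only [Term.subst, e.subst_subst, a.subst_subst, b.subst_subst, liftSub_comp]
  | .caseData T e br => by
      simp only [Term.subst, e.subst_subst, (br _).subst_subst, liftSub_comp, liftSubN_comp]
  | .letRec τ b p => by
      simp only [Term.subst, τ.subst_subst, b.subst_subst, p.subst_subst, liftSub_comp]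
  | .reflect τ b p => by
      simp only [Term.subst, τ.subst_subst, b.subst_subst, p.subst_subst, liftSub_comp]
  | .fix e => by simp only [Term.subst, e.subst_subst, liftSub_comp]

theorem Ty.subst_subst {n m k : ℕ} (σ : Fin n → Term S m) (σ' : Fin m → Term S k) :
    ∀ t : Ty S n, (t.subst σ).subst σ' = t.subst fun i => (σ i).subst σ'
  | .base l B r => by simp only [Ty.subst, r.subst_subst, liftSub_comp]
  | .fn τ₁ τ₂ => by simp only [Ty.subst, τ₁.subst_subst, τ₂.subst_subst, liftSub_comp]

end

theorem liftSub_var {n m : ℕ} (ρ : Fin n → Fin m) :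
    liftSub (fun i => (Term.var (ρ i) : Term S m)) = fun i => .var (liftRen ρ i) :=
  snoc_ext rfl fun _ => rfl

theorem liftSubN_var {n m : ℕ} (ρ : Fin n → Fin m) (j : ℕ) :
    liftSubN (fun i => (Term.var (ρ i) : Term S m)) j = fun i => .var (liftRenN ρ j i) := by
  induction j with
  | zero => rfl
  | succ j ih => simp only [liftSubN, liftRenN, ih]; exact liftSub_var _

mutual

theorem Term.subst_ren {n m : ℕ} (ρ : Fin n → Fin m) :
    ∀ t : Term S n, (t.subst fun i => .var (ρ i)) = t.rename ρ
  | .var i => rfl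
  | .const c => rfl
  | .con T i => rfl
  | .lam τ e => by
      simp only [Term.rename, Term.subst, τ.subst_ren, e.subst_ren, liftSub_var]
  | .app f a => by simp only [Term.rename, Term.subst, f.subst_ren, a.subst_ren]
  | .caseBool e a b => by
      simp only [Term.rename, Term.subst, e.subst_ren, a.subst_ren, b.subst_ren, liftSub_var]
  | .caseData T e br => by
      simp only [Term.rename, Term.subst, e.subst_ren, (br _).subst_ren, liftSub_var, liftSubN_var]
  | .letRec τ b p => by
      simp only [Term.rename, Term.subst, τ.subst_ren, b.subst_ren, p.subst_ren, liftSub_var]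
  | .reflect τ b p => by
      simp only [Term.rename, Term.subst, τ.subst_ren, b.subst_ren, p.subst_ren, liftSub_var]
  | .fix e => by simp only [Term.rename, Term.subst, e.subst_ren, liftSub_var]

theorem Ty.subst_ren {n m : ℕ} (ρ : Fin n → Fin m) :
    ∀ t : Ty S n, (t.subst fun i => .var (ρ i)) = t.rename ρ
  | .base l B r => by simp only [Ty.rename, Ty.subst, r.subst_ren, liftSub_var]
  | .fn τ₁ τ₂ => by simp only [Ty.rename, Ty.subst, τ₁.subst_ren, τ₂.subst_ren, liftSub_var]

end

theorem liftSub_id {n : ℕ} : liftSub (Term.var : Fin n → Term S n) = Term.var :=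
  snoc_ext rfl fun _ => rfl

theorem liftSubN_id {n : ℕ} (j : ℕ) :
    liftSubN (Term.var : Fin n → Term S n) j = Term.var := by
  induction j with
  | zero => rfl
  | succ j ih => rw [liftSubN, ih, liftSub_id]

mutual

theorem Term.subst_var {n : ℕ} : ∀ t : Term S n, t.subst Term.var = t
  | .var i => rfl
  | .const c => rfl
  | .con T i => rfl
  | .lam τ e => by simp only [Term.subst, liftSub_id, τ.subst_var, e.subst_var]
  | .app f a => by simp only [Term.subst, f.subst_var, a.subst_var]
  | .caseBool e a b => by
      simp only [Term.subst, liftSub_id, e.subst_var, a.subst_var, b.subst_var]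
  | .caseData T e br => by
      simp only [Term.subst, liftSub_id, liftSubN_id, e.subst_var, (br _).subst_var]
  | .letRec τ b p => by simp only [Term.subst, liftSub_id, τ.subst_var, b.subst_var, p.subst_var]
  | .reflect τ b p => by simp only [Term.subst, liftSub_id, τ.subst_var, b.subst_var, p.subst_var]
  | .fix e => by simp only [Term.subst, liftSub_id, e.subst_var]

theorem Ty.subst_var {n : ℕ} : ∀ t : Ty S n, t.subst Term.var = t
  | .base l B r => by simp only [Ty.subst, liftSub_id, r.subst_var]
  | .fn τ₁ τ₂ => by simp only [Ty.subst, liftSub_id, τ₁.subst_var, τ₂.subst_var]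

end

theorem Term.wk_inst {n : ℕ} (t a : Term S n) : t.wk.inst a = t := by
  rw [Term.inst, Term.wk_subst]; exact t.subst_var

theorem Ty.wk_inst {n : ℕ} (t : Ty S n) (a : Term S n) : t.wk.inst a = t := by
  rw [Ty.inst, Ty.wk_subst]; exact t.subst_var

theorem liftSub_snoc {n m k : ℕ} (σ : Fin n → Term S m) (θ : Fin m → Term S k) (a : Term S k) :
    (fun i => (liftSub σ i).subst (snoc θ a)) = snoc (fun i => (σ i).subst θ) a :=
  snoc_ext rfl fun i => by
    simp only [liftSub, snoc_succ, Term.wk_subst]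

theorem Term.subst_liftSub_snoc {n m k : ℕ} (t : Term S (n + 1)) (σ : Fin n → Term S m)
    (θ : Fin m → Term S k) (a : Term S k) :
    (t.subst (liftSub σ)).subst (snoc θ a) = t.subst (snoc (fun i => (σ i).subst θ) a) := by
  rw [Term.subst_subst, liftSub_snoc]

theorem Ty.subst_liftSub_snoc {n m k : ℕ} (t : Ty S (n + 1)) (σ : Fin n → Term S m)
    (θ : Fin m → Term S k) (a : Term S k) :
    (t.subst (liftSub σ)).subst (snoc θ a) = t.subst (snoc (fun i => (σ i).subst θ) a) := by
  rw [Ty.subst_subst, liftSub_snoc]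

theorem snoc_var_subst {n m : ℕ} (a : Term S n) (σ : Fin n → Term S m) :
    (fun i => (snoc Term.var a i).subst σ) = snoc σ (a.subst σ) :=
  snoc_ext rfl fun _ => rfl

theorem Term.inst_subst {n m : ℕ} (t : Term S (n + 1)) (a : Term S n) (σ : Fin n → Term S m) :
    (t.inst a).subst σ = t.subst (snoc σ (a.subst σ)) := by
  rw [Term.inst, Term.subst_subst, snoc_var_subst]

theorem Ty.inst_subst {n m : ℕ} (t : Ty S (n + 1)) (a : Term S n) (σ : Fin n → Term S m) :
    (t.inst a).subst σ = t.subst (snoc σ (a.subst σ)) := by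
  rw [Ty.inst, Ty.subst_subst, snoc_var_subst]

theorem Term.subst_liftSub_inst {n m : ℕ} (t : Term S (n + 1)) (a : Term S m)
    (σ : Fin n → Term S m) : (t.subst (liftSub σ)).inst a = t.subst (snoc σ a) := by
  rw [Term.inst, Term.subst_liftSub_snoc]; simp only [Term.subst_var]

theorem Ty.subst_liftSub_inst {n m : ℕ} (t : Ty S (n + 1)) (a : Term S m)
    (σ : Fin n → Term S m) : (t.subst (liftSub σ)).inst a = t.subst (snoc σ a) := by
  rw [Ty.inst, Ty.subst_liftSub_snoc]; simp only [Term.subst_var]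

theorem Term.inst_subst_liftSub {n m : ℕ} (t : Term S (n + 1)) (a : Term S n)
    (σ : Fin n → Term S m) : (t.inst a).subst σ = (t.subst (liftSub σ)).inst (a.subst σ) := by
  rw [Term.inst_subst, Term.subst_liftSub_inst]

theorem Ty.inst_subst_liftSub {n m : ℕ} (t : Ty S (n + 1)) (a : Term S n)
    (σ : Fin n → Term S m) : (t.inst a).subst σ = (t.subst (liftSub σ)).inst (a.subst σ) := by
  rw [Ty.inst_subst, Ty.subst_liftSub_inst]

theorem Term.conApp_subst {n m : ℕ} (σ : Fin n → Term S m) (T : S.Data) (i : Fin (S.ctors T))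
    {k : ℕ} (args : Fin k → Term S n) :
    (Term.conApp T i args).subst σ = Term.conApp T i fun j => (args j).subst σ := by
  induction k with
  | zero => rfl
  | succ k ih => simp only [Term.conApp, Term.subst, ih]

theorem extend_subst {n m k j : ℕ} (σ : Fin n → Term S m) (args : Fin j → Term S m)
    (σ' : Fin m → Term S k) :
    (fun i => (extend σ args i).subst σ') =
      extend (fun i => (σ i).subst σ') fun i => (args i).subst σ' := by
  induction j with
  | zero => rfl
  | succ j ih =>
    exact (comp_snoc (Term.subst σ') _ _).trans (congrArg (fun f => snoc f _) (ih _))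

theorem liftSubN_extend {n m k j : ℕ} (σ : Fin n → Term S m) (θ : Fin m → Term S k)
    (args : Fin j → Term S k) :
    (fun i => (liftSubN σ j i).subst (extend θ args)) = extend (fun i => (σ i).subst θ) args := by
  induction j with
  | zero => rfl
  | succ j ih => exact (liftSub_snoc _ _ _).trans (congrArg (fun f => snoc f _) (ih _))

theorem extend_wkRen {A : Type} {n k : ℕ} (θ : Fin n → A) (args : Fin k → A) (i : Fin n) :
    extend θ args (wkRen k i) = θ i := by
  induction k with
  | zero => rfl
  | succ k ih => simp only [extend, wkRen, snoc_succ, ih]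

theorem Term.branch_subst {n m k j : ℕ} (t : Term S (n + j + 1)) (σ : Fin n → Term S m)
    (θ : Fin m → Term S k) (args : Fin j → Term S k) (a : Term S k) :
    (t.subst (liftSub (liftSubN σ j))).subst (snoc (extend θ args) a) =
      t.subst (snoc (extend (fun i => (σ i).subst θ) args) a) := by
  rw [Term.subst_liftSub_snoc, liftSubN_extend]

theorem Term.branch_inst_subst {n m j : ℕ} (t : Term S (n + j + 1)) (σ : Fin n → Term S m)
    (args : Fin j → Term S n) (a : Term S n) :
    (t.subst (snoc (extend Term.var args) a)).subst σ =
      (t.subst (liftSub (liftSubN σ j))).subst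
        (snoc (extend Term.var fun i => (args i).subst σ) (a.subst σ)) := by
  rw [Term.branch_subst, Term.subst_subst, comp_snoc (fun t => Term.subst σ t), extend_subst]
  simp only [Term.subst_var]; rfl

end SyntaxLemmas

/-! ### Applied constructors -/

section Evaluation

variable {S : DataSig}

/-- The constructor and the arguments of an applied constructor. -/
def Term.conView : {n : ℕ} → Term S n →
    Option ((T : S.Data) × Fin (S.ctors T) × List (Term S n))
  | _, .con T i => some ⟨T, i, []⟩
  | _, .app f a => f.conView.map fun x => ⟨x.1, x.2.1, x.2.2 ++ [a]⟩
  | _, _ => none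

theorem Term.conView_conApp {n : ℕ} (T : S.Data) (i : Fin (S.ctors T)) {k : ℕ}
    (args : Fin k → Term S n) : (Term.conApp T i args).conView = some ⟨T, i, List.ofFn args⟩ := by
  induction k with
  | zero => simp [Term.conApp, Term.conView]
  | succ k ih =>
    rw [Term.conApp, Term.conView, ih, List.ofFn_succ', List.concat_eq_append]; rfl

theorem Term.conApp_inj {n : ℕ} {T T' : S.Data} {i : Fin (S.ctors T)} {i' : Fin (S.ctors T')}
    {k k' : ℕ} {args : Fin k → Term S n} {args' : Fin k' → Term S n}
    (h : Term.conApp T i args = Term.conApp T' i' args') :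
    T = T' ∧ i ≍ i' ∧ k = k' ∧ args ≍ args' := by
  have h := congrArg Term.conView h
  rw [Term.conView_conApp, Term.conView_conApp, Option.some.injEq] at h
  cases h' : List.ofFn args with
  | _ =>
    have hl : (⟨T, i, List.ofFn args⟩ :
      (T : S.Data) × Fin (S.ctors T) × List (Term S n)).2.2.length = List.length _ :=
        congrArg (fun x => x.2.2.length) h
    simp only [List.length_ofFn] at hl
    obtain ⟨rfl, h2⟩ := Sigma.mk.inj h
    have h2 := Prod.mk.inj (eq_of_heq h2)
    subst hl
    exact ⟨rfl, heq_of_eq h2.1, rfl, heq_of_eq (List.ofFn_injective h2.2)⟩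

theorem Term.app_eq_conApp {n : ℕ} {f a : Term S n} {T : S.Data} {i : Fin (S.ctors T)} {k : ℕ}
    {args : Fin k → Term S n} (h : Term.app f a = Term.conApp T i args) :
    ∃ (j : ℕ) (_ : k = j + 1) (args' : Fin (j + 1) → Term S n), args ≍ args' ∧
      f = Term.conApp T i (fun x => args' x.castSucc) ∧ a = args' (Fin.last j) := by
  cases k with
  | zero => cases h
  | succ k =>
    rw [Term.conApp, Term.app.injEq] at h
    exact ⟨k, rfl, args, HEq.rfl, h.1, h.2⟩

theorem Term.conApp_ne {n : ℕ} {t : Term S n} (ht : t.conView = none) {T : S.Data}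
    {i : Fin (S.ctors T)} {k : ℕ} {args : Fin k → Term S n} : t ≠ Term.conApp T i args := by
  rintro rfl
  rw [Term.conView_conApp] at ht
  cases ht

/-! ### Ground terms and primitive steps -/

theorem Ground.value {n : ℕ} {w : Term S n} (h : Ground w) : Value w := by
  induction h with
  | bool b => exact .const _
  | int z => exact .const _
  | con T i args _ ih => exact .con T i args le_rfl ih

theorem Ground.subst {n m : ℕ} (σ : Fin n → Term S m) {w : Term S n} (h : Ground w) :
    Ground (w.subst σ) := by
  induction h with
  | bool b => exact .bool b
  | int z => exact .int z
  | con T i args _ ih => rw [Term.conApp_subst]; exact .con T i _ ih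

theorem Ground.subst_inj {n m : ℕ} (σ : Fin n → Term S m) {w : Term S n} (h : Ground w) :
    ∀ {w'}, Ground w' → w.subst σ = w'.subst σ → w = w' := by
  induction h with
  | bool b =>
    rintro _ (_ | _ | _) he
    · simpa [Term.subst] using he
    · simp [Term.subst] at he
    · rw [Term.conApp_subst] at he; exact absurd he (Term.conApp_ne rfl)
  | int b =>
    rintro _ (_ | _ | _) he
    · simp [Term.subst] at he
    · simpa [Term.subst] using he
    · rw [Term.conApp_subst] at he; exact absurd he (Term.conApp_ne rfl)
  | con T i args _ ih =>
    rintro _ (_ | _ | ⟨T', i', args', h'⟩) he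
    · rw [Term.conApp_subst] at he; exact absurd he.symm (Term.conApp_ne rfl)
    · rw [Term.conApp_subst] at he; exact absurd he.symm (Term.conApp_ne rfl)
    · rw [Term.conApp_subst, Term.conApp_subst] at he
      obtain ⟨rfl, hi, -, ha⟩ := Term.conApp_inj he
      obtain rfl := eq_of_heq hi
      have ha := eq_of_heq ha
      congr 1
      exact funext fun j => ih j (h' j) (congrFun ha j)

theorem Delta.subst {n m : ℕ} (σ : Fin n → Term S m) {t r : Term S n} (h : Delta t r) :
    Delta (t.subst σ) (r.subst σ) := by
  cases h with
  | not b => exact .not b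
  | and b b' => exact .and b b'
  | lt z z' => exact .lt z z'
  | add z z' => exact .add z z'
  | sub z z' => exact .sub z z'
  | eqTrue B h hw => exact .eqTrue B h (hw.subst σ)
  | eqFalse B h hw hw' hne =>
    exact .eqFalse B h (hw.subst σ) (hw'.subst σ) fun he => hne (hw.subst_inj σ hw' he)

/-- The shape of a saturated primitive application that computes, and of its result. -/
theorem Delta.shape {n : ℕ} {t r : Term S n} (h : Delta t r) :
    ((∃ b, t = .not (.const (.bool b))) ∨
      ∃ c w w', t = .op c w w' ∧ c.arity = 2 ∧ Ground w ∧ Ground w') ∧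
      ∃ d : Const S, r = .const d ∧ d.arity = 0 := by
  cases h with
  | not b => exact ⟨.inl ⟨b, rfl⟩, _, rfl, rfl⟩
  | and b b' => exact ⟨.inr ⟨_, _, _, rfl, rfl, .bool b, .bool b'⟩, _, rfl, rfl⟩
  | lt z z' => exact ⟨.inr ⟨_, _, _, rfl, rfl, .int z, .int z'⟩, _, rfl, rfl⟩
  | add z z' => exact ⟨.inr ⟨_, _, _, rfl, rfl, .int z, .int z'⟩, _, rfl, rfl⟩
  | sub z z' => exact ⟨.inr ⟨_, _, _, rfl, rfl, .int z, .int z'⟩, _, rfl, rfl⟩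
  | eqTrue B h hw => exact ⟨.inr ⟨_, _, _, rfl, rfl, hw, hw⟩, _, rfl, rfl⟩
  | eqFalse B h hw hw' hne => exact ⟨.inr ⟨_, _, _, rfl, rfl, hw, hw'⟩, _, rfl, rfl⟩

theorem Delta.det {n : ℕ} {t r r' : Term S n} (h : Delta t r) (h' : Delta t r') : r = r' := by
  generalize ht : t = t' at h'
  cases h <;> cases h' <;>
    simp only [Term.not, Term.and, Term.eq, Term.op, Term.app.injEq, Term.const.injEq,
      Const.bool.injEq, Const.int.injEq, reduceCtorEq, false_and, and_false] at ht ⊢ <;>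
    grind

/-- The function part of a saturated primitive application is a value. -/
theorem Delta.app_value {n : ℕ} {f a r : Term S n} (h : Delta (.app f a) r) :
    Value f ∧ Value a ∧ f.conView = none := by
  obtain ⟨⟨b, h⟩ | ⟨c, w, w', h, hc, hw, hw'⟩, -⟩ := h.shape
  · cases h; exact ⟨.const _, .const _, rfl⟩
  · cases h; exact ⟨.partialOp hc hw.value, hw'.value, rfl⟩

theorem Value.app_inv {n : ℕ} {f a : Term S n} (h : Value (.app f a)) : Value f ∧ Value a := by
  generalize ht : Term.app f a = t at h
  cases h with
  | const c => cases ht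
  | partialOp hc hw => cases ht; exact ⟨.const _, hw⟩
  | lam τ e => cases ht
  | con T i args hk ha =>
    obtain ⟨j, rfl, args', he, rfl, rfl⟩ := Term.app_eq_conApp ht
    obtain rfl := eq_of_heq he
    exact ⟨.con T i _ (by omega) fun x => ha _, ha _⟩

theorem Value.subst {n m : ℕ} (σ : Fin n → Term S m) {w : Term S n} (h : Value w) :
    Value (w.subst σ) := by
  induction h with
  | const c => exact .const c
  | partialOp hc _ ih => exact .partialOp hc ih
  | lam τ e => exact .lam _ _
  | con T i args hk _ ih => rw [Term.conApp_subst]; exact .con T i _ hk ih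

theorem Value.view {n : ℕ} {w : Term S n} (h : Value w) :
    (∃ c, w = .const c) ∨ (∃ τ e, w = .lam τ e) ∨ (∃ c a, c.arity = 2 ∧ w = .app (.const c) a) ∨
      w.conView ≠ none := by
  cases h with
  | const c => exact .inl ⟨c, rfl⟩
  | partialOp hc hw => exact .inr (.inr (.inl ⟨_, _, hc, rfl⟩))
  | lam τ e => exact .inr (.inl ⟨_, _, rfl⟩)
  | con T i args hk _ => exact .inr (.inr (.inr (by simp [Term.conView_conApp])))

theorem Value.not_step {n : ℕ} {w t : Term S n} (h : Value w) : ¬ Step w t := by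
  intro hs
  induction hs with
  | appFun _ ih => exact ih h.app_inv.1
  | appConst _ ih => exact ih h.app_inv.2
  | appPartialOp _ _ _ ih => exact ih h.app_inv.2
  | appCon _ _ ih => exact ih h.app_inv.2
  | delta hd =>
    obtain ⟨⟨b, rfl⟩ | ⟨c, w, w', rfl, hc, hw, hw'⟩, -⟩ := hd.shape
    · obtain ⟨c, h⟩ | ⟨τ, e, h⟩ | ⟨c, a, hc, h⟩ | h := h.view
      · cases h
      · cases h
      · cases h; cases hc
      · exact h rfl
    · obtain ⟨c, h⟩ | ⟨τ, e, h⟩ | ⟨c, a, hc, h⟩ | h := h.view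
      · cases h
      · cases h
      · cases h
      · exact h rfl
  | _ =>
    obtain ⟨c, h⟩ | ⟨τ, e, h⟩ | ⟨c, a, hc, h⟩ | h := h.view
    · cases h
    · cases h
    · cases h
    · exact h rfl

theorem Value.steps_eq {n : ℕ} {w t : Term S n} (h : Value w) (hs : Steps w t) : t = w := by
  cases hs.cases_head with
  | inl h => exact h.symm
  | inr h' => obtain ⟨_, h', _⟩ := h'; exact absurd h' h.not_step

/-! ### Congruence of evaluation -/

theorem Step.subst {n m : ℕ} (σ : Fin n → Term S m) {t t' : Term S n} (h : Step t t') :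
    Step (t.subst σ) (t'.subst σ) := by
  induction h with
  | appFun _ ih => exact .appFun ih
  | appConst _ ih => exact .appConst ih
  | appPartialOp hc hw _ ih => exact .appPartialOp hc (hw.subst σ) ih
  | appCon hk _ ih => 
    simp only [Term.subst, Term.conApp_subst]; exact .appCon hk ih
  | caseBoolScrut _ ih => exact .caseBoolScrut ih
  | caseDataScrut _ ih => exact .caseDataScrut ih
  | delta hd => exact .delta (hd.subst σ)
  | beta τ e a => rw [Term.inst_subst_liftSub]; exact .beta _ _ _
  | caseTrue a b => rw [Term.inst_subst_liftSub]; exact .caseTrue _ _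
  | caseFalse a b => rw [Term.inst_subst_liftSub]; exact .caseFalse _ _
  | caseCon T i args br =>
    rw [Term.branch_inst_subst]
    simp only [Term.subst, Term.conApp_subst]
    exact .caseCon T i _ fun i => (br i).subst (liftSub (liftSubN σ (S.arity T i)))
  | letRec τ b p => rw [Term.inst_subst_liftSub]; exact .letRec _ _ _
  | reflect τ b p => rw [Term.inst_subst_liftSub]; exact .reflect _ _ _
  | fix e => rw [Term.inst_subst_liftSub]; exact .fix _

theorem Steps.map {n m : ℕ} {f : Term S n → Term S m}
    (hf : ∀ t t', Step t t' → Step (f t) (f t')) {t t' : Term S n} (h : Steps t t') :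
    Steps (f t) (f t') :=
  Relation.ReflTransGen.lift f hf _ _ h

theorem Steps.subst {n m : ℕ} (σ : Fin n → Term S m) {t t' : Term S n} (h : Steps t t') :
    Steps (t.subst σ) (t'.subst σ) := h.map fun _ _ => Step.subst σ

theorem Steps.appFun {n : ℕ} {f f' : Term S n} (a : Term S n) (h : Steps f f') :
    Steps (.app f a) (.app f' a) := h.map (f := (Term.app · a)) fun _ _ => .appFun

theorem Steps.appConst {n : ℕ} (c : Const S) {a a' : Term S n} (h : Steps a a') :
    Steps (.app (.const c) a) (.app (.const c) a') := h.map fun _ _ => .appConst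

theorem Steps.caseBool {n : ℕ} {e e' : Term S n} (a b : Term S (n + 1)) (h : Steps e e') :
    Steps (.caseBool e a b) (.caseBool e' a b) :=
  h.map (f := (Term.caseBool · a b)) fun _ _ => .caseBoolScrut

theorem Steps.caseData {n : ℕ} {T : S.Data} {e e' : Term S n}
    (br : (i : Fin (S.ctors T)) → Term S (n + S.arity T i + 1)) (h : Steps e e') :
    Steps (.caseData T e br) (.caseData T e' br) :=
  h.map (f := (Term.caseData T · br)) fun _ _ => .caseDataScrut

theorem Steps.op {n : ℕ} {c : Const S} {a a' b b' : Term S n} (hc : c.arity = 2)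
    (ha : Steps a a') (hv : Value a') (hb : Steps b b') : Steps (.op c a b) (.op c a' b') :=
  ((ha.appConst c).appFun b).trans (hb.map fun _ _ => .appPartialOp hc hv)

theorem Steps.conApp {n : ℕ} {T : S.Data} {i : Fin (S.ctors T)} {k : ℕ}
    {args args' : Fin k → Term S n} (hk : k ≤ S.arity T i) (h : ∀ j, Steps (args j) (args' j)) :
    Steps (.conApp T i args) (.conApp T i args') := by
  induction k with
  | zero => rw [show args = args' from funext fun j => j.elim0]; exact .refl
  | succ k ih =>
    exact ((ih (Nat.le_of_succ_le hk) fun j => h j.castSucc).appFun _).trans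
      ((h (Fin.last k)).map fun _ _ => .appCon hk)

/-! ### Parallel reduction -/

/-- Parallel reduction, under binders as well. It ignores type annotations. -/
inductive Par : {n : ℕ} → Term S n → Term S n → Prop
  | var {n : ℕ} (i : Fin n) : Par (.var i) (.var i)
  | const {n : ℕ} (c : Const S) : Par (.const c : Term S n) (.const c)
  | con {n : ℕ} (T : S.Data) (i : Fin (S.ctors T)) : Par (.con T i : Term S n) (.con T i)
  | lam {n : ℕ} (τ τ' : Ty S n) {e e' : Term S (n + 1)} : Par e e' → Par (.lam τ e) (.lam τ' e')
  | app {n : ℕ} {f f' a a' : Term S n} : Par f f' → Par a a' → Par (.app f a) (.app f' a')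
  | caseBool {n : ℕ} {e e' : Term S n} {a a' b b' : Term S (n + 1)} :
      Par e e' → Par a a' → Par b b' → Par (.caseBool e a b) (.caseBool e' a' b')
  | caseData {n : ℕ} {T : S.Data} {e e' : Term S n}
      {br br' : (i : Fin (S.ctors T)) → Term S (n + S.arity T i + 1)} :
      Par e e' → (∀ i, Par (br i) (br' i)) → Par (.caseData T e br) (.caseData T e' br')
  | letRec {n : ℕ} (τ τ' : Ty S (n + 1)) {b b' p p' : Term S (n + 1)} :
      Par b b' → Par p p' → Par (.letRec τ b p) (.letRec τ' b' p')
  | reflect {n : ℕ} (τ τ' : Ty S n) {b b' p p' : Term S (n + 1)} :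
      Par b b' → Par p p' → Par (.reflect τ b p) (.reflect τ' b' p')
  | fix {n : ℕ} {e e' : Term S (n + 1)} : Par e e' → Par (.fix e) (.fix e')
  | delta {n : ℕ} {t r : Term S n} : Delta t r → Par t r
  | beta {n : ℕ} (τ : Ty S n) {e e' : Term S (n + 1)} {a a' : Term S n} :
      Par e e' → Par a a' → Par (.app (.lam τ e) a) (e'.inst a')
  | caseTrue {n : ℕ} {a a' : Term S (n + 1)} (b : Term S (n + 1)) : Par a a' →
      Par (.caseBool (.const (.bool true)) a b) (a'.inst (.const (.bool true)))
  | caseFalse {n : ℕ} (a : Term S (n + 1)) {b b' : Term S (n + 1)} : Par b b' →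
      Par (.caseBool (.const (.bool false)) a b) (b'.inst (.const (.bool false)))
  | caseCon {n : ℕ} {T : S.Data} {i : Fin (S.ctors T)} {args args' : Fin (S.arity T i) → Term S n}
      (br : (i : Fin (S.ctors T)) → Term S (n + S.arity T i + 1))
      {b' : Term S (n + S.arity T i + 1)} :
      (∀ j, Par (args j) (args' j)) → Par (br i) b' →
      Par (.caseData T (.conApp T i args) br)
        (b'.subst (snoc (extend Term.var args') (.conApp T i args')))
  | letRecStep {n : ℕ} (τ : Ty S (n + 1)) {b b' p p' : Term S (n + 1)} :
      Par b b' → Par p p' → Par (.letRec τ b p) (p'.inst (.fix b'))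
  | reflectStep {n : ℕ} (τ : Ty S n) {b b' p p' : Term S (n + 1)} :
      Par b b' → Par p p' → Par (.reflect τ b p) (p'.inst (.fix b'))
  | fixStep {n : ℕ} {e e' : Term S (n + 1)} : Par e e' → Par (.fix e) (e'.inst (.fix e'))

theorem Par.refl : ∀ {n : ℕ} (t : Term S n), Par t t
  | _, .var i => .var i
  | _, .const c => .const c
  | _, .con T i => .con T i
  | _, .lam τ e => .lam τ τ (Par.refl e)
  | _, .app f a => .app (Par.refl f) (Par.refl a)
  | _, .caseBool e a b => .caseBool (Par.refl e) (Par.refl a) (Par.refl b)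
  | _, .caseData _ e br => .caseData (Par.refl e) fun i => Par.refl (br i)
  | _, .letRec τ b p => .letRec τ τ (Par.refl b) (Par.refl p)
  | _, .reflect τ b p => .reflect τ τ (Par.refl b) (Par.refl p)
  | _, .fix e => .fix (Par.refl e)

theorem Par.conApp {n : ℕ} {T : S.Data} {i : Fin (S.ctors T)} {k : ℕ}
    {args args' : Fin k → Term S n} (h : ∀ j, Par (args j) (args' j)) :
    Par (.conApp T i args) (.conApp T i args') := by
  induction k with
  | zero => exact .con T i
  | succ k ih => exact .app (ih fun j => h _) (h _)

/-- Parallel reduction is stable under every class of pairs of substitutions that is closed under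
passing a binder. -/
theorem Par.subst_of {K : ∀ {n m : ℕ}, (Fin n → Term S m) → (Fin n → Term S m) → Prop}
    (hpar : ∀ {n m : ℕ} {σ σ' : Fin n → Term S m}, K σ σ' → ∀ i, Par (σ i) (σ' i))
    (hlift : ∀ {n m : ℕ} {σ σ' : Fin n → Term S m}, K σ σ' → K (liftSub σ) (liftSub σ'))
    {n : ℕ} {t t' : Term S n} (h : Par t t') :
    ∀ {m : ℕ} {σ σ' : Fin n → Term S m}, K σ σ' → Par (t.subst σ) (t'.subst σ') := by
  have hliftN : ∀ {n m : ℕ} {σ σ' : Fin n → Term S m} (j : ℕ), K σ σ' →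
      K (liftSubN σ j) (liftSubN σ' j) := by
    intro n m σ σ' j hK
    induction j with
    | zero => exact hK
    | succ j ih => exact hlift ih
  induction h with
  | var i => exact fun hK => hpar hK i
  | const c => exact fun _ => .const c
  | con T i => exact fun _ => .con T i
  | lam τ τ' _ ih => exact fun hK => .lam _ _ (ih (hlift hK))
  | app _ _ ihf iha => exact fun hK => .app (ihf hK) (iha hK)
  | caseBool _ _ _ ihe iha ihb =>
    exact fun hK => .caseBool (ihe hK) (iha (hlift hK)) (ihb (hlift hK))
  | caseData _ _ ihe ihb =>
    exact fun hK => .caseData (ihe hK) fun i => ihb i (hlift (hliftN _ hK))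
  | letRec τ τ' _ _ ihb ihp => exact fun hK => .letRec _ _ (ihb (hlift hK)) (ihp (hlift hK))
  | reflect τ τ' _ _ ihb ihp => exact fun hK => .reflect _ _ (ihb (hlift hK)) (ihp (hlift hK))
  | fix _ ih => exact fun hK => .fix (ih (hlift hK))
  | @delta n t r hd =>
    intro m σ σ' _
    obtain ⟨-, d, rfl, -⟩ := hd.shape
    exact .delta (hd.subst σ)
  | beta τ _ _ ihe iha =>
    intro m σ σ' hK
    rw [Term.inst_subst_liftSub]
    exact .beta _ (ihe (hlift hK)) (iha hK)
  | caseTrue b _ ih =>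
    intro m σ σ' hK
    rw [Term.inst_subst_liftSub]
    exact .caseTrue _ (ih (hlift hK))
  | caseFalse a _ ih =>
    intro m σ σ' hK
    rw [Term.inst_subst_liftSub]
    exact .caseFalse _ (ih (hlift hK))
  | @caseCon n T i args args' br b' _ _ iha ihb =>
    intro m σ σ' hK
    rw [Term.branch_inst_subst]
    simp only [Term.subst, Term.conApp_subst]
    exact .caseCon (fun i => (br i).subst (liftSub (liftSubN σ (S.arity T i))))
      (fun j => iha j hK) (ihb (hlift (hliftN _ hK)))
  | letRecStep τ _ _ ihb ihp =>
    intro m σ σ' hK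
    rw [Term.inst_subst_liftSub]
    exact .letRecStep _ (ihb (hlift hK)) (ihp (hlift hK))
  | reflectStep τ _ _ ihb ihp =>
    intro m σ σ' hK
    rw [Term.inst_subst_liftSub]
    exact .reflectStep _ (ihb (hlift hK)) (ihp (hlift hK))
  | fixStep _ ih =>
    intro m σ σ' hK
    rw [Term.inst_subst_liftSub]
    exact .fixStep (ih (hlift hK))

theorem Par.rename {n m : ℕ} (ρ : Fin n → Fin m) {t t' : Term S n} (h : Par t t') :
    Par (t.rename ρ) (t'.rename ρ) := by
  rw [← Term.subst_ren, ← Term.subst_ren]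
  refine h.subst_of (K := fun {n m} σ σ' => σ = σ' ∧ ∃ ρ : Fin n → Fin m,
    σ = fun i => .var (ρ i)) ?_ ?_ ⟨rfl, ρ, rfl⟩
  · rintro n m σ _ ⟨rfl, _⟩ i; exact .refl _
  · rintro n m σ _ ⟨rfl, ρ, rfl⟩; exact ⟨rfl, liftRen ρ, liftSub_var ρ⟩

theorem Par.liftSub {n m : ℕ} {σ σ' : Fin n → Term S m} (h : ∀ i, Par (σ i) (σ' i)) :
    ∀ i, Par (liftSub σ i) (liftSub σ' i) :=
  Fin.cases (.var 0) fun i => (h i).rename _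

theorem Par.subst {n m : ℕ} {σ σ' : Fin n → Term S m} (hσ : ∀ i, Par (σ i) (σ' i))
    {t t' : Term S n} (h : Par t t') : Par (t.subst σ) (t'.subst σ') :=
  h.subst_of (K := fun σ σ' => ∀ i, Par (σ i) (σ' i)) id Par.liftSub hσ

theorem Par.snoc {n m : ℕ} {σ σ' : Fin n → Term S m} (hσ : ∀ i, Par (σ i) (σ' i))
    {a a' : Term S m} (h : Par a a') : ∀ i, Par (snoc σ a i) (snoc σ' a' i) :=
  Fin.cases h hσ

theorem Par.extend {n m k : ℕ} {σ σ' : Fin n → Term S m} (hσ : ∀ i, Par (σ i) (σ' i))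
    {args args' : Fin k → Term S m} (h : ∀ j, Par (args j) (args' j)) :
    ∀ i, Par (extend σ args i) (extend σ' args' i) := by
  induction k with
  | zero => exact hσ
  | succ k ih => exact Par.snoc (ih fun j => h _) (h _)

theorem Par.inst {n : ℕ} {t t' : Term S (n + 1)} {a a' : Term S n} (h : Par t t')
    (ha : Par a a') : Par (t.inst a) (t'.inst a') :=
  h.subst (Par.snoc (fun _ => .refl _) ha)

theorem Step.par {n : ℕ} {t t' : Term S n} (h : Step t t') : Par t t' := by
  induction h with
  | appFun _ ih => exact .app ih (.refl _)
  | appConst _ ih => exact .app (.refl _) ih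
  | appPartialOp _ _ _ ih => exact .app (.refl _) ih
  | appCon _ _ ih => exact .app (.refl _) ih
  | caseBoolScrut _ ih => exact .caseBool ih (.refl _) (.refl _)
  | caseDataScrut _ ih => exact .caseData ih fun _ => .refl _
  | delta hd => exact .delta hd
  | beta τ e a => exact .beta τ (.refl _) (.refl _)
  | caseTrue a b => exact .caseTrue b (.refl _)
  | caseFalse a b => exact .caseFalse a (.refl _)
  | caseCon T i args br => exact .caseCon br (fun _ => .refl _) (.refl _)
  | letRec τ b p => exact .letRecStep τ (.refl _) (.refl _)
  | reflect τ b p => exact .reflectStep τ (.refl _) (.refl _)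
  | fix e => exact .fixStep (.refl _)

theorem Par.conApp_inv {n : ℕ} {T : S.Data} {i : Fin (S.ctors T)} {k : ℕ}
    {args : Fin k → Term S n} {t : Term S n} (h : Par (.conApp T i args) t) :
    ∃ args', t = .conApp T i args' ∧ ∀ j, Par (args j) (args' j) := by
  induction k generalizing t with
  | zero =>
    rw [Term.conApp] at h
    cases h with
    | con => exact ⟨args, rfl, fun _ => .refl _⟩
    | delta hd =>
      obtain ⟨⟨b, h⟩ | ⟨c, w, w', h, -⟩, -⟩ := hd.shape <;> cases h
  | succ k ih =>
    rw [Term.conApp] at h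
    generalize hf : Term.conApp T i (fun j => args j.castSucc) = f at h
    cases h with
    | app hf' ha =>
      subst hf
      obtain ⟨args', rfl, h'⟩ := ih hf'
      rename_i a'
      refine ⟨Fin.snoc (α := fun _ => Term S n) args' a', ?_, Fin.lastCases ?_ fun j => ?_⟩
      · simp [Term.conApp]
      · simpa using ha
      · simpa using h' j
    | delta hd => exact absurd hf.symm (Term.conApp_ne hd.app_value.2.2)
    | beta => exact absurd hf.symm (Term.conApp_ne rfl)

theorem Par.ground {n : ℕ} {w t : Term S n} (hw : Ground w) (h : Par w t) : t = w := by
  induction hw generalizing t with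
  | bool b =>
    cases h with
    | const => rfl
    | delta hd => obtain ⟨⟨b, h⟩ | ⟨c, w, w', h, -⟩, -⟩ := hd.shape <;> cases h
  | int b =>
    cases h with
    | const => rfl
    | delta hd => obtain ⟨⟨b, h⟩ | ⟨c, w, w', h, -⟩, -⟩ := hd.shape <;> cases h
  | con T i args _ ih =>
    obtain ⟨args', rfl, h'⟩ := h.conApp_inv
    rw [show args' = args from funext fun j => ih j (h' j)]

theorem Par.const_inv {n : ℕ} {c : Const S} {t : Term S n} (h : Par (.const c) t) :
    t = .const c := by
  cases h with
  | const => rfl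
  | delta hd => obtain ⟨⟨b, h⟩ | ⟨c, w, w', h, -⟩, -⟩ := hd.shape <;> cases h

theorem Par.delta_inv {n : ℕ} {t r t' : Term S n} (hd : Delta t r) (h : Par t t') :
    t' = t ∨ t' = r := by
  obtain ⟨⟨b, rfl⟩ | ⟨c, w, w', rfl, hc, hw, hw'⟩, -⟩ := hd.shape
  · rw [Term.not] at h
    generalize hg : Term.app (Term.const Const.not) (.const (.bool b)) = g at h
    cases h <;> cases hg
    · rename_i h h'
      rw [h.const_inv, h'.const_inv]; exact .inl rfl
    · rename_i h; exact .inr (h.det hd)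
  · rw [Term.op] at h
    cases h with
    | app h h' =>
      cases h with
      | app h h'' => rw [h.const_inv, h'.ground hw', h''.ground hw]; exact .inl rfl
      | delta hd' =>
        obtain ⟨⟨b, h⟩ | ⟨c, w, w', h, -⟩, -⟩ := hd'.shape <;> cases h
        cases hc
    | delta hd' => exact .inr (hd'.det hd)

end Evaluation

section Standardization

variable {S : DataSig}

/-! ### Standardization -/

/-- Parallel reduction that contracts no redex at the head. -/
inductive HPar : {n : ℕ} → Term S n → Term S n → Prop
  | var {n : ℕ} (i : Fin n) : HPar (.var i) (.var i)
  | const {n : ℕ} (c : Const S) : HPar (.const c : Term S n) (.const c)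
  | con {n : ℕ} (T : S.Data) (i : Fin (S.ctors T)) : HPar (.con T i : Term S n) (.con T i)
  | lam {n : ℕ} (τ τ' : Ty S n) {e e' : Term S (n + 1)} : Par e e' → HPar (.lam τ e) (.lam τ' e')
  | app {n : ℕ} {f f' a a' : Term S n} : HPar f f' → Par a a' → HPar (.app f a) (.app f' a')
  | caseBool {n : ℕ} {e e' : Term S n} {a a' b b' : Term S (n + 1)} :
      HPar e e' → Par a a' → Par b b' → HPar (.caseBool e a b) (.caseBool e' a' b')
  | caseData {n : ℕ} {T : S.Data} {e e' : Term S n}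
      {br br' : (i : Fin (S.ctors T)) → Term S (n + S.arity T i + 1)} :
      HPar e e' → (∀ i, Par (br i) (br' i)) → HPar (.caseData T e br) (.caseData T e' br')
  | letRec {n : ℕ} (τ τ' : Ty S (n + 1)) {b b' p p' : Term S (n + 1)} :
      Par b b' → Par p p' → HPar (.letRec τ b p) (.letRec τ' b' p')
  | reflect {n : ℕ} (τ τ' : Ty S n) {b b' p p' : Term S (n + 1)} :
      Par b b' → Par p p' → HPar (.reflect τ b p) (.reflect τ' b' p')
  | fix {n : ℕ} {e e' : Term S (n + 1)} : Par e e' → HPar (.fix e) (.fix e')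

theorem HPar.conApp {n : ℕ} {T : S.Data} {i : Fin (S.ctors T)} {k : ℕ}
    {args args' : Fin k → Term S n} (h : ∀ j, Par (args j) (args' j)) :
    HPar (.conApp T i args) (.conApp T i args') := by
  induction k with
  | zero => exact .con T i
  | succ k ih => exact .app (ih fun j => h _) (h _)

theorem HPar.conApp_inv {n : ℕ} {T : S.Data} {i : Fin (S.ctors T)} {k : ℕ}
    {args : Fin k → Term S n} {t : Term S n} (h : HPar t (.conApp T i args)) :
    ∃ args', t = .conApp T i args' ∧ ∀ j, Par (args' j) (args j) := by
  induction k generalizing t with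
  | zero =>
    rw [Term.conApp] at h
    cases h
    exact ⟨args, rfl, fun _ => .refl _⟩
  | succ k ih =>
    rw [Term.conApp] at h
    cases h with
    | @app _ _ a' _ hf ha =>
      obtain ⟨args', rfl, h'⟩ := ih hf
      refine ⟨Fin.snoc (α := fun _ => Term S n) args' a', ?_, Fin.lastCases ?_ fun j => ?_⟩
      · simp [Term.conApp]
      · simpa using ha
      · simpa using h' j

theorem HPar.par {n : ℕ} {t t' : Term S n} (h : HPar t t') : Par t t' := by
  induction h with
  | var i => exact .var i
  | const c => exact .const c
  | con T i => exact .con T i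
  | lam τ τ' he => exact .lam _ _ he
  | app _ ha ih => exact .app ih ha
  | caseBool _ ha hb ih => exact .caseBool ih ha hb
  | caseData _ hb ih => exact .caseData ih hb
  | letRec τ τ' hb hp => exact .letRec _ _ hb hp
  | reflect τ τ' hb hp => exact .reflect _ _ hb hp
  | fix he => exact .fix he

/-- A substitution instance of a head-stable parallel reduction evaluates to one. -/
theorem HPar.subst {n m : ℕ} {σ σ' : Fin n → Term S m} (hσ : ∀ i, Par (σ i) (σ' i))
    (hd : ∀ i, ∃ u, Steps (σ i) u ∧ HPar u (σ' i)) {t t' : Term S n} (h : HPar t t') :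
    ∃ u, Steps (t.subst σ) u ∧ HPar u (t'.subst σ') := by
  have hl := Par.liftSub hσ
  have hlN : ∀ j i, Par (liftSubN σ j i) (liftSubN σ' j i) := by
    intro j
    induction j with
    | zero => exact hσ
    | succ j ih => exact Par.liftSub ih
  induction h with
  | var i => exact hd i
  | const c => exact ⟨_, .refl, .const c⟩
  | con T i => exact ⟨_, .refl, .con T i⟩
  | lam τ τ' he => exact ⟨_, .refl, .lam _ _ (he.subst hl)⟩
  | app _ ha ih =>
    obtain ⟨u, hs, hu⟩ := ih
    exact ⟨_, hs.appFun _, .app hu (ha.subst hσ)⟩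
  | caseBool _ ha hb ih =>
    obtain ⟨u, hs, hu⟩ := ih
    exact ⟨_, hs.caseBool _ _, .caseBool hu (ha.subst hl) (hb.subst hl)⟩
  | caseData _ hb ih =>
    obtain ⟨u, hs, hu⟩ := ih
    exact ⟨_, hs.caseData _, .caseData hu fun i => (hb i).subst (Par.liftSub (hlN _))⟩
  | letRec τ τ' hb hp => exact ⟨_, .refl, .letRec _ _ (hb.subst hl) (hp.subst hl)⟩
  | reflect τ τ' hb hp => exact ⟨_, .refl, .reflect _ _ (hb.subst hl) (hp.subst hl)⟩
  | fix he => exact ⟨_, .refl, .fix (he.subst hl)⟩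

/-- Head redexes of a parallel reduction can be contracted first, by evaluation. -/
theorem Par.steps_hpar {n : ℕ} {t t' : Term S n} (h : Par t t') :
    ∃ u, Steps t u ∧ HPar u t' := by
  have hvar : ∀ {n : ℕ} (i : Fin n), ∃ u, Steps (.var i : Term S n) u ∧ HPar u (.var i) :=
    fun i => ⟨_, .refl, .var i⟩
  have hinst : ∀ {n : ℕ} {e : Term S (n + 1)} {e' : Term S (n + 1)} {a a' : Term S n},
      Par a a' → (∃ u, Steps e u ∧ HPar u e') → (∃ u, Steps a u ∧ HPar u a') →
      ∃ u, Steps (e.inst a) u ∧ HPar u (e'.inst a') := by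
    rintro n e e' a a' ha ⟨u, hs, hu⟩ hda
    obtain ⟨v, hv, hvu⟩ := hu.subst (Par.snoc (fun _ => .refl _) ha)
      (σ := RefinementReflection.snoc Term.var a) (σ' := RefinementReflection.snoc Term.var a')
      (Fin.cases hda hvar)
    exact ⟨v, (hs.subst _).trans hv, hvu⟩
  induction h with
  | var i => exact ⟨_, .refl, .var i⟩
  | const c => exact ⟨_, .refl, .const c⟩
  | con T i => exact ⟨_, .refl, .con T i⟩
  | lam τ τ' he => exact ⟨_, .refl, .lam _ _ he⟩
  | app _ ha ih =>
    obtain ⟨u, hs, hu⟩ := ih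
    exact ⟨_, hs.appFun _, .app hu ha⟩
  | caseBool _ ha hb ih =>
    obtain ⟨u, hs, hu⟩ := ih
    exact ⟨_, hs.caseBool _ _, .caseBool hu ha hb⟩
  | caseData _ hb ih =>
    obtain ⟨u, hs, hu⟩ := ih
    exact ⟨_, hs.caseData _, .caseData hu hb⟩
  | letRec τ τ' hb hp => exact ⟨_, .refl, .letRec _ _ hb hp⟩
  | reflect τ τ' hb hp => exact ⟨_, .refl, .reflect _ _ hb hp⟩
  | fix he => exact ⟨_, .refl, .fix he⟩
  | delta hd =>
    obtain ⟨-, d, rfl, -⟩ := hd.shape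
    exact ⟨_, .single (.delta hd), .const d⟩
  | beta τ _ ha ihe iha =>
    obtain ⟨u, hs, hu⟩ := hinst ha ihe iha
    exact ⟨u, .head (.beta _ _ _) hs, hu⟩
  | caseTrue b _ ih =>
    obtain ⟨u, hs, hu⟩ := hinst (.refl _) ih ⟨_, .refl, .const _⟩
    exact ⟨u, .head (.caseTrue _ _) hs, hu⟩
  | caseFalse b _ ih =>
    obtain ⟨u, hs, hu⟩ := hinst (.refl _) ih ⟨_, .refl, .const _⟩
    exact ⟨u, .head (.caseFalse _ _) hs, hu⟩
  | @caseCon n T i args args' br b' ha _ iha ihb =>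
    obtain ⟨u, hs, hu⟩ := ihb
    have hext : ∀ {k : ℕ} {args args' : Fin k → Term S n},
        (∀ j, ∃ u, Steps (args j) u ∧ HPar u (args' j)) → ∀ l, ∃ u,
        Steps (RefinementReflection.extend Term.var args l) u ∧
          HPar u (RefinementReflection.extend Term.var args' l) := by
      intro k args args' h
      induction k with
      | zero => exact hvar
      | succ k ih => exact Fin.cases (h _) (ih fun j => h _)
    obtain ⟨v, hv, hvu⟩ := hu.subst
      (Par.snoc (Par.extend (fun i => .refl _) ha) (Par.conApp ha))
      (σ := RefinementReflection.snoc (RefinementReflection.extend Term.var args)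
        (.conApp T i args))
      (σ' := RefinementReflection.snoc (RefinementReflection.extend Term.var args')
        (.conApp T i args'))
      (Fin.cases ⟨_, .refl, HPar.conApp ha⟩ (hext iha))
    exact ⟨v, .head (.caseCon _ _ _ _) ((hs.subst _).trans hv), hvu⟩
  | letRecStep τ hb hp _ ihp =>
    obtain ⟨u, hs, hu⟩ := hinst (.fix hb) ihp ⟨_, .refl, .fix hb⟩
    exact ⟨u, .head (.letRec _ _ _) hs, hu⟩
  | reflectStep τ hb hp _ ihp =>
    obtain ⟨u, hs, hu⟩ := hinst (.fix hb) ihp ⟨_, .refl, .fix hb⟩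
    exact ⟨u, .head (.reflect _ _ _) hs, hu⟩
  | fixStep he ih =>
    obtain ⟨u, hs, hu⟩ := hinst (.fix he) ih ⟨_, .refl, .fix he⟩
    exact ⟨u, .head (.fix _) hs, hu⟩

theorem Par.steps_of_value {n : ℕ} {t w : Term S n} (hw : Value w) (h : Par t w) :
    ∃ w', Steps t w' ∧ Value w' ∧ Par w' w := by
  induction hw generalizing t with
  | const c =>
    obtain ⟨u, hs, hu⟩ := h.steps_hpar
    cases hu
    exact ⟨_, hs, .const c, .const c⟩
  | partialOp hc _ ih =>
    obtain ⟨u, hs, hu⟩ := h.steps_hpar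
    cases hu with
    | app hf ha =>
      cases hf
      obtain ⟨a', hsa, hva, hpa⟩ := ih ha
      exact ⟨_, hs.trans (hsa.appConst _), .partialOp hc hva, .app (.const _) hpa⟩
  | lam τ e =>
    obtain ⟨u, hs, hu⟩ := h.steps_hpar
    cases hu with
    | lam _ _ he => exact ⟨_, hs, .lam _ _, .lam _ _ he⟩
  | con T i args hk _ ih =>
    obtain ⟨u, hs, hu⟩ := h.steps_hpar
    obtain ⟨args', rfl, ha⟩ := hu.conApp_inv
    choose args'' hs' hv' hp' using fun j => ih j (ha j)
    exact ⟨_, hs.trans (Steps.conApp hk hs'), .con T i _ hk hv', .conApp hp'⟩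

theorem Par.steps_of_ground {n : ℕ} {t w : Term S n} (hw : Ground w) (h : Par t w) :
    Steps t w := by
  induction hw generalizing t with
  | bool b =>
    obtain ⟨u, hs, hu⟩ := h.steps_hpar
    cases hu
    exact hs
  | int z =>
    obtain ⟨u, hs, hu⟩ := h.steps_hpar
    cases hu
    exact hs
  | con T i args _ ih =>
    obtain ⟨u, hs, hu⟩ := h.steps_hpar
    obtain ⟨args', rfl, ha⟩ := hu.conApp_inv
    exact hs.trans (Steps.conApp le_rfl fun j => ih j (ha j))

/-- Evaluation is postponed after parallel reduction. -/
theorem Par.step_backward {n : ℕ} {t t' u' : Term S n} (h : Par t t') (hs : Step t' u') :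
    ∃ u, Steps t u ∧ Par u u' := by
  induction hs generalizing t with
  | appFun _ ih =>
    obtain ⟨u, hs, hu⟩ := h.steps_hpar
    cases hu with
    | app hf ha =>
      obtain ⟨f, hf', hp⟩ := ih hf.par
      exact ⟨_, hs.trans (hf'.appFun _), .app hp ha⟩
  | appConst _ ih =>
    obtain ⟨u, hs, hu⟩ := h.steps_hpar
    cases hu with
    | app hf ha =>
      cases hf
      obtain ⟨a, ha', hp⟩ := ih ha
      exact ⟨_, hs.trans (ha'.appConst _), .app (.const _) hp⟩
  | appPartialOp hc hw _ ih =>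
    obtain ⟨u, hs, hu⟩ := h.steps_hpar
    cases hu with
    | app hf ha =>
      cases hf with
      | app hf hx =>
        cases hf
        obtain ⟨x, hsx, hvx, hpx⟩ := hx.steps_of_value hw
        obtain ⟨a, ha', hp⟩ := ih ha
        exact ⟨_, hs.trans (Steps.op hc hsx hvx ha'), .app (.app (.const _) hpx) hp⟩
  | appCon hk _ ih =>
    obtain ⟨u, hs, hu⟩ := h.steps_hpar
    cases hu with
    | app hf ha =>
      obtain ⟨args, rfl, hargs⟩ := hf.conApp_inv
      obtain ⟨a, ha', hp⟩ := ih ha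
      exact ⟨_, hs.trans (ha'.map fun _ _ => .appCon hk), .app (.conApp hargs) hp⟩
  | caseBoolScrut _ ih =>
    obtain ⟨u, hs, hu⟩ := h.steps_hpar
    cases hu with
    | caseBool he ha hb =>
      obtain ⟨e, he', hp⟩ := ih he.par
      exact ⟨_, hs.trans (he'.caseBool _ _), .caseBool hp ha hb⟩
  | caseDataScrut _ ih =>
    obtain ⟨u, hs, hu⟩ := h.steps_hpar
    cases hu with
    | caseData he hb =>
      obtain ⟨e, he', hp⟩ := ih he.par
      exact ⟨_, hs.trans (he'.caseData _), .caseData hp hb⟩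
  | delta hd =>
    obtain ⟨u, hs, hu⟩ := h.steps_hpar
    refine ⟨_, hs.trans ?_, .refl _⟩
    obtain ⟨⟨b, rfl⟩ | ⟨c, w, w', rfl, hc, hw, hw'⟩, -⟩ := hd.shape
    · cases hu with
      | app hf ha =>
        cases hf
        exact ((ha.steps_of_ground (.bool b)).appConst _).tail (.delta hd)
    · cases hu with
      | app hf ha =>
        cases hf with
        | app hf hx =>
          cases hf
          exact (Steps.op hc (hx.steps_of_ground hw) hw.value (ha.steps_of_ground hw')).tail
            (.delta hd)
  | beta τ e a =>
    obtain ⟨u, hs, hu⟩ := h.steps_hpar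
    cases hu with
    | app hf ha =>
      cases hf with
      | lam _ _ he => exact ⟨_, hs.tail (.beta _ _ _), he.inst ha⟩
  | caseTrue a b =>
    obtain ⟨u, hs, hu⟩ := h.steps_hpar
    cases hu with
    | caseBool he ha hb =>
      cases he
      exact ⟨_, hs.tail (.caseTrue _ _), ha.inst (.refl _)⟩
  | caseFalse a b =>
    obtain ⟨u, hs, hu⟩ := h.steps_hpar
    cases hu with
    | caseBool he ha hb =>
      cases he
      exact ⟨_, hs.tail (.caseFalse _ _), hb.inst (.refl _)⟩
  | caseCon T i args br =>
    obtain ⟨u, hs, hu⟩ := h.steps_hpar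
    cases hu with
    | caseData he hb =>
      obtain ⟨args', rfl, ha⟩ := he.conApp_inv
      exact ⟨_, hs.tail (.caseCon _ _ _ _),
        (hb i).subst (Par.snoc (Par.extend (fun _ => .refl _) ha) (Par.conApp ha))⟩
  | letRec τ b p =>
    obtain ⟨u, hs, hu⟩ := h.steps_hpar
    cases hu with
    | letRec _ _ hb hp => exact ⟨_, hs.tail (.letRec _ _ _), hp.inst (.fix hb)⟩
  | reflect τ b p =>
    obtain ⟨u, hs, hu⟩ := h.steps_hpar
    cases hu with
    | reflect _ _ hb hp => exact ⟨_, hs.tail (.reflect _ _ _), hp.inst (.fix hb)⟩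
  | fix e =>
    obtain ⟨u, hs, hu⟩ := h.steps_hpar
    cases hu with
    | fix he => exact ⟨_, hs.tail (.fix _), he.inst (.fix he)⟩

theorem Par.steps_backward {n : ℕ} {t t' u' : Term S n} (h : Par t t') (hs : Steps t' u') :
    ∃ u, Steps t u ∧ Par u u' := by
  induction hs with
  | refl => exact ⟨t, .refl, h⟩
  | tail _ hs ih =>
    obtain ⟨u, hu, hp⟩ := ih
    obtain ⟨v, hv, hp'⟩ := hp.step_backward hs
    exact ⟨v, hu.trans hv, hp'⟩

theorem Step.conApp_inv {n : ℕ} {T : S.Data} {i : Fin (S.ctors T)} {k : ℕ}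
    {args : Fin k → Term S n} {t : Term S n} (h : Step (.conApp T i args) t) :
    ∃ args' : Fin k → Term S n, t = .conApp T i args' := by
  induction k generalizing t with
  | zero =>
    rw [Term.conApp] at h
    cases h with
    | delta hd => obtain ⟨⟨b, h⟩ | ⟨c, w, w', h, -⟩, -⟩ := hd.shape <;> cases h
  | succ k ih =>
    rw [Term.conApp] at h
    generalize hf : Term.conApp T i (fun j => args j.castSucc) = f at h
    have key : ∀ a (args' : Fin k → Term S n), ∃ args'' : Fin (k + 1) → Term S n,
        Term.app (.conApp T i args') a = .conApp T i args'' := fun a args' =>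
      ⟨Fin.snoc (α := fun _ => Term S n) args' a, by simp [Term.conApp]⟩
    cases h with
    | appFun hs =>
      subst hf
      obtain ⟨args', rfl⟩ := ih hs
      exact key _ _
    | appConst => exact absurd hf.symm (Term.conApp_ne rfl)
    | appPartialOp => exact absurd hf.symm (Term.conApp_ne rfl)
    | appCon hk hs => rw [← hf]; exact key _ _
    | delta hd => exact absurd hf.symm (Term.conApp_ne hd.app_value.2.2)
    | beta => exact absurd hf.symm (Term.conApp_ne rfl)

/-- A parallel reduction and an evaluation step can be joined. -/
theorem Par.step_join {n : ℕ} {t t' u : Term S n} (h : Par t t') (hs : Step t u) :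
    ∃ v, Par u v ∧ Par t' v := by
  induction hs generalizing t' with
  | appFun hs ih =>
    cases h with
    | app hf ha =>
      obtain ⟨v, h1, h2⟩ := ih hf
      exact ⟨_, .app h1 ha, .app h2 (.refl _)⟩
    | delta hd => exact absurd hs hd.app_value.1.not_step
    | beta => exact absurd hs (Value.lam _ _).not_step
  | appConst hs ih =>
    cases h with
    | app hf ha =>
      obtain ⟨v, h1, h2⟩ := ih ha
      exact ⟨_, .app hf h1, .app (.refl _) h2⟩
    | delta hd => exact absurd hs hd.app_value.2.1.not_step
  | appPartialOp hc hw hs ih =>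
    cases h with
    | app hf ha =>
      obtain ⟨v, h1, h2⟩ := ih ha
      exact ⟨_, .app hf h1, .app (.refl _) h2⟩
    | delta hd => exact absurd hs hd.app_value.2.1.not_step
  | @appCon T i k args a a' hk hs ih =>
    generalize hg : Term.conApp T i args = g at h
    cases h with
    | app hf ha =>
      obtain ⟨v, h1, h2⟩ := ih ha
      exact ⟨_, .app hf h1, .app (.refl _) h2⟩
    | delta hd => exact absurd hs hd.app_value.2.1.not_step
    | beta => exact absurd hg.symm (Term.conApp_ne rfl)
  | caseBoolScrut hs ih =>
    cases h with
    | caseBool he ha hb =>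
      obtain ⟨v, h1, h2⟩ := ih he
      exact ⟨_, .caseBool h1 ha hb, .caseBool h2 (.refl _) (.refl _)⟩
    | delta hd => obtain ⟨⟨b, h⟩ | ⟨c, w, w', h, -⟩, -⟩ := hd.shape <;> cases h
    | caseTrue => exact absurd hs (Value.const _).not_step
    | caseFalse => exact absurd hs (Value.const _).not_step
  | @caseDataScrut T e e' br hs ih =>
    generalize hg : e = g at h
    cases h with
    | caseData he hb =>
      obtain ⟨v, h1, h2⟩ := ih (hg ▸ he)
      exact ⟨_, .caseData h1 hb, .caseData h2 fun _ => .refl _⟩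
    | delta hd => obtain ⟨⟨b, h⟩ | ⟨c, w, w', h, -⟩, -⟩ := hd.shape <;> cases h
    | @caseCon _ _ i args args' _ b' ha hb =>
      subst hg
      obtain ⟨args₁, rfl⟩ := hs.conApp_inv
      obtain ⟨v, h1, h2⟩ := ih (Par.conApp ha)
      obtain ⟨args₂, rfl, h1'⟩ := h1.conApp_inv
      obtain ⟨args₃, he, h2⟩ := h2.conApp_inv
      obtain ⟨-, -, -, he⟩ := Term.conApp_inj he
      obtain rfl := eq_of_heq he
      exact ⟨_, .caseCon _ h1' hb, Par.subst
        (Par.snoc (Par.extend (fun _ => .refl _) h2) (Par.conApp h2)) (.refl _)⟩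
  | delta hd =>
    obtain rfl | rfl := h.delta_inv hd
    · exact ⟨_, .refl _, .delta hd⟩
    · exact ⟨_, .refl _, .refl _⟩
  | beta τ e a =>
    cases h with
    | app hf ha =>
      cases hf with
      | lam _ _ he => exact ⟨_, he.inst ha, .beta _ (.refl _) (.refl _)⟩
      | delta hd => obtain ⟨⟨b, h⟩ | ⟨c, w, w', h, -⟩, -⟩ := hd.shape <;> cases h
    | delta hd => obtain ⟨⟨b, h⟩ | ⟨c, w, w', h, -⟩, -⟩ := hd.shape <;> cases h
    | beta _ he ha => exact ⟨_, he.inst ha, .refl _⟩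
  | caseTrue a b =>
    cases h with
    | caseBool he ha hb =>
      rw [he.const_inv]; exact ⟨_, ha.inst (.refl _), .caseTrue _ (.refl _)⟩
    | delta hd => obtain ⟨⟨b, h⟩ | ⟨c, w, w', h, -⟩, -⟩ := hd.shape <;> cases h
    | caseTrue _ ha => exact ⟨_, ha.inst (.refl _), .refl _⟩
  | caseFalse a b =>
    cases h with
    | caseBool he ha hb =>
      rw [he.const_inv]; exact ⟨_, hb.inst (.refl _), .caseFalse _ (.refl _)⟩
    | delta hd => obtain ⟨⟨b, h⟩ | ⟨c, w, w', h, -⟩, -⟩ := hd.shape <;> cases h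
    | caseFalse _ hb => exact ⟨_, hb.inst (.refl _), .refl _⟩
  | caseCon T i args br =>
    generalize hg : Term.conApp T i args = g at h
    cases h with
    | caseData he hb =>
      subst hg
      obtain ⟨args', rfl, ha⟩ := he.conApp_inv
      exact ⟨_, (hb i).subst (Par.snoc (Par.extend (fun _ => .refl _) ha) (Par.conApp ha)),
        .caseCon _ (fun _ => .refl _) (.refl _)⟩
    | delta hd => obtain ⟨⟨b, h⟩ | ⟨c, w, w', h, -⟩, -⟩ := hd.shape <;> cases h
    | caseCon _ ha hb =>
      obtain ⟨-, hi, -, he⟩ := Term.conApp_inj hg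
      obtain rfl := eq_of_heq hi
      obtain rfl := eq_of_heq he
      exact ⟨_, hb.subst (Par.snoc (Par.extend (fun _ => .refl _) ha) (Par.conApp ha)), .refl _⟩
  | letRec τ b p =>
    cases h with
    | letRec _ _ hb hp =>
      exact ⟨_, hp.inst (.fix hb), .letRecStep _ (.refl _) (.refl _)⟩
    | delta hd => obtain ⟨⟨b, h⟩ | ⟨c, w, w', h, -⟩, -⟩ := hd.shape <;> cases h
    | letRecStep _ hb hp => exact ⟨_, hp.inst (.fix hb), .refl _⟩
  | reflect τ b p =>
    cases h with
    | reflect _ _ hb hp =>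
      exact ⟨_, hp.inst (.fix hb), .reflectStep _ (.refl _) (.refl _)⟩
    | delta hd => obtain ⟨⟨b, h⟩ | ⟨c, w, w', h, -⟩, -⟩ := hd.shape <;> cases h
    | reflectStep _ hb hp => exact ⟨_, hp.inst (.fix hb), .refl _⟩
  | fix e =>
    cases h with
    | fix he => exact ⟨_, he.inst (.fix he), .fixStep (.refl _)⟩
    | delta hd => obtain ⟨⟨b, h⟩ | ⟨c, w, w', h, -⟩, -⟩ := hd.shape <;> cases h
    | fixStep he => exact ⟨_, he.inst (.fix he), .refl _⟩

/-! ### Conversion -/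

/-- Conversion: the equivalence generated by parallel reduction. -/
def Conv {n : ℕ} : Term S n → Term S n → Prop := Relation.EqvGen Par

theorem Conv.refl {n : ℕ} (t : Term S n) : Conv t t := Relation.EqvGen.refl t

theorem Conv.symm {n : ℕ} {t t' : Term S n} (h : Conv t t') : Conv t' t := Relation.EqvGen.symm _ _ h

theorem Conv.trans {n : ℕ} {t t' t'' : Term S n} (h : Conv t t') (h' : Conv t' t'') :
    Conv t t'' := Relation.EqvGen.trans _ _ _ h h'

theorem Par.conv {n : ℕ} {t t' : Term S n} (h : Par t t') : Conv t t' := Relation.EqvGen.rel _ _ h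

theorem Steps.conv {n : ℕ} {t t' : Term S n} (h : Steps t t') : Conv t t' := by
  induction h with
  | refl => exact .refl t
  | tail _ hs ih => exact ih.trans hs.par.conv

theorem Conv.map {n m : ℕ} {f : Term S n → Term S m} (hf : ∀ t t', Par t t' → Par (f t) (f t'))
    {t t' : Term S n} (h : Conv t t') : Conv (f t) (f t') := by
  induction h with
  | rel t t' h => exact (hf _ _ h).conv
  | refl t => exact .refl _
  | symm t t' _ ih => exact ih.symm
  | trans t t' t'' _ _ ih ih' => exact ih.trans ih'

theorem Value.par {n : ℕ} {w t : Term S n} (hw : Value w) (h : Par w t) : Value t := by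
  induction hw generalizing t with
  | const c => rw [h.const_inv]; exact .const c
  | partialOp hc hv ih =>
    cases h with
    | app hf ha => rw [hf.const_inv]; exact .partialOp hc (ih ha)
    | delta hd => exact absurd (.delta hd) (Value.partialOp hc hv).not_step
  | lam τ e =>
    cases h with
    | lam _ τ' _ => exact .lam _ _
    | delta hd => exact absurd (.delta hd) (Value.lam τ e).not_step
  | con T i args hk _ ih =>
    obtain ⟨args', rfl, ha⟩ := h.conApp_inv
    exact .con T i _ hk fun j => ih j (ha j)

theorem Par.eval_forward {n : ℕ} {t t' w : Term S n} (h : Par t t') (hw : EvaluatesTo t w) :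
    ∃ w', EvaluatesTo t' w' ∧ Conv w w' := by
  obtain ⟨hs, hv⟩ := hw
  induction hs using Relation.ReflTransGen.head_induction_on generalizing t' with
  | refl => exact ⟨t', ⟨.refl, hv.par h⟩, h.conv⟩
  | head hs _ ih =>
    obtain ⟨v, h1, h2⟩ := h.step_join hs
    obtain ⟨w', ⟨hs', hv'⟩, hc⟩ := ih h1
    obtain ⟨x, hx, hp⟩ := h2.steps_backward hs'
    obtain ⟨y, hy, hvy, hpy⟩ := hp.steps_of_value hv'
    exact ⟨y, ⟨hx.trans hy, hvy⟩, hc.trans hpy.conv.symm⟩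

theorem Par.eval_backward {n : ℕ} {t t' w' : Term S n} (h : Par t t')
    (hw : EvaluatesTo t' w') : ∃ w, EvaluatesTo t w ∧ Conv w w' := by
  obtain ⟨u, hu, hp⟩ := h.steps_backward hw.1
  obtain ⟨w, hs, hv, hp⟩ := hp.steps_of_value hw.2
  exact ⟨w, ⟨hu.trans hs, hv⟩, hp.conv⟩

theorem Par.ground_iff {n : ℕ} {t t' w : Term S n} (h : Par t t') (hw : Ground w) :
    Steps t w ↔ Steps t' w := by
  constructor
  · intro hs
    induction hs using Relation.ReflTransGen.head_induction_on generalizing t' with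
    | refl => rw [h.ground hw]; exact .refl
    | head hs _ ih =>
      obtain ⟨v, h1, h2⟩ := h.step_join hs
      obtain ⟨x, hx, hp⟩ := h2.steps_backward (ih h1)
      exact hx.trans (hp.steps_of_ground hw)
  · intro hs
    obtain ⟨x, hx, hp⟩ := h.steps_backward hs
    exact hx.trans (hp.steps_of_ground hw)

theorem Conv.ground_iff {n : ℕ} {t t' w : Term S n} (h : Conv t t') (hw : Ground w) :
    Steps t w ↔ Steps t' w := by
  induction h with
  | rel t t' h => exact h.ground_iff hw
  | refl t => exact Iff.rfl
  | symm t t' _ ih => exact ih.symm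
  | trans t t' t'' _ _ ih ih' => exact ih.trans ih'

/-- Convertible terms evaluate to convertible values. -/
theorem Conv.eval {n : ℕ} {t t' : Term S n} (h : Conv t t') :
    (∀ w, EvaluatesTo t w → ∃ w', EvaluatesTo t' w' ∧ Conv w w') ∧
      ∀ w', EvaluatesTo t' w' → ∃ w, EvaluatesTo t w ∧ Conv w w' := by
  induction h with
  | rel t t' h => exact ⟨fun _ => h.eval_forward, fun _ => h.eval_backward⟩
  | refl t => exact ⟨fun w hw => ⟨w, hw, .refl w⟩, fun w hw => ⟨w, hw, .refl w⟩⟩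
  | symm t t' _ ih =>
    refine ⟨fun w hw => ?_, fun w hw => ?_⟩
    · obtain ⟨w', h, hc⟩ := ih.2 w hw; exact ⟨w', h, hc.symm⟩
    · obtain ⟨w', h, hc⟩ := ih.1 w hw; exact ⟨w', h, hc.symm⟩
  | trans t t' t'' _ _ ih ih' =>
    refine ⟨fun w hw => ?_, fun w hw => ?_⟩
    · obtain ⟨w', h, hc⟩ := ih.1 w hw
      obtain ⟨w'', h', hc'⟩ := ih'.1 w' h
      exact ⟨w'', h', hc.trans hc'⟩
    · obtain ⟨w', h, hc⟩ := ih'.2 w hw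
      obtain ⟨w'', h', hc'⟩ := ih.2 w' h
      exact ⟨w'', h', hc'.trans hc⟩

theorem ground_tt {n : ℕ} : Ground (Term.tt : Term S n) := .bool true

/-- A term with a ground normal form has no other value. -/
theorem Steps.ground_unique {n : ℕ} {t w w' : Term S n} (h : Steps t w) (hw : Ground w)
    (h' : EvaluatesTo t w') : w' = w := by
  have := (h'.1.conv.ground_iff hw).1 h
  exact (h'.2.steps_eq this).symm

end Standardization

section Approximation

variable {S : DataSig}

/-! ### Finite unfoldings of a recursive definition -/

/-- The body of the `m`-th approximation of `fix x. b`: the zeroth diverges, and the next one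
unfolds to `b` applied to the previous one. -/
def approxBody (b : Term S 1) : ℕ → Term S 1
  | 0 => .var 0
  | m + 1 => (b.inst (.fix (approxBody b m))).wk

/-- The `m`-th approximation of `fix x. b`, which is `fix x. b` itself for `m = ⊤`. -/
def approx (b : Term S 1) (m : ℕ∞) : Term S 1 := ENat.recTopCoe b (approxBody b) m

theorem approx_succ_inst (b : Term S 1) (m : ℕ∞) :
    (approx b (m + 1)).inst (.fix (approx b (m + 1))) = b.inst (.fix (approx b m)) := by
  cases m with
  | top => rfl
  | coe m => exact Term.wk_inst _ _

/-- Terms that agree up to type annotations and up to replacing an approximation of `fix x. b` by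
another one, with indices related by `Q`. -/
inductive Approx (b : Term S 1) (Q : ℕ∞ → ℕ∞ → Prop) : {n : ℕ} → Term S n → Term S n → Prop
  | approx {n : ℕ} (ρ : Fin 0 → Fin n) {m m' : ℕ∞} : Q m m' →
      Approx b Q (.fix ((approx b m).rename (liftRen ρ))) (.fix ((approx b m').rename (liftRen ρ)))
  | var {n : ℕ} (i : Fin n) : Approx b Q (.var i) (.var i)
  | const {n : ℕ} (c : Const S) : Approx b Q (.const c : Term S n) (.const c)
  | con {n : ℕ} (T : S.Data) (i : Fin (S.ctors T)) : Approx b Q (.con T i : Term S n) (.con T i)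
  | lam {n : ℕ} (τ τ' : Ty S n) {e e' : Term S (n + 1)} : Approx b Q e e' →
      Approx b Q (.lam τ e) (.lam τ' e')
  | app {n : ℕ} {f f' a a' : Term S n} : Approx b Q f f' → Approx b Q a a' →
      Approx b Q (.app f a) (.app f' a')
  | caseBool {n : ℕ} {e e' : Term S n} {a a' c c' : Term S (n + 1)} :
      Approx b Q e e' → Approx b Q a a' → Approx b Q c c' →
      Approx b Q (.caseBool e a c) (.caseBool e' a' c')
  | caseData {n : ℕ} {T : S.Data} {e e' : Term S n}
      {br br' : (i : Fin (S.ctors T)) → Term S (n + S.arity T i + 1)} :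
      Approx b Q e e' → (∀ i, Approx b Q (br i) (br' i)) →
      Approx b Q (.caseData T e br) (.caseData T e' br')
  | letRec {n : ℕ} (τ τ' : Ty S (n + 1)) {c c' p p' : Term S (n + 1)} :
      Approx b Q c c' → Approx b Q p p' → Approx b Q (.letRec τ c p) (.letRec τ' c' p')
  | reflect {n : ℕ} (τ τ' : Ty S n) {c c' p p' : Term S (n + 1)} :
      Approx b Q c c' → Approx b Q p p' → Approx b Q (.reflect τ c p) (.reflect τ' c' p')
  | fix {n : ℕ} {e e' : Term S (n + 1)} : Approx b Q e e' → Approx b Q (.fix e) (.fix e')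

variable {b : Term S 1} {Q Q' : ℕ∞ → ℕ∞ → Prop}

theorem Approx.refl : ∀ {n : ℕ} (t : Term S n), Approx b Q t t
  | _, .var i => .var i
  | _, .const c => .const c
  | _, .con T i => .con T i
  | _, .lam τ e => .lam τ τ (Approx.refl e)
  | _, .app f a => .app (Approx.refl f) (Approx.refl a)
  | _, .caseBool e a c => .caseBool (Approx.refl e) (Approx.refl a) (Approx.refl c)
  | _, .caseData _ e br => .caseData (Approx.refl e) fun i => Approx.refl (br i)
  | _, .letRec τ c p => .letRec τ τ (Approx.refl c) (Approx.refl p)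
  | _, .reflect τ c p => .reflect τ τ (Approx.refl c) (Approx.refl p)
  | _, .fix e => .fix (Approx.refl e)

theorem Approx.map (hQ : ∀ m m', Q m m' → Q' m m') {n : ℕ} {t t' : Term S n}
    (h : Approx b Q t t') : Approx b Q' t t' := by
  induction h with
  | approx ρ h => exact .approx ρ (hQ _ _ h)
  | var i => exact .var i
  | const c => exact .const c
  | con T i => exact .con T i
  | lam τ τ' _ ih => exact .lam _ _ ih
  | app _ _ ih ih' => exact .app ih ih'
  | caseBool _ _ _ ih ih' ih'' => exact .caseBool ih ih' ih''
  | caseData _ _ ih ih' => exact .caseData ih ih'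
  | letRec τ τ' _ _ ih ih' => exact .letRec _ _ ih ih'
  | reflect τ τ' _ _ ih ih' => exact .reflect _ _ ih ih'
  | fix _ ih => exact .fix ih

theorem Approx.symm {n : ℕ} {t t' : Term S n} (h : Approx b Q t t') :
    Approx b (fun m m' => Q m' m) t' t := by
  induction h with
  | approx ρ h => exact .approx ρ h
  | var i => exact .var i
  | const c => exact .const c
  | con T i => exact .con T i
  | lam τ τ' _ ih => exact .lam _ _ ih
  | app _ _ ih ih' => exact .app ih ih'
  | caseBool _ _ _ ih ih' ih'' => exact .caseBool ih ih' ih''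
  | caseData _ _ ih ih' => exact .caseData ih ih'
  | letRec τ τ' _ _ ih ih' => exact .letRec _ _ ih ih'
  | reflect τ τ' _ _ ih ih' => exact .reflect _ _ ih ih'
  | fix _ ih => exact .fix ih

theorem liftSub_liftRen_elim {n m : ℕ} (σ : Fin n → Term S m) (ρ : Fin 0 → Fin n) (t : Term S 1) :
    (t.rename (liftRen ρ)).subst (liftSub σ) = t.rename (liftRen Fin.elim0) := by
  rw [Term.rename_subst, liftSub_liftRen, ← Term.subst_ren, ← liftSub_var]
  congr 2
  exact funext fun i => i.elim0

theorem Approx.subst_of {K : ∀ {n m : ℕ}, (Fin n → Term S m) → (Fin n → Term S m) → Prop}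
    (hpar : ∀ {n m : ℕ} {σ σ' : Fin n → Term S m}, K σ σ' → ∀ i, Approx b Q (σ i) (σ' i))
    (hlift : ∀ {n m : ℕ} {σ σ' : Fin n → Term S m}, K σ σ' → K (liftSub σ) (liftSub σ'))
    {n : ℕ} {t t' : Term S n} (h : Approx b Q t t') :
    ∀ {m : ℕ} {σ σ' : Fin n → Term S m}, K σ σ' → Approx b Q (t.subst σ) (t'.subst σ') := by
  have hliftN : ∀ {n m : ℕ} {σ σ' : Fin n → Term S m} (j : ℕ), K σ σ' →
      K (liftSubN σ j) (liftSubN σ' j) := by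
    intro n m σ σ' j hK
    induction j with
    | zero => exact hK
    | succ j ih => exact hlift ih
  induction h with
  | approx ρ h =>
    intro m σ σ' _
    simp only [Term.subst, liftSub_liftRen_elim]
    exact .approx _ h
  | var i => exact fun hK => hpar hK i
  | const c => exact fun _ => .const c
  | con T i => exact fun _ => .con T i
  | lam τ τ' _ ih => exact fun hK => .lam _ _ (ih (hlift hK))
  | app _ _ ihf iha => exact fun hK => .app (ihf hK) (iha hK)
  | caseBool _ _ _ ihe iha ihb =>
    exact fun hK => .caseBool (ihe hK) (iha (hlift hK)) (ihb (hlift hK))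
  | caseData _ _ ihe ihb =>
    exact fun hK => .caseData (ihe hK) fun i => ihb i (hlift (hliftN _ hK))
  | letRec τ τ' _ _ ihb ihp => exact fun hK => .letRec _ _ (ihb (hlift hK)) (ihp (hlift hK))
  | reflect τ τ' _ _ ihb ihp => exact fun hK => .reflect _ _ (ihb (hlift hK)) (ihp (hlift hK))
  | fix _ ih => exact fun hK => .fix (ih (hlift hK))

theorem Approx.rename {n m : ℕ} (ρ : Fin n → Fin m) {t t' : Term S n} (h : Approx b Q t t') :
    Approx b Q (t.rename ρ) (t'.rename ρ) := by
  rw [← Term.subst_ren, ← Term.subst_ren]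
  refine h.subst_of
    (K := fun {n m} σ σ' => σ = σ' ∧ ∃ ρ : Fin n → Fin m, σ = fun i => .var (ρ i)) ?_ ?_
    ⟨rfl, ρ, rfl⟩
  · rintro n m σ _ ⟨rfl, _⟩ i; exact .refl _
  · rintro n m σ _ ⟨rfl, ρ, rfl⟩; exact ⟨rfl, liftRen ρ, liftSub_var ρ⟩

theorem Approx.subst {n m : ℕ} {σ σ' : Fin n → Term S m} (hσ : ∀ i, Approx b Q (σ i) (σ' i))
    {t t' : Term S n} (h : Approx b Q t t') : Approx b Q (t.subst σ) (t'.subst σ') :=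
  h.subst_of (K := fun σ σ' => ∀ i, Approx b Q (σ i) (σ' i)) id
    (fun h => Fin.cases (.var 0) fun i => (h i).rename _) hσ

theorem Approx.snoc {n m : ℕ} {σ σ' : Fin n → Term S m} (hσ : ∀ i, Approx b Q (σ i) (σ' i))
    {a a' : Term S m} (h : Approx b Q a a') : ∀ i, Approx b Q (snoc σ a i) (snoc σ' a' i) :=
  Fin.cases h hσ

theorem Approx.extend {n m k : ℕ} {σ σ' : Fin n → Term S m} (hσ : ∀ i, Approx b Q (σ i) (σ' i))
    {args args' : Fin k → Term S m} (h : ∀ j, Approx b Q (args j) (args' j)) :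
    ∀ i, Approx b Q (extend σ args i) (extend σ' args' i) := by
  induction k with
  | zero => exact hσ
  | succ k ih => exact Approx.snoc (ih fun j => h _) (h _)

theorem Approx.inst {n : ℕ} {t t' : Term S (n + 1)} {a a' : Term S n} (h : Approx b Q t t')
    (ha : Approx b Q a a') : Approx b Q (t.inst a) (t'.inst a') :=
  h.subst (Approx.snoc (fun _ => .refl _) ha)

theorem Approx.conApp {n : ℕ} {T : S.Data} {i : Fin (S.ctors T)} {k : ℕ}
    {args args' : Fin k → Term S n} (h : ∀ j, Approx b Q (args j) (args' j)) :
    Approx b Q (.conApp T i args) (.conApp T i args') := by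
  induction k with
  | zero => exact .con T i
  | succ k ih => exact .app (ih fun j => h _) (h _)

theorem Approx.conApp_inv {n : ℕ} {T : S.Data} {i : Fin (S.ctors T)} {k : ℕ}
    {args : Fin k → Term S n} {t : Term S n} (h : Approx b Q (.conApp T i args) t) :
    ∃ args', t = .conApp T i args' ∧ ∀ j, Approx b Q (args j) (args' j) := by
  induction k generalizing t with
  | zero =>
    rw [Term.conApp] at h
    cases h
    exact ⟨args, rfl, fun _ => .refl _⟩
  | succ k ih =>
    rw [Term.conApp] at h
    cases h with
    | app hf ha =>
      rename_i a'
      obtain ⟨args', rfl, h'⟩ := ih hf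
      refine ⟨Fin.snoc (α := fun _ => Term S n) args' a', ?_, Fin.lastCases ?_ fun j => ?_⟩
      · simp [Term.conApp]
      · simpa using ha
      · simpa using h' j

theorem Approx.ground {n : ℕ} {w t : Term S n} (hw : Ground w) (h : Approx b Q w t) : t = w := by
  induction hw generalizing t with
  | bool b => cases h; rfl
  | int b => cases h; rfl
  | con T i args _ ih =>
    obtain ⟨args', rfl, h'⟩ := h.conApp_inv
    rw [show args' = args from funext fun j => ih j (h' j)]

theorem Approx.value {n : ℕ} {w t : Term S n} (hw : Value w) (h : Approx b Q w t) : Value t := by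
  induction hw generalizing t with
  | const c => cases h; exact .const c
  | partialOp hc hv ih =>
    cases h with
    | app hf ha => cases hf; exact .partialOp hc (ih ha)
  | lam τ e => cases h; exact .lam _ _
  | con T i args hk _ ih =>
    obtain ⟨args', rfl, ha⟩ := h.conApp_inv
    exact .con T i _ hk fun j => ih j (ha j)

theorem Term.rename_closed {ρ : Fin 0 → Fin 0} (t : Term S 1) : t.rename (liftRen ρ) = t := by
  rw [← Term.subst_ren, ← liftSub_var,
    show (fun i => Term.var (ρ i)) = (Term.var : Fin 0 → Term S 0) from funext fun i => i.elim0,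
    liftSub_id, Term.subst_var]

/-- Evaluation simulates itself up to `Approx`, if the relation `Q'` of indices allows for an
unfolding. -/
theorem Approx.step (hQ : ∀ m m', Q m m' → Q' m m')
    (hQ' : ∀ m m', Q m m' → m = 0 ∨ ∃ j j', m = j + 1 ∧ m' = j' + 1 ∧ Q' j j')
    {t t' u : Term S 0} (h : Approx b Q t t') (hs : Step t u) :
    ∃ u', Steps t' u' ∧ Approx b Q' u u' := by
  induction hs generalizing t' with
  | appFun _ ih =>
    cases h with
    | app hf ha =>
      obtain ⟨f, hf', hp⟩ := ih hf
      exact ⟨_, hf'.appFun _, .app hp (ha.map hQ)⟩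
  | appConst _ ih =>
    cases h with
    | app hf ha =>
      cases hf
      obtain ⟨a, ha', hp⟩ := ih ha
      exact ⟨_, ha'.appConst _, .app (.const _) hp⟩
  | appPartialOp hc hw _ ih =>
    cases h with
    | app hf ha =>
      cases hf with
      | app hf hx =>
        cases hf
        obtain ⟨a, ha', hp⟩ := ih ha
        exact ⟨_, ha'.map fun _ _ => .appPartialOp hc (hx.value hw),
          .app (.app (.const _) (hx.map hQ)) hp⟩
  | appCon hk _ ih =>
    cases h with
    | app hf ha =>
      have hf' := hf.map hQ
      obtain ⟨args, rfl, hargs⟩ := hf.conApp_inv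
      obtain ⟨a, ha', hp⟩ := ih ha
      exact ⟨_, ha'.map fun _ _ => .appCon hk, .app hf' hp⟩
  | caseBoolScrut _ ih =>
    cases h with
    | caseBool he ha hb =>
      obtain ⟨e, he', hp⟩ := ih he
      exact ⟨_, he'.caseBool _ _, .caseBool hp (ha.map hQ) (hb.map hQ)⟩
  | caseDataScrut _ ih =>
    cases h with
    | caseData he hb =>
      obtain ⟨e, he', hp⟩ := ih he
      exact ⟨_, he'.caseData _, .caseData hp fun i => (hb i).map hQ⟩
  | @delta t r hd =>
    have : t' = t := by
      obtain ⟨⟨b, rfl⟩ | ⟨c, w, w', rfl, hc, hw, hw'⟩, -⟩ := hd.shape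
      · cases h with
        | app hf ha => cases hf; cases ha; rfl
      · cases h with
        | app hf ha =>
          cases hf with
          | app hf hx => cases hf; rw [hx.ground hw, ha.ground hw']; rfl
    subst this
    exact ⟨_, .single (.delta hd), .refl _⟩
  | beta τ e a =>
    cases h with
    | app hf ha =>
      cases hf with
      | lam _ _ he => exact ⟨_, .single (.beta _ _ _), (he.inst ha).map hQ⟩
  | caseTrue a b =>
    cases h with
    | caseBool he ha hb =>
      cases he
      exact ⟨_, .single (.caseTrue _ _), (ha.inst (.refl _)).map hQ⟩
  | caseFalse a b =>
    cases h with
    | caseBool he ha hb =>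
      cases he
      exact ⟨_, .single (.caseFalse _ _), (hb.inst (.refl _)).map hQ⟩
  | caseCon T i args br =>
    cases h with
    | caseData he hb =>
      obtain ⟨args', rfl, ha⟩ := he.conApp_inv
      exact ⟨_, .single (.caseCon _ _ _ _), ((hb i).subst
        (Approx.snoc (Approx.extend (fun _ => .refl _) ha) (Approx.conApp ha))).map hQ⟩
  | letRec τ b p =>
    cases h with
    | letRec _ _ hb hp => exact ⟨_, .single (.letRec _ _ _), (hp.inst (.fix hb)).map hQ⟩
  | reflect τ b p =>
    cases h with
    | reflect _ _ hb hp => exact ⟨_, .single (.reflect _ _ _), (hp.inst (.fix hb)).map hQ⟩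
  | fix e =>
    generalize he : Term.fix e = t at h
    cases h with
    | fix h => cases he; exact ⟨_, .single (.fix _), (h.inst (.fix h)).map hQ⟩
    | approx ρ h =>
      cases he
      have hg := Approx.approx (b := b) ρ (hQ _ _ h)
      simp only [Term.rename_closed] at hg ⊢
      obtain rfl | ⟨j, j', rfl, rfl, hj⟩ := hQ' _ _ h
      · exact ⟨_, .refl, hg⟩
      · have hj := Approx.approx (b := b) ρ hj
        simp only [Term.rename_closed] at hj
        refine ⟨_, .single (.fix _), ?_⟩
        rw [approx_succ_inst, approx_succ_inst]
        exact Approx.inst (.refl b) hj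
    | _ => cases he

/-- A term evaluates to true if some approximation of it does. -/
theorem Approx.steps_tt {t t' : Term S 0} (h : Approx b (· ≤ ·) t t') (hs : Steps t .tt) :
    Steps t' .tt := by
  induction hs using Relation.ReflTransGen.head_induction_on generalizing t' with
  | refl => rw [h.ground ground_tt]; exact .refl
  | head hs _ ih =>
    obtain ⟨u', hu, hp⟩ := h.step (Q' := (· ≤ ·)) (fun _ _ => id) (fun m m' h => by
      by_cases hm : m = 0
      · exact .inl hm
      · have h1 := Order.one_le_iff_ne_zero.2 hm
        exact .inr ⟨m - 1, m' - 1, (tsub_add_cancel_of_le h1).symm,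
          (tsub_add_cancel_of_le (h1.trans h)).symm, tsub_le_tsub_right h 1⟩) hs
    exact hu.trans (ih hp)

/-- A value of a term is approximated by values of good enough approximations of the term. -/
theorem Steps.approx {t' w' : Term S 0} (hs : Steps t' w') : ∃ k : ℕ, ∀ t : Term S 0,
    Approx b (fun m m' => (k : ℕ∞) ≤ m ∧ k ≤ m' ∧ m ≤ m') t t' →
      ∃ w, Steps t w ∧ Approx b (· ≤ ·) w w' := by
  induction hs using Relation.ReflTransGen.head_induction_on with
  | refl => exact ⟨0, fun t h => ⟨t, .refl, h.map fun _ _ h => h.2.2⟩⟩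
  | head hs _ ih =>
    obtain ⟨k, ih⟩ := ih
    refine ⟨k + 1, fun t h => ?_⟩
    obtain ⟨u, hu, hp⟩ := h.symm.step (Q' := fun m' m => (k : ℕ∞) ≤ m ∧ k ≤ m' ∧ m ≤ m')
      (fun m m' h => ⟨le_trans (by simp) h.1, le_trans (by simp) h.2.1, h.2.2⟩)
      (fun m' m h => by
        have hm : 1 ≤ m := le_trans (by simp) h.1
        have hm' : 1 ≤ m' := le_trans (by simp) h.2.1
        refine .inr ⟨m' - 1, m - 1, (tsub_add_cancel_of_le hm').symm,
          (tsub_add_cancel_of_le hm).symm, ?_, ?_, tsub_le_tsub_right h.2.2 1⟩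
        · exact ENat.le_sub_of_add_le_right (by simp) (by exact_mod_cast h.1)
        · exact ENat.le_sub_of_add_le_right (by simp) (by exact_mod_cast h.2.1)) hs
    obtain ⟨w, hw, hpw⟩ := ih u hp.symm
    exact ⟨w, hu.trans hw, hpw⟩

end Approximation

section SimpleTyping

variable {S : DataSig}

/-! ### Simple typing -/

theorem Ty.erase_subst : ∀ {n m : ℕ} (τ : Ty S n) (σ : Fin n → Term S m),
    (τ.subst σ).erase = τ.erase
  | _, _, .base _ _ _, _ => rfl
  | _, _, .fn τ₁ τ₂, σ => by
      simp only [Ty.subst, Ty.erase, Ty.erase_subst τ₁, Ty.erase_subst τ₂]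

theorem Ty.erase_rename {n m : ℕ} (τ : Ty S n) (ρ : Fin n → Fin m) :
    (τ.rename ρ).erase = τ.erase := by
  rw [← Ty.subst_ren, Ty.erase_subst]

theorem Ty.erase_wk {n : ℕ} (τ : Ty S n) : τ.wk.erase = τ.erase := Ty.erase_rename τ _

theorem SimplyTyped.subst_of
    {K : ∀ {n m : ℕ}, (Fin n → SimpleTy S.Data) → (Fin m → SimpleTy S.Data) →
      (Fin n → Term S m) → Prop}
    (hvar : ∀ {n m : ℕ} {Δ : Fin n → SimpleTy S.Data} {Δ' : Fin m → SimpleTy S.Data}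
      {σ : Fin n → Term S m}, K Δ Δ' σ → ∀ i, SimplyTyped Δ' (σ i) (Δ i))
    (hlift : ∀ {n m : ℕ} {Δ : Fin n → SimpleTy S.Data} {Δ' : Fin m → SimpleTy S.Data}
      {σ : Fin n → Term S m} (s), K Δ Δ' σ → K (snoc Δ s) (snoc Δ' s) (liftSub σ))
    {n : ℕ} {Δ : Fin n → SimpleTy S.Data} {t : Term S n} {s : SimpleTy S.Data}
    (h : SimplyTyped Δ t s) :
    ∀ {m : ℕ} {Δ' : Fin m → SimpleTy S.Data} {σ : Fin n → Term S m}, K Δ Δ' σ →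
      SimplyTyped Δ' (t.subst σ) s := by
  have hliftN : ∀ {n m : ℕ} {Δ : Fin n → SimpleTy S.Data} {Δ' : Fin m → SimpleTy S.Data}
      {σ : Fin n → Term S m} {j : ℕ} (s : Fin j → SimpleTy S.Data), K Δ Δ' σ →
      K (extend Δ s) (extend Δ' s) (liftSubN σ j) := by
    intro n m Δ Δ' σ j s hK
    induction j with
    | zero => exact hK
    | succ j ih => exact hlift _ (ih _)
  induction h with
  | var i => exact fun hK => hvar hK i
  | const c => exact fun _ => .const c
  | con T i => exact fun _ => .con T i
  | @lam n Δ τ e s _ ih =>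
    intro m Δ' σ hK
    rw [← Ty.erase_subst τ σ] at ih ⊢
    exact .lam (ih (hlift _ hK))
  | app _ _ ih ih' => exact fun hK => .app (ih hK) (ih' hK)
  | caseBool _ _ _ ih ih' ih'' =>
    exact fun hK => .caseBool (ih hK) (ih' (hlift _ hK)) (ih'' (hlift _ hK))
  | caseData _ _ ih ih' =>
    exact fun hK => .caseData (ih hK) fun i => ih' i (hlift _ (hliftN _ hK))
  | @letRec n Δ τ b p s _ _ ih ih' =>
    intro m Δ' σ hK
    rw [← Ty.erase_subst τ (liftSub σ)] at ih ih'
    exact .letRec (ih (hlift _ hK)) (ih' (hlift _ hK))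
  | @reflect n Δ τ b p s _ _ ih ih' =>
    intro m Δ' σ hK
    rw [← Ty.erase_subst τ σ] at ih ih'
    exact .reflect (ih (hlift _ hK)) (ih' (hlift _ hK))
  | fix _ ih => exact fun hK => .fix (ih (hlift _ hK))

theorem SimplyTyped.rename {n m : ℕ} {Δ : Fin n → SimpleTy S.Data} {Δ' : Fin m → SimpleTy S.Data}
    {ρ : Fin n → Fin m} (hρ : ∀ i, Δ' (ρ i) = Δ i) {t : Term S n} {s : SimpleTy S.Data}
    (h : SimplyTyped Δ t s) : SimplyTyped Δ' (t.rename ρ) s := by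
  rw [← Term.subst_ren]
  refine h.subst_of (K := fun {n m} Δ Δ' σ => ∃ ρ : Fin n → Fin m, (∀ i, Δ' (ρ i) = Δ i) ∧
    σ = fun i => .var (ρ i)) ?_ ?_ ⟨ρ, hρ, rfl⟩
  · rintro n m Δ Δ' _ ⟨ρ, hρ, rfl⟩ i; rw [← hρ]; exact .var _
  · rintro n m Δ Δ' _ s ⟨ρ, hρ, rfl⟩; exact ⟨liftRen ρ, Fin.cases rfl hρ, liftSub_var ρ⟩

theorem SimplyTyped.subst {n m : ℕ} {Δ : Fin n → SimpleTy S.Data} {Δ' : Fin m → SimpleTy S.Data}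
    {σ : Fin n → Term S m} (hσ : ∀ i, SimplyTyped Δ' (σ i) (Δ i)) {t : Term S n}
    {s : SimpleTy S.Data} (h : SimplyTyped Δ t s) : SimplyTyped Δ' (t.subst σ) s :=
  h.subst_of (K := fun Δ Δ' σ => ∀ i, SimplyTyped Δ' (σ i) (Δ i)) id
    (fun _ h => Fin.cases (.var 0) fun i => (h i).rename (ρ := Fin.succ) fun _ => rfl) hσ

theorem SimplyTyped.inst {n : ℕ} {Δ : Fin n → SimpleTy S.Data} {t : Term S (n + 1)}
    {a : Term S n} {s s' : SimpleTy S.Data} (h : SimplyTyped (snoc Δ s') t s)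
    (ha : SimplyTyped Δ a s') : SimplyTyped Δ (t.inst a) s :=
  h.subst (Fin.cases ha .var)

/-- Peeling off the arguments of an iterated function type from the outside. -/
theorem SimpleTy.arrs_peel {D : Type} {k : ℕ} (s : Fin k → SimpleTy D) (t : SimpleTy D) :
    ∃ G : ℕ → SimpleTy D, G 0 = .arrs s t ∧ G k = t ∧ ∀ j : Fin k, G j = .arr (s j) (G (j + 1)) := by
  induction k generalizing t with
  | zero => exact ⟨fun _ => t, rfl, rfl, fun j => j.elim0⟩
  | succ k ih =>
    obtain ⟨G, h0, hk, hG⟩ := ih (fun j => s j.castSucc) (.arr (s (Fin.last _)) t)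
    refine ⟨fun j => if j ≤ k then G j else t, by simpa [SimpleTy.arrs] using h0, by simp,
      Fin.lastCases ?_ fun j => ?_⟩
    · simpa using hk
    · have h1 : (j : ℕ) ≤ k := j.2.le
      have h2 : (j : ℕ) + 1 ≤ k := j.2
      simpa [h1, h2] using hG j

theorem SimplyTyped.app_inv {n : ℕ} {Δ : Fin n → SimpleTy S.Data} {f a : Term S n}
    {t : SimpleTy S.Data} (h : SimplyTyped Δ (.app f a) t) :
    ∃ s, SimplyTyped Δ f (.arr s t) ∧ SimplyTyped Δ a s := by
  cases h with
  | app hf ha => exact ⟨_, hf, ha⟩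

theorem SimplyTyped.const_inv {n : ℕ} {Δ : Fin n → SimpleTy S.Data} {c : Const S}
    {t : SimpleTy S.Data} (h : SimplyTyped Δ (.const c) t) : t = c.simpleTy := by
  cases h; rfl

theorem SimplyTyped.conApp_inv {n : ℕ} {Δ : Fin n → SimpleTy S.Data} {T : S.Data}
    {i : Fin (S.ctors T)} {k : ℕ} (hk : k ≤ S.arity T i) {args : Fin k → Term S n}
    {t : SimpleTy S.Data} (h : SimplyTyped Δ (.conApp T i args) t) :
    (∀ j, SimplyTyped Δ (args j) (S.field T i (j.castLE hk))) ∧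
      (k = S.arity T i → t = .base (.data T)) ∧ (k < S.arity T i → ∃ s s', t = .arr s s') := by
  obtain ⟨G, h0, hN, hG⟩ := SimpleTy.arrs_peel (S.field T i) (.base (.data T))
  have key : (∀ j, SimplyTyped Δ (args j) (S.field T i (j.castLE hk))) ∧ t = G k := by
    induction k generalizing t with
    | zero => 
      rw [Term.conApp] at h
      cases h
      exact ⟨fun j => j.elim0, h0.symm⟩
    | succ k ih =>
      obtain ⟨s, hf, ha⟩ := h.app_inv
      obtain ⟨h1, h2⟩ := ih (Nat.le_of_succ_le hk) hf
      have h3 := hG ⟨k, hk⟩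
      rw [← h2, SimpleTy.arr.injEq] at h3
      exact ⟨Fin.lastCases (h3.1 ▸ ha) h1, h3.2⟩
  refine ⟨key.1, fun h => ?_, fun h => ⟨_, _, key.2.trans (hG ⟨k, h⟩)⟩⟩
  rw [key.2, h, hN]

theorem SimplyTyped.delta {n : ℕ} {Δ : Fin n → SimpleTy S.Data} {t r : Term S n}
    {s : SimpleTy S.Data} (hd : Delta t r) (h : SimplyTyped Δ t s) : SimplyTyped Δ r s := by
  cases hd with
  | not b =>
    obtain ⟨_, hf, -⟩ := h.app_inv
    cases hf.const_inv; exact .const _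
  | _ =>
    obtain ⟨_, hf, -⟩ := h.app_inv
    obtain ⟨_, hf, -⟩ := hf.app_inv
    cases hf.const_inv; exact .const _

theorem SimplyTyped.extend {n m k : ℕ} {Δ : Fin n → SimpleTy S.Data}
    {Δ' : Fin m → SimpleTy S.Data} {σ : Fin n → Term S m} {s : Fin k → SimpleTy S.Data}
    {args : Fin k → Term S m} (hσ : ∀ i, SimplyTyped Δ' (σ i) (Δ i))
    (h : ∀ j, SimplyTyped Δ' (args j) (s j)) :
    ∀ i, SimplyTyped Δ' (extend σ args i) (extend Δ s i) := by
  induction k with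
  | zero => exact hσ
  | succ k ih => exact Fin.cases (h _) (ih fun j => h _)

theorem SimplyTyped.step {n : ℕ} {Δ : Fin n → SimpleTy S.Data} {t t' : Term S n}
    {s : SimpleTy S.Data} (hs : Step t t') (h : SimplyTyped Δ t s) : SimplyTyped Δ t' s := by
  induction hs generalizing s with
  | appFun _ ih => cases h with | app hf ha => exact .app (ih hf) ha
  | appConst _ ih => cases h with | app hf ha => exact .app hf (ih ha)
  | appPartialOp _ _ _ ih => cases h with | app hf ha => exact .app hf (ih ha)
  | appCon _ _ ih => obtain ⟨_, hf, ha⟩ := h.app_inv; exact .app hf (ih ha)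
  | caseBoolScrut _ ih => cases h with | caseBool he ha hb => exact .caseBool (ih he) ha hb
  | caseDataScrut _ ih => cases h with | caseData he hb => exact .caseData (ih he) hb
  | delta hd => exact h.delta hd
  | beta τ e a => cases h with | app hf ha => cases hf with | lam he => exact he.inst ha
  | caseTrue a b => cases h with | caseBool he ha hb => exact ha.inst he
  | caseFalse a b => cases h with | caseBool he ha hb => exact hb.inst he
  | caseCon T i args br =>
    generalize hg : Term.conApp T i args = g at h
    cases h with
    | caseData he hb =>
      subst hg
      exact (hb i).subst (Fin.cases he (SimplyTyped.extend .var (he.conApp_inv le_rfl).1))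
  | letRec τ b p => cases h with | letRec hb hp => exact hp.inst (.fix hb)
  | reflect τ b p => cases h with | reflect hb hp => exact hp.inst (.fix hb)
  | fix e => cases h with | fix he => exact he.inst (.fix he)

theorem SimplyTyped.steps {n : ℕ} {Δ : Fin n → SimpleTy S.Data} {t t' : Term S n}
    {s : SimpleTy S.Data} (hs : Steps t t') (h : SimplyTyped Δ t s) : SimplyTyped Δ t' s := by
  induction hs with
  | refl => exact h
  | tail _ hs ih => exact ih.step hs

/-- Canonical forms: values of a base type are literals or saturated constructors. -/
theorem SimplyTyped.canonical {n : ℕ} {Δ : Fin n → SimpleTy S.Data} {w : Term S n}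
    {B : BaseTy S.Data} (hw : Value w) (h : SimplyTyped Δ w (.base B)) :
    (∃ b, w = .const (.bool b) ∧ B = .bool) ∨ (∃ z, w = .const (.int z) ∧ B = .int) ∨
      ∃ T i, ∃ args : Fin (S.arity T i) → Term S n, w = .conApp T i args ∧ B = .data T ∧
        ∀ j, Value (args j) ∧ SimplyTyped Δ (args j) (S.field T i j) := by
  cases hw with
  | const c =>
    have h := h.const_inv
    cases c with
    | bool b => cases h; exact .inl ⟨b, rfl, rfl⟩
    | int z => cases h; exact .inr (.inl ⟨z, rfl, rfl⟩)
    | _ => cases h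
  | @partialOp c w hc hw =>
    obtain ⟨s, hf, -⟩ := h.app_inv
    have hf := hf.const_inv
    cases c <;> first | (cases hc; done) | simp [Const.simpleTy] at hf
  | lam τ e => cases h
  | @con T i k args hk hv =>
    obtain ⟨h1, h2, h3⟩ := h.conApp_inv hk
    obtain hk' | hk' := hk.lt_or_eq
    · obtain ⟨s, s', h⟩ := h3 hk'; cases h
    · subst hk'
      cases h2 rfl
      exact .inr (.inr ⟨T, i, args, rfl, rfl, fun j => ⟨hv j, h1 j⟩⟩)

/-- The values of a first order type are ground. -/
theorem FirstOrder.ground {n : ℕ} {Δ : Fin n → SimpleTy S.Data} {w : Term S n}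
    {B : BaseTy S.Data} (hB : FirstOrder S B) (hw : Value w) (h : SimplyTyped Δ w (.base B)) :
    Ground w := by
  obtain ⟨X, hBX, hX⟩ := hB
  induction hw generalizing B with
  | con T i args hk hv ih =>
    obtain ⟨h1, h2, h3⟩ := h.conApp_inv hk
    obtain hk' | hk' := hk.lt_or_eq
    · obtain ⟨s, s', h⟩ := h3 hk'; cases h
    · subst hk'
      cases h2 rfl
      refine .con T i args fun j => ?_
      obtain ⟨B', hB', he⟩ := hX T hBX i j
      exact ih j (he ▸ h1 j) hB'
  | const c => 
    obtain ⟨b, h, -⟩ | ⟨z, h, -⟩ | ⟨T, i, args, h, -⟩ := h.canonical (.const c)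
    · cases h; exact .bool b
    · cases h; exact .int z
    · exact absurd h (Term.conApp_ne rfl)
  | partialOp hc hv =>
    obtain ⟨b, h, -⟩ | ⟨z, h, -⟩ | ⟨T, i, args, h, -⟩ := h.canonical (.partialOp hc hv)
    · cases h
    · cases h
    · exact absurd h (Term.conApp_ne rfl)
  | lam τ e => cases h

end SimpleTyping

section Denotations

variable {S : DataSig}

/-! ### Evaluation of conjunctions and equations -/

theorem Steps.op_inv {n : ℕ} {c d : Const S} (hc : c.arity = 2) {a b : Term S n}
    (h : Steps (.op c a b) (.const d)) :
    ∃ a' b', Steps a a' ∧ Steps b b' ∧ Delta (.op c a' b') (.const d) := by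
  generalize ht : Term.op c a b = t at h
  induction h using Relation.ReflTransGen.head_induction_on generalizing a b with
  | refl => cases ht
  | @head t u hs hs' ih =>
    rw [Term.op] at ht
    generalize hf : Term.app (.const c) a = f at ht
    cases hs with
    | appFun hs =>
      cases ht
      generalize hg : Term.const c = g at hf
      subst hf
      cases hs with
      | appFun hs => subst hg; exact absurd hs (Value.const c).not_step
      | appConst hs =>
        cases hg
        obtain ⟨a', b', ha, hb, hd⟩ := ih rfl
        exact ⟨a', b', .head hs ha, hb, hd⟩
      | appPartialOp => cases hg
      | appCon => exact absurd hg (Term.conApp_ne rfl)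
      | delta hd =>
        subst hg
        obtain ⟨⟨b, h⟩ | ⟨c, w, w', h, -⟩, -⟩ := hd.shape
        · cases h; cases hc
        · cases h
      | beta => cases hg
    | appConst => cases ht; cases hf
    | appPartialOp _ hv hs =>
      cases ht
      cases hf
      obtain ⟨a', b', ha, hb, hd⟩ := ih rfl
      exact ⟨a', b', ha, .head hs hb, hd⟩
    | appCon => cases ht; exact absurd hf (Term.conApp_ne rfl)
    | beta => cases ht; cases hf
    | delta hd =>
      subst hf
      subst ht
      obtain ⟨d', rfl, -⟩ := hd.shape.2
      have := (Value.const d').steps_eq hs'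
      exact ⟨a, b, .refl, .refl, this ▸ hd⟩
    | _ => cases ht

theorem Steps.and_tt {n : ℕ} {a b : Term S n} (ha : Steps a .tt) (hb : Steps b .tt) :
    Steps (.and a b) .tt :=
  (Steps.op (c := .and) rfl ha (.const _) hb).tail (.delta (.and true true))

theorem Steps.and_tt_inv {n : ℕ} {a b : Term S n} (h : Steps (.and a b) .tt) :
    Steps a .tt ∧ Steps b .tt := by
  obtain ⟨a', b', ha, hb, hd⟩ := Steps.op_inv (c := .and) rfl h
  generalize ht : Term.op .and a' b' = t at hd
  generalize hr : Term.const (Const.bool true) = r at hd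
  cases hd <;> cases ht
  rename_i x y
  cases x <;> cases y <;> cases hr
  exact ⟨ha, hb⟩

theorem Steps.eq_tt {n : ℕ} {B : BaseTy S.Data} (h : FirstOrder S B) {e e' w : Term S n}
    (hw : Ground w) (hs : Steps e w) (hs' : Steps e' w) : Steps (.eq B h e e') .tt :=
  (Steps.op (c := .eq B h) rfl hs hw.value hs').tail (.delta (.eqTrue B h hw))

theorem Steps.eq_tt_inv {n : ℕ} {B : BaseTy S.Data} {h : FirstOrder S B} {a b : Term S n}
    (hs : Steps (.eq B h a b) .tt) : ∃ w, Ground w ∧ Steps a w ∧ Steps b w := by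
  obtain ⟨a', b', ha, hb, hd⟩ := Steps.op_inv (c := .eq B h) rfl hs
  generalize ht : Term.op (.eq B h) a' b' = t at hd
  generalize hr : Term.const (Const.bool true) = r at hd
  cases hd <;> cases ht
  · rename_i hw; exact ⟨_, hw, ha, hb⟩
  · cases hr

/-! ### Divergence -/

theorem Steps.app_value {n : ℕ} {f a v : Term S n} (h : Steps (.app f a) v) (hv : Value v) :
    ∃ w, EvaluatesTo f w := by
  generalize ht : Term.app f a = t at h
  induction h using Relation.ReflTransGen.head_induction_on generalizing f a with
  | refl => subst ht; exact ⟨f, .refl, hv.app_inv.1⟩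
  | head hs _ ih =>
    cases hs with
    | appFun hs =>
      cases ht
      obtain ⟨w, hw, hv⟩ := ih rfl
      exact ⟨w, .head hs hw, hv⟩
    | appConst => cases ht; exact ⟨_, .refl, .const _⟩
    | appPartialOp hc hw => cases ht; exact ⟨_, .refl, .partialOp hc hw⟩
    | appCon => cases ht; exact ih rfl
    | beta => cases ht; exact ⟨_, .refl, .lam _ _⟩
    | delta hd => subst ht; exact ⟨_, .refl, hd.app_value.1⟩
    | _ => cases ht

theorem Steps.caseBool_value {n : ℕ} {e v : Term S n} {a b : Term S (n + 1)}
    (h : Steps (.caseBool e a b) v) (hv : Value v) : ∃ w, EvaluatesTo e w := by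
  generalize ht : Term.caseBool e a b = t at h
  induction h using Relation.ReflTransGen.head_induction_on generalizing e with
  | refl => 
    subst ht
    obtain ⟨c, h⟩ | ⟨τ, e, h⟩ | ⟨c, a, hc, h⟩ | h := hv.view
    · cases h
    · cases h
    · cases h
    · exact absurd rfl h
  | head hs _ ih =>
    cases hs with
    | caseBoolScrut hs =>
      cases ht
      obtain ⟨w, hw, hv⟩ := ih rfl
      exact ⟨w, .head hs hw, hv⟩
    | caseTrue => cases ht; exact ⟨_, .refl, .const _⟩
    | caseFalse => cases ht; exact ⟨_, .refl, .const _⟩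
    | delta hd =>
      subst ht
      obtain ⟨⟨b, h⟩ | ⟨c, w, w', h, -⟩, -⟩ := hd.shape <;> cases h
    | _ => cases ht

theorem Steps.caseData_value {n : ℕ} {T : S.Data} {e v : Term S n}
    {br : (i : Fin (S.ctors T)) → Term S (n + S.arity T i + 1)}
    (h : Steps (.caseData T e br) v) (hv : Value v) :
    ∃ i, ∃ args : Fin (S.arity T i) → Term S n, Steps e (.conApp T i args) := by
  generalize ht : Term.caseData T e br = t at h
  induction h using Relation.ReflTransGen.head_induction_on generalizing e with
  | refl => 
    subst ht
    obtain ⟨c, h⟩ | ⟨τ, e, h⟩ | ⟨c, a, hc, h⟩ | h := hv.view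
    · cases h
    · cases h
    · cases h
    · exact absurd rfl h
  | head hs _ ih =>
    cases hs with
    | caseDataScrut hs =>
      cases ht
      obtain ⟨i, args, hw⟩ := ih rfl
      exact ⟨i, args, .head hs hw⟩
    | caseCon T i args => cases ht; exact ⟨i, args, .refl⟩
    | delta hd =>
      subst ht
      obtain ⟨⟨b, h⟩ | ⟨c, w, w', h, -⟩, -⟩ := hd.shape <;> cases h
    | _ => cases ht

/-! ### Denotations -/

theorem mem_Den_base {n : ℕ} {l : Label} {B : BaseTy S.Data} {r : Term S (n + 1)}
    {θ : Fin n → Term S 0} {e : Term S 0} : e ∈ Den (.base l B r) θ ↔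
      SimplyTyped Fin.elim0 e (.base B) ∧
      (∀ w, EvaluatesTo e w → Steps (r.subst (snoc θ w)) .tt) ∧
      (l = .tot → ∃ w, EvaluatesTo e w) := by
  rw [Den]; rfl

theorem mem_Den_fn {n : ℕ} {τ₁ : Ty S n} {τ₂ : Ty S (n + 1)} {θ : Fin n → Term S 0}
    {e : Term S 0} : e ∈ Den (.fn τ₁ τ₂) θ ↔
      SimplyTyped Fin.elim0 e (.arr τ₁.erase τ₂.erase) ∧
      ∀ a ∈ Den τ₁ θ, .app e a ∈ Den τ₂ (snoc θ a) := by
  rw [Den]; rfl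

theorem simplyTyped_of_mem {n : ℕ} {τ : Ty S n} {θ : Fin n → Term S 0} {e : Term S 0}
    (h : e ∈ Den τ θ) : SimplyTyped Fin.elim0 e τ.erase := by
  cases τ with
  | base l B r => exact (mem_Den_base.1 h).1
  | fn τ₁ τ₂ => exact (mem_Den_fn.1 h).1

theorem Den_subst : ∀ {n m : ℕ} (τ : Ty S n) (σ : Fin n → Term S m) (θ : Fin m → Term S 0),
    Den (τ.subst σ) θ = Den τ fun i => (σ i).subst θ
  | _, _, .base l B r, σ, θ => by
      ext e
      simp only [Ty.subst, mem_Den_base, Term.subst_liftSub_snoc]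
  | _, _, .fn τ₁ τ₂, σ, θ => by
      ext e
      simp only [Ty.subst, mem_Den_fn, Ty.erase_subst, Den_subst τ₁, Den_subst τ₂, liftSub_snoc]

theorem Den_rename {n m : ℕ} (τ : Ty S n) (ρ : Fin n → Fin m) (θ : Fin m → Term S 0) :
    Den (τ.rename ρ) θ = Den τ fun i => θ (ρ i) := by
  rw [← Ty.subst_ren, Den_subst]; rfl

theorem Den_wk {n : ℕ} (τ : Ty S n) (θ : Fin (n + 1) → Term S 0) :
    Den τ.wk θ = Den τ fun i => θ i.succ := Den_rename _ _ _

theorem Den_inst {n : ℕ} (τ : Ty S (n + 1)) (a : Term S n) (θ : Fin n → Term S 0) :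
    Den (τ.inst a) θ = Den τ (snoc θ (a.subst θ)) := by
  rw [Ty.inst, Den_subst, snoc_var_subst]

/-- Denotations are invariant under parallel reduction of the closing substitution. -/
theorem Den_par : ∀ {n : ℕ} (τ : Ty S n) {θ θ' : Fin n → Term S 0},
    (∀ i, Par (θ i) (θ' i)) → Den τ θ = Den τ θ'
  | _, .base l B r, θ, θ', h => by
      ext e
      simp only [mem_Den_base]
      have := fun w => ((Par.refl r).subst (Par.snoc h (.refl w))).ground_iff ground_tt
      simp only [this]
  | _, .fn τ₁ τ₂, θ, θ', h => by
      ext e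
      simp only [mem_Den_fn, Den_par τ₁ h, fun a => Den_par τ₂ (Par.snoc h (.refl a))]

/-- Denotations are closed under conversion of simply typed terms. -/
theorem Den_conv : ∀ {n : ℕ} {τ : Ty S n} {θ : Fin n → Term S 0} {t t' : Term S 0},
    Conv t t' → SimplyTyped Fin.elim0 t' τ.erase → t ∈ Den τ θ → t' ∈ Den τ θ
  | _, .base l B r, θ, t, t', h, ht', ht => by
      obtain ⟨-, h1, h2⟩ := mem_Den_base.1 ht
      refine mem_Den_base.2 ⟨ht', fun w' hw' => ?_, fun hl => ?_⟩
      · obtain ⟨w, hw, hc⟩ := h.eval.2 w' hw'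
        exact ((hc.map (f := fun w => r.subst (snoc θ w)) fun _ _ h =>
          (Par.refl r).subst (Par.snoc (fun _ => .refl _) h)).ground_iff ground_tt).1 (h1 w hw)
      · obtain ⟨w, hw⟩ := h2 hl
        obtain ⟨w', hw', -⟩ := h.eval.1 w hw
        exact ⟨w', hw'⟩
  | _, .fn τ₁ τ₂, θ, t, t', h, ht', ht => by
      obtain ⟨-, h1⟩ := mem_Den_fn.1 ht
      exact mem_Den_fn.2 ⟨ht', fun a ha => Den_conv
        (h.map (f := (Term.app · a)) fun _ _ h => .app h (.refl a))
        (.app ht' (simplyTyped_of_mem ha)) (h1 a ha)⟩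

/-- A divergent term inhabits every type whose result may diverge. -/
theorem mem_Den_of_diverges : ∀ {n : ℕ} {τ : Ty S n} {θ : Fin n → Term S 0} {t : Term S 0},
    τ.resultLabel = .part → SimplyTyped Fin.elim0 t τ.erase → (∀ w, ¬ EvaluatesTo t w) →
    t ∈ Den τ θ
  | _, .base l B r, θ, t, hl, ht, hd => by
      cases hl
      exact mem_Den_base.2 ⟨ht, fun w hw => absurd hw (hd w), fun h => by cases h⟩
  | _, .fn τ₁ τ₂, θ, t, hl, ht, hd => by
      refine mem_Den_fn.2 ⟨ht, fun a ha => mem_Den_of_diverges hl (.app ht (simplyTyped_of_mem ha)) ?_⟩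
      intro w hw
      obtain ⟨w', hw'⟩ := hw.1.app_value hw.2
      exact hd w' hw'

theorem SimpleTy.erase_toTy (l : Label) : ∀ (s : SimpleTy S.Data) {n : ℕ},
    (s.toTy l : Ty S n).erase = s
  | .base B, _ => rfl
  | .arr s t, _ => by
      rw [SimpleTy.toTy, Ty.erase, SimpleTy.erase_toTy .part s, SimpleTy.erase_toTy .part t]

theorem mem_Den_toTy : ∀ {s : SimpleTy S.Data} {l : Label} {n : ℕ} {θ : Fin n → Term S 0}
    {e : Term S 0}, e ∈ Den (s.toTy l) θ ↔ SimplyTyped Fin.elim0 e s ∧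
      ∀ B, s = .base B → l = .tot → ∃ w, EvaluatesTo e w
  | .base B, l, n, θ, e => by
      rw [SimpleTy.toTy, Ty.plain, mem_Den_base]
      exact ⟨fun h => ⟨h.1, fun B' _ hl => h.2.2 hl⟩,
        fun h => ⟨h.1, fun _ _ => .refl, h.2 B rfl⟩⟩
  | .arr s t, l, n, θ, e => by
      rw [SimpleTy.toTy, mem_Den_fn, SimpleTy.erase_toTy, SimpleTy.erase_toTy]
      refine ⟨fun h => ⟨h.1, fun B hB => by cases hB⟩, fun h => ⟨h.1, fun a ha => ?_⟩⟩
      exact mem_Den_toTy.2 ⟨.app h.1 (mem_Den_toTy.1 ha).1, fun _ _ hl => by cases hl⟩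

theorem SimpleTy.toTy_subst (l : Label) : ∀ (s : SimpleTy S.Data) {n m : ℕ} (σ : Fin n → Term S m),
    (s.toTy l : Ty S n).subst σ = s.toTy l
  | .base B, _, _, _ => rfl
  | .arr s t, _, _, σ => by
      rw [SimpleTy.toTy, Ty.subst, SimpleTy.toTy_subst .part s, SimpleTy.toTy_subst .part t]; rfl

/-! ### Environments -/

theorem snoc_mem_snocRec {n : ℕ} {Γ : Ctx S n} {τ : Ty S (n + 1)} {θ : Fin n → Term S 0}
    {a : Term S 0} : snoc θ a ∈ (Γ.snocRec τ).den ↔ θ ∈ Γ.den ∧ a ∈ Den τ (snoc θ a) := by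
  constructor
  · intro h
    refine ⟨fun i => ?_, h 0⟩
    have := h i.succ
    rwa [Ctx.snocRec, snoc_succ, Den_wk] at this
  · rintro ⟨h1, h2⟩
    refine Fin.cases h2 fun i => ?_
    rw [Ctx.snocRec, snoc_succ, Den_wk]
    exact h1 i

theorem snoc_mem_snoc {n : ℕ} {Γ : Ctx S n} {τ : Ty S n} {θ : Fin n → Term S 0}
    {a : Term S 0} : snoc θ a ∈ (Γ.snoc τ).den ↔ θ ∈ Γ.den ∧ a ∈ Den τ θ := by
  rw [Ctx.snoc, snoc_mem_snocRec, Den_wk]; rfl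

theorem snoc_tail {A : Type} {n : ℕ} (θ : Fin (n + 1) → A) :
    snoc (fun i => θ i.succ) (θ 0) = θ := snoc_ext rfl fun _ => rfl

theorem extend_mem_snocFields {n k : ℕ} {Γ : Ctx S n} {l : Label} {s : Fin k → SimpleTy S.Data}
    {θ : Fin n → Term S 0} {args : Fin k → Term S 0} (hθ : θ ∈ Γ.den)
    (h : ∀ j, args j ∈ Den ((s j).toTy l : Ty S 0) Fin.elim0) :
    extend θ args ∈ (Γ.snocFields l s).den := by
  induction k with
  | zero => exact hθ
  | succ k ih => exact snoc_mem_snoc.2 ⟨ih fun j => h _, mem_Den_toTy.2 (mem_Den_toTy.1 (h _))⟩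

theorem Ctx.erase_snocRec {n : ℕ} (Γ : Ctx S n) (τ : Ty S (n + 1)) :
    (fun i => (Γ.snocRec τ i).erase) = RefinementReflection.snoc (fun i => (Γ i).erase) τ.erase :=
  snoc_ext rfl fun i => Ty.erase_wk (Γ i)

theorem Ctx.erase_snoc {n : ℕ} (Γ : Ctx S n) (τ : Ty S n) :
    (fun i => (Γ.snoc τ i).erase) = RefinementReflection.snoc (fun i => (Γ i).erase) τ.erase := by
  rw [Ctx.snoc, Ctx.erase_snocRec, Ty.erase_wk]

theorem Ctx.erase_snocFields {n k : ℕ} (Γ : Ctx S n) (l : Label) (s : Fin k → SimpleTy S.Data) :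
    (fun i => (Γ.snocFields l s i).erase) = extend (fun i => (Γ i).erase) s := by
  induction k with
  | zero => rfl
  | succ k ih =>
    refine (Ctx.erase_snoc _ _).trans ?_
    rw [SimpleTy.erase_toTy]
    exact congrArg (fun f => RefinementReflection.snoc f _) (ih _)

/-! ### Iterated application -/

/-- The application of `e` to `k` arguments. -/
def Term.apps {n : ℕ} (e : Term S n) : {k : ℕ} → (Fin k → Term S n) → Term S n
  | 0, _ => e
  | _ + 1, args => .app (e.apps fun j => args j.castSucc) (args (Fin.last _))

theorem Term.apps_con {n : ℕ} (T : S.Data) (i : Fin (S.ctors T)) {k : ℕ}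
    (args : Fin k → Term S n) : (Term.con T i).apps args = .conApp T i args := by
  induction k with
  | zero => rfl
  | succ k ih => rw [Term.apps, ih]; rfl

theorem SimplyTyped.apps {n k : ℕ} {Δ : Fin n → SimpleTy S.Data} {e : Term S n}
    {s : Fin k → SimpleTy S.Data} {args : Fin k → Term S n} {t : SimpleTy S.Data}
    (he : SimplyTyped Δ e (.arrs s t)) (ha : ∀ j, SimplyTyped Δ (args j) (s j)) :
    SimplyTyped Δ (e.apps args) t := by
  induction k generalizing t with
  | zero => exact he
  | succ k ih => exact .app (ih he fun j => ha _) (ha _)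

theorem Ty.erase_fnFields {n k : ℕ} (l : Label) (s : Fin k → SimpleTy S.Data) (τ : Ty S (n + k)) :
    (Ty.fnFields l s τ).erase = .arrs s τ.erase := by
  induction k with
  | zero => rfl
  | succ k ih =>
    rw [Ty.fnFields, ih, Ty.erase, SimpleTy.erase_toTy]; rfl

theorem mem_Den_fnFields {n k : ℕ} {l : Label} {s : Fin k → SimpleTy S.Data} {τ : Ty S (n + k)}
    {θ : Fin n → Term S 0} {e : Term S 0} : e ∈ Den (.fnFields l s τ) θ ↔
      SimplyTyped Fin.elim0 e (.arrs s τ.erase) ∧ ∀ args : Fin k → Term S 0,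
        (∀ j, args j ∈ Den ((s j).toTy l : Ty S 0) Fin.elim0) →
          e.apps args ∈ Den τ (extend θ args) := by
  induction k with
  | zero => exact ⟨fun h => ⟨simplyTyped_of_mem h, fun _ _ => h⟩, fun h => h.2 Fin.elim0 fun j => j.elim0⟩
  | succ k ih =>
    rw [Ty.fnFields, ih, Ty.erase, SimpleTy.erase_toTy]
    refine ⟨fun ⟨he, h⟩ => ⟨he, fun args ha => ?_⟩, fun ⟨he, h⟩ => ⟨he, fun args ha => ?_⟩⟩
    · exact (mem_Den_fn.1 (h (fun j => args j.castSucc) fun j => ha _)).2 _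
        (mem_Den_toTy.2 (mem_Den_toTy.1 (ha _)))
    · refine mem_Den_fn.2 ⟨?_, fun a ha' => ?_⟩
      · rw [SimpleTy.erase_toTy]
        exact SimplyTyped.apps (s := fun j => s j.castSucc) he fun j => (mem_Den_toTy.1 (ha j)).1
      · have := h (Fin.snoc (α := fun _ => Term S 0) args a)
          (Fin.lastCases (by simpa using mem_Den_toTy.2 (mem_Den_toTy.1 ha'))
            fun j => by simpa using ha j)
        simpa [Term.apps, extend] using this

end Denotations

section ConstantTyping

/-! ### Types of constants and constructors -/

section Constants

variable {S : DataSig}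

theorem literal_mem {n : ℕ} {θ : Fin n → Term S 0} {c : Const S} {B : BaseTy S.Data}
    (hB : FirstOrder S B) (hc : Ground (.const c : Term S 0)) (hs : c.simpleTy = .base B) :
    .const c ∈ Den (.base .tot B (.eq B hB (.var 0) (.const c))) θ := by
  refine mem_Den_base.2 ⟨hs ▸ .const c, fun w hw => ?_, fun _ => ⟨_, .refl, hc.value⟩⟩
  rw [hc.value.steps_eq hw.1]
  exact Steps.eq_tt hB hc .refl .refl

theorem not_mem {n : ℕ} {θ : Fin n → Term S 0} :
    .const .not ∈ Den (Const.not.ty : Ty S n) θ := by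
  refine mem_Den_fn.2 ⟨.const .not, fun a ha => ?_⟩
  obtain ⟨ht, -, h⟩ := mem_Den_base.1 ha
  obtain ⟨w, hw, hv⟩ := h rfl
  obtain ⟨b, rfl, -⟩ | ⟨z, -, h⟩ | ⟨T, i, args, -, h, -⟩ := (ht.steps hw).canonical hv
  · have hs : Steps (.app (.const .not) a) (.const (.bool !b)) :=
      (hw.appConst _).tail (.delta (.not b))
    refine mem_Den_base.2 ⟨.app (.const .not) ht, fun w hw => ?_, fun _ => ⟨_, hs, .const _⟩⟩
    rw [hs.ground_unique (.bool _) hw]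
    exact Steps.eq_tt _ (.bool _) .refl hs
  · cases h
  · cases h

theorem op_mem {n : ℕ} {θ : Fin n → Term S 0} {c : Const S} {B B' : BaseTy S.Data}
    (hB' : FirstOrder S B')
    (hs : c.simpleTy = .arr (.base B) (.arr (.base B) (.base B'))) (hc : c.arity = 2)
    (hd : ∀ w w' : Term S 0, Value w → Value w' → SimplyTyped Fin.elim0 w (.base B) →
      SimplyTyped Fin.elim0 w' (.base B) → ∃ r, Delta (.op c w w') r) :
    .const c ∈ Den (.fn (.plain .tot B) (.fn (.plain .tot B)
      (.base .tot B' (.eq B' hB' (.var 0) (.op c (.var 2) (.var 1)))))) θ := by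
  refine mem_Den_fn.2 ⟨hs ▸ .const c, fun a ha => mem_Den_fn.2 ⟨?_, fun a' ha' => ?_⟩⟩
  · exact .app (hs ▸ .const c) (simplyTyped_of_mem ha)
  · have hty : SimplyTyped Fin.elim0 (.op c a a') (.base B') :=
      .app (.app (hs ▸ .const c) (simplyTyped_of_mem ha)) (simplyTyped_of_mem ha')
    obtain ⟨ht, -, h⟩ := mem_Den_base.1 ha
    obtain ⟨w, hw, hv⟩ := h rfl
    obtain ⟨ht', -, h'⟩ := mem_Den_base.1 ha'
    obtain ⟨w', hw', hv'⟩ := h' rfl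
    obtain ⟨r, hr⟩ := hd w w' hv hv' (ht.steps hw) (ht'.steps hw')
    have hs : Steps (.op c a a') r := (Steps.op hc hw hv hw').tail (.delta hr)
    have hvr : Value r := by
      obtain ⟨-, d, rfl, -⟩ := hr.shape
      exact .const d
    have hg := hB'.ground hvr (hty.steps hs)
    refine mem_Den_base.2 ⟨hty, fun w hw => ?_, fun _ => ⟨_, hs, hvr⟩⟩
    rw [hs.ground_unique hg hw]
    exact Steps.eq_tt _ hg .refl hs

theorem Const.mem {n : ℕ} {θ : Fin n → Term S 0} (c : Const S) :
    .const c ∈ Den (c.ty : Ty S n) θ := by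
  have hint : ∀ w : Term S 0, Value w → SimplyTyped Fin.elim0 w (.base .int) →
      ∃ z, w = .const (.int z) := by
    intro w hv ht
    obtain ⟨b, -, h⟩ | ⟨z, rfl, -⟩ | ⟨T, i, args, -, h, -⟩ := ht.canonical hv
    · cases h
    · exact ⟨z, rfl⟩
    · cases h
  have hbool : ∀ w : Term S 0, Value w → SimplyTyped Fin.elim0 w (.base .bool) →
      ∃ b, w = .const (.bool b) := by
    intro w hv ht
    obtain ⟨b, rfl, -⟩ | ⟨z, -, h⟩ | ⟨T, i, args, -, h, -⟩ := ht.canonical hv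
    · exact ⟨b, rfl⟩
    · cases h
    · cases h
  cases c with
  | bool b => exact literal_mem _ (.bool b) rfl
  | int z => exact literal_mem _ (.int z) rfl
  | not => exact not_mem
  | and =>
    refine op_mem _ rfl rfl fun w w' hv hv' ht ht' => ?_
    obtain ⟨b, rfl⟩ := hbool w hv ht
    obtain ⟨b', rfl⟩ := hbool w' hv' ht'
    exact ⟨_, .and b b'⟩
  | eq B h =>
    refine op_mem _ rfl rfl fun w w' hv hv' ht ht' => ?_
    by_cases he : w = w'
    · subst he; exact ⟨_, .eqTrue B h (h.ground hv ht)⟩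
    · exact ⟨_, .eqFalse B h (h.ground hv ht) (h.ground hv' ht') he⟩
  | lt =>
    refine op_mem _ rfl rfl fun w w' hv hv' ht ht' => ?_
    obtain ⟨b, rfl⟩ := hint w hv ht
    obtain ⟨b', rfl⟩ := hint w' hv' ht'
    exact ⟨_, .lt b b'⟩
  | add =>
    refine op_mem _ rfl rfl fun w w' hv hv' ht ht' => ?_
    obtain ⟨b, rfl⟩ := hint w hv ht
    obtain ⟨b', rfl⟩ := hint w' hv' ht'
    exact ⟨_, .add b b'⟩
  | sub =>
    refine op_mem _ rfl rfl fun w w' hv hv' ht ht' => ?_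
    obtain ⟨b, rfl⟩ := hint w hv ht
    obtain ⟨b', rfl⟩ := hint w' hv' ht'
    exact ⟨_, .sub b b'⟩

theorem Const.erase_ty {n : ℕ} (c : Const S) : (c.ty : Ty S n).erase = c.simpleTy := by
  cases c <;> rfl

theorem extend_castLE {A : Type} {n k : ℕ} (θ : Fin n → A) (args : Fin k → A) (h : k ≤ n + k)
    (j : Fin k) : extend θ args (j.castLE h) = args j.rev := by
  induction k with
  | zero => exact j.elim0
  | succ k ih =>
    induction j using Fin.cases with
    | zero => rw [Fin.rev_zero]; rfl
    | succ j =>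
      exact (ih (fun j => args j.castSucc) (Nat.le_add_left _ _) j).trans
        (congrArg args (Fin.rev_succ j).symm)

theorem refIn_subst (P : Signature) {n m : ℕ} (T : P.sig.Data) (i : Fin (P.sig.ctors T))
    (θ : Fin n → Term P.sig m) (args : Fin (P.sig.arity T i) → Term P.sig m) (w : Term P.sig m) :
    (P.refIn n T i).subst (snoc (extend θ args) w) =
      (P.ref T i).subst (snoc (fun j => args j.rev) w) := by
  rw [Signature.refIn, Term.rename_subst]
  congr 1
  exact snoc_ext rfl fun j => extend_castLE θ args (Nat.le_add_left _ _) j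

/-- Constructors satisfy their output refinements. -/
theorem Signature.Sound.conApp_mem {P : Signature} (hP : P.Sound) {n : ℕ} {l : Label}
    {T : P.sig.Data} {i : Fin (P.sig.ctors T)} {θ : Fin n → Term P.sig 0}
    {args : Fin (P.sig.arity T i) → Term P.sig 0}
    (ha : ∀ j, SimplyTyped Fin.elim0 (args j) (P.sig.field T i j))
    (hl : l = .tot → ∃ w, EvaluatesTo (Term.conApp T i args) w) :
    Term.conApp T i args ∈ Den (.base l (.data T) (P.refIn n T i)) (extend θ args) := by
  have h := (mem_Den_fnFields.1 (hP T i)).2 args fun j =>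
    mem_Den_toTy.2 ⟨ha j, fun _ _ h => by cases h⟩
  rw [Term.apps_con] at h
  obtain ⟨h1, h2, -⟩ := mem_Den_base.1 h
  refine mem_Den_base.2 ⟨h1, fun w hw => ?_, hl⟩
  rw [refIn_subst, ← refIn_subst (n := 0) P T i Fin.elim0]
  exact h2 w hw

theorem Signature.Sound.con_mem {P : Signature} (hP : P.Sound) {n : ℕ} {l : Label}
    {T : P.sig.Data} {i : Fin (P.sig.ctors T)} {θ : Fin n → Term P.sig 0}
    (hl : l = .tot → ∀ j, ∃ B, P.sig.field T i j = .base B) :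
    Term.con T i ∈ Den (P.conTy l T i) θ := by
  refine mem_Den_fnFields.2 ⟨.con T i, fun args ha => ?_⟩
  rw [Term.apps_con]
  refine hP.conApp_mem (fun j => (mem_Den_toTy.1 (ha j)).1) fun h => ?_
  choose B hB using hl h
  choose w hw hv using fun j => (mem_Den_toTy.1 (ha j)).2 _ (hB j) h
  exact ⟨_, .conApp le_rfl hw, .con T i _ le_rfl hv⟩

end Constants

/-! ### Simple types of typed terms -/

theorem Subtype.erase_eq {S : DataSig} {n : ℕ} {Γ : Ctx S n} {τ τ' : Ty S n}
    (h : Subtype Γ τ τ') : τ.erase = τ'.erase := by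
  induction h with
  | base => rfl
  | fn _ _ ih ih' => rw [Ty.erase, ih', ← ih]; rfl

theorem Reflect.erase_eq {S : DataSig} {n : ℕ} {τ τ' : Ty S n} {e : Term S n}
    (h : Reflect τ e τ') : τ'.erase = τ.erase := by
  induction h with
  | base => rfl
  | fn _ ih => rw [Ty.erase, ih]; rfl

theorem HasType.simplyTyped {P : Signature} : ∀ {n : ℕ} {Γ : Ctx P.sig n} {p : Term P.sig n}
    {τ : Ty P.sig n}, HasType P Γ p τ → SimplyTyped (fun i => (Γ i).erase) p τ.erase
  | _, Γ, _, _, .var i => .var (Δ := fun i => (Γ i).erase) i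
  | _, _, _, _, .const c => by rw [Const.erase_ty]; exact .const c
  | _, _, _, _, .con l T i _ => by
      rw [Signature.conTy, Ty.erase_fnFields]; exact .con T i
  | _, _, _, _, .sub h hs => hs.erase_eq ▸ h.simplyTyped
  | _, _, _, _, .exact _ h => h.simplyTyped
  | _, _, _, _, .lam _ h => .lam (Ctx.erase_snoc _ _ ▸ h.simplyTyped)
  | _, _, _, _, .app h h' => by
      rw [Ty.inst, Ty.erase_subst]; exact .app h.simplyTyped h'.simplyTyped
  | _, _, _, _, .caseBool h _ _ h1 h2 => by
      have h1 := h1.simplyTyped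
      have h2 := h2.simplyTyped
      rw [Ctx.erase_snoc, Ty.erase_wk] at h1 h2
      exact .caseBool h.simplyTyped h1 h2
  | _, _, _, _, .caseData h _ _ hb => by
      refine .caseData h.simplyTyped fun i => ?_
      have h1 := (hb i).simplyTyped
      rwa [Ctx.erase_snoc, Ctx.erase_snocFields, Ty.erase_wk, Ty.erase_rename] at h1
  | _, _, _, _, .letRec hb _ h _ => by
      have h1 := hb.simplyTyped
      have h2 := h.simplyTyped
      rw [Ctx.erase_snocRec] at h1 h2
      rw [Ty.erase_wk] at h2
      exact .letRec h1 h2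
  | _, _, _, _, .reflect hr h => by
      have h := h.simplyTyped
      have he := hr.erase_eq
      cases h with
      | letRec hb hp =>
        rw [he, Ty.erase_wk] at hb hp
        exact .reflect hb hp
  | _, _, _, _, .fix hb _ => by
      have h1 := hb.simplyTyped
      rw [Ctx.erase_snocRec] at h1
      rw [Ty.inst, Ty.erase_subst]
      exact .fix h1

theorem HasType.simplyTyped_subst {P : Signature} {n : ℕ} {Γ : Ctx P.sig n} {p : Term P.sig n}
    {τ : Ty P.sig n} (h : HasType P Γ p τ) {θ : Fin n → Term P.sig 0} (hθ : θ ∈ Γ.den) :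
    SimplyTyped Fin.elim0 (p.subst θ) τ.erase :=
  h.simplyTyped.subst fun i => simplyTyped_of_mem (hθ i)

end ConstantTyping

section Soundness

/-! ### Partial recursive definitions -/

theorem mem_Den_of_approx {S : DataSig} {b : Term S 1} : ∀ {n m : ℕ} {τ : Ty S n}
    {ρ : Fin m → Fin n} {θ' : Fin n → Term S 0} {t' : Term S 0}, τ.resultLabel = .part →
    τ.ArgsAlong ρ → SimplyTyped Fin.elim0 t' τ.erase →
    (∀ k : ℕ, ∃ θ t, t ∈ Den τ θ ∧ (∀ i, θ (ρ i) = θ' (ρ i)) ∧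
      (∀ i, Approx b (· ≤ ·) (θ i) (θ' i)) ∧
      Approx b (fun m m' => (k : ℕ∞) ≤ m ∧ k ≤ m' ∧ m ≤ m') t t') → t' ∈ Den τ θ'
  | _, _, .base l B r, ρ, θ', t', hl, _, ht', h => by
      cases hl
      refine mem_Den_base.2 ⟨ht', fun w' hw' => ?_, fun h => by cases h⟩
      obtain ⟨k, hk⟩ := hw'.1.approx (b := b)
      obtain ⟨θ, t, ht, -, hθ, hp⟩ := h k
      obtain ⟨w, hs, hw⟩ := hk t hp
      exact ((Approx.refl r).subst (Approx.snoc hθ hw)).steps_tt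
        ((mem_Den_base.1 ht).2.1 w ⟨hs, hw.symm.value hw'.2⟩)
  | _, _, .fn τ₁ τ₂, ρ, θ', t', hl, ha, ht', h => by
      rw [Ty.ArgsAlong] at ha
      obtain ⟨⟨τ₁', h₁⟩, h₂⟩ := ha
      refine mem_Den_fn.2 ⟨ht', fun a ha => ?_⟩
      refine mem_Den_of_approx (b := b) (ρ := liftRen ρ) hl h₂
        (.app ht' (simplyTyped_of_mem ha)) fun k => ?_
      obtain ⟨θ, t, ht, he, hθ, hp⟩ := h k
      refine ⟨snoc θ a, .app t a, (mem_Den_fn.1 ht).2 a ?_, Fin.cases rfl he,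
        Approx.snoc hθ (.refl a), .app hp (.refl a)⟩
      rw [h₁, Den_rename] at ha ⊢
      rwa [funext he]

theorem simplyTyped_approx {S : DataSig} {b : Term S 1} {s : SimpleTy S.Data}
    (hb : SimplyTyped (snoc Fin.elim0 s) b s) (m : ℕ∞) :
    SimplyTyped Fin.elim0 (.fix (approx b m)) s := by
  cases m with
  | top => exact .fix hb
  | coe m =>
    induction m with
    | zero => exact .fix (.var 0)
    | succ m ih => exact .fix ((hb.inst ih).rename (ρ := Fin.succ) fun i => i.elim0)

/-- Recursive definitions that are admitted inhabit their type. -/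
theorem RecursionOk.fix_mem {S : DataSig} {n : ℕ} {Γ : Ctx S n} {τ : Ty S (n + 1)}
    {b : Term S (n + 1)} (hr : RecursionOk Γ τ b)
    (ht : SimplyTyped (fun i => (Γ.snocRec τ i).erase) b τ.erase)
    (hb : ∀ θ ∈ (Γ.snocRec τ).den, b.subst θ ∈ Den τ θ) {θ : Fin n → Term S 0} (hθ : θ ∈ Γ.den) :
    (Term.fix b).subst θ ∈ Den τ (snoc θ ((Term.fix b).subst θ)) := by
  obtain ⟨hl, ha⟩ | hr := hr
  · rw [Ctx.erase_snocRec] at ht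
    have htb : SimplyTyped (snoc Fin.elim0 τ.erase) (b.subst (liftSub θ)) τ.erase :=
      ht.subst (Fin.cases (.var 0) fun i =>
        (simplyTyped_of_mem (hθ i)).rename (ρ := Fin.succ) fun i => i.elim0)
    rw [Term.subst]
    generalize hb' : b.subst (liftSub θ) = b' at htb ⊢
    have hA := simplyTyped_approx htb
    have hmem : ∀ m : ℕ, .fix (approx b' m) ∈ Den τ (snoc θ (.fix (approx b' m))) := by
      intro m
      induction m with
      | zero =>
        refine mem_Den_of_diverges hl (hA 0) fun w hw => ?_
        have key : ∀ t, Steps (.fix (approx b' 0)) t → t = .fix (approx b' 0) := by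
          intro t hs
          induction hs with
          | refl => rfl
          | tail _ hs ih =>
            subst ih
            generalize he : Term.fix (approx b' 0) = e at hs
            cases hs with
            | fix e => cases he; rfl
            | delta hd =>
              subst he
              obtain ⟨⟨b, h⟩ | ⟨c, w, w', h, -⟩, -⟩ := hd.shape <;> cases h
            | _ => cases he
        have hv := hw.2
        rw [key w hw.1] at hv
        exact hv.not_step (.fix _)
      | succ m ih =>
        have h1 := hb _ (snoc_mem_snocRec.2 ⟨hθ, ih⟩)
        rw [← Term.subst_liftSub_inst, hb', ← approx_succ_inst] at h1
        have h2 : Term.fix (approx b' (m + 1)) ∈ Den τ (snoc θ (.fix (approx b' m))) :=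
          Den_conv (Step.fix _).par.conv.symm (hA _) h1
        refine mem_Den_of_approx (b := b') hl ha (hA _) fun k => ⟨_, _, h2, fun i => rfl, ?_,
          .refl _⟩
        refine Approx.snoc (fun i => .refl _) ?_
        have := Approx.approx (b := b') (Q := (· ≤ ·)) (n := 0) id
          (m := m) (m' := (m + 1 : ℕ)) (by exact_mod_cast Nat.le_succ m)
        simpa only [Term.rename_closed] using this
    refine mem_Den_of_approx (b := b') hl ha (hA ⊤) fun k => ⟨_, _, hmem k, fun i => rfl, ?_, ?_⟩
    · refine Approx.snoc (fun i => .refl _) ?_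
      have := Approx.approx (b := b') (Q := (· ≤ ·)) (n := 0) id (m := k) (m' := ⊤) le_top
      simp only [Term.rename_closed] at this
      exact this
    · have := Approx.approx (b := b') (Q := fun m m' => (k : ℕ∞) ≤ m ∧ k ≤ m' ∧ m ≤ m')
        (n := 0) id (m := k) (m' := ⊤) ⟨le_rfl, le_top, le_top⟩
      simp only [Term.rename_closed] at this
      exact this
  · exact hr θ hθ fun e he => hb _ (snoc_mem_snocRec.2 ⟨hθ, he⟩)

/-! ### Soundness of typing -/

theorem Subtype.den_subset {S : DataSig} {n : ℕ} {Γ : Ctx S n} {τ τ' : Ty S n}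
    (h : Subtype Γ τ τ') : ∀ θ ∈ Γ.den, Den τ θ ⊆ Den τ' θ := by
  induction h with
  | base h => exact h
  | fn h₁ h₂ ih₁ ih₂ =>
    intro θ hθ e he
    obtain ⟨ht, he⟩ := mem_Den_fn.1 he
    rw [h₁.erase_eq.symm, h₂.erase_eq] at ht
    exact mem_Den_fn.2 ⟨ht, fun a ha =>
      ih₂ _ (snoc_mem_snoc.2 ⟨hθ, ha⟩) (he a (ih₁ θ hθ ha))⟩

theorem mem_Den_and {S : DataSig} {n : ℕ} {l l' : Label} {B : BaseTy S.Data}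
    {r r' : Term S (n + 1)} {θ : Fin n → Term S 0} {e : Term S 0}
    (h : e ∈ Den (.base l B r) θ) (h' : e ∈ Den (.base l' B r') θ) :
    e ∈ Den (.base l B (.and r r')) θ := by
  obtain ⟨h1, h2, h3⟩ := mem_Den_base.1 h
  exact mem_Den_base.2 ⟨h1, fun w hw => Steps.and_tt (h2 w hw) ((mem_Den_base.1 h').2.1 w hw), h3⟩

/-- A term of a first order type is equal to its values. -/
theorem mem_Den_eq {S : DataSig} {n : ℕ} {B : BaseTy S.Data} (h : FirstOrder S B)
    {θ : Fin n → Term S 0} {e : Term S n} (he : SimplyTyped Fin.elim0 (e.subst θ) (.base B)) :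
    e.subst θ ∈ Den (.base .part B (.eq B h (.var 0) e.wk)) θ := by
  refine mem_Den_base.2 ⟨he, fun w hw => ?_, fun h => by cases h⟩
  have : (Term.eq B h (.var 0) e.wk).subst (snoc θ w) = .eq B h w (e.subst θ) := by
    simp only [Term.eq, Term.op, Term.subst, Term.wk_subst]; rfl
  rw [this]
  exact Steps.eq_tt h (h.ground hw.2 (he.steps hw.1)) .refl hw.1

theorem Steps.mem_Den {S : DataSig} {n : ℕ} {τ : Ty S n} {θ : Fin n → Term S 0} {t t' : Term S 0}
    (h : Steps t t') (ht : SimplyTyped Fin.elim0 t τ.erase) : t ∈ Den τ θ ↔ t' ∈ Den τ θ :=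
  ⟨Den_conv h.conv (ht.steps h), Den_conv h.conv.symm ht⟩

theorem literal_mem_eq {S : DataSig} {n : ℕ} {l : Label} (b : Bool)
    {r : Term S (n + 1)} {θ : Fin n → Term S 0} (h : .const (.bool b) ∈ Den (.base l .bool r) θ) :
    .const (.bool b) ∈ Den (.base l .bool
      (.and r (.eq .bool (firstOrder_bool S) (.var 0) (.const (.bool b))))) θ :=
  mem_Den_and h (literal_mem _ (.bool b) rfl)

theorem Signature.Sound.branch_mem {P : Signature} (hP : P.Sound) {n : ℕ} {Γ : Ctx P.sig n}
    {l : Label} {T : P.sig.Data} {i : Fin (P.sig.ctors T)} {r : Term P.sig (n + 1)}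
    {θ : Fin n → Term P.sig 0} {args : Fin (P.sig.arity T i) → Term P.sig 0} (hθ : θ ∈ Γ.den)
    (hr : .conApp T i args ∈ Den (.base l (.data T) r) θ)
    (hl : l = .tot → ∀ j, ∃ w, EvaluatesTo (args j) w) :
    snoc (extend θ args) (.conApp T i args) ∈
      ((Γ.snocFields l (P.sig.field T i)).snoc (.base l (.data T)
        (.and (r.rename (liftRen (wkRen (P.sig.arity T i)))) (P.refIn n T i)))).den := by
  obtain ⟨h1, h2, h3⟩ := mem_Den_base.1 hr
  have ha := (h1.conApp_inv le_rfl).1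
  refine snoc_mem_snoc.2 ⟨extend_mem_snocFields hθ fun j =>
    mem_Den_toTy.2 ⟨ha j, fun _ _ h => hl h j⟩, mem_Den_and (l' := l) ?_ (hP.conApp_mem ha h3)⟩
  have := Den_rename (.base l (.data T) r) (wkRen (P.sig.arity T i)) (extend θ args)
  simp only [extend_wkRen] at this
  rw [← this] at hr
  exact hr

theorem HasType.sound {P : Signature} (hP : P.Sound) : ∀ {n : ℕ} {Γ : Ctx P.sig n}
    {p : Term P.sig n} {τ : Ty P.sig n}, HasType P Γ p τ →
    ∀ {θ : Fin n → Term P.sig 0}, θ ∈ Γ.den → p.subst θ ∈ Den τ θ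
  | _, Γ, _, _, .var i, _, hθ => hθ i
  | _, _, _, _, .const c, _, _ => c.mem
  | _, _, _, _, .con l T i hl, _, _ => hP.con_mem hl
  | _, _, _, _, .sub h hs, θ, hθ => hs.den_subset θ hθ (h.sound hP hθ)
  | _, _, _, _, .exact hB h, _, hθ =>
      mem_Den_and (h.sound hP hθ) (mem_Den_eq hB (h.simplyTyped_subst hθ))
  | _, Γ, _, _, .lam (e := e) hτ h, θ, hθ => by
      have ht := (HasType.lam hτ h).simplyTyped_subst hθ
      refine mem_Den_fn.2 ⟨ht, fun a ha => ?_⟩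
      have := h.sound hP (snoc_mem_snoc.2 ⟨hθ, ha⟩)
      rw [← Term.subst_liftSub_inst] at this
      exact Den_conv (Step.beta _ _ _).par.conv.symm (.app ht (simplyTyped_of_mem ha)) this
  | _, _, _, _, .app h h', θ, hθ => by
      rw [Den_inst]
      exact (mem_Den_fn.1 (h.sound hP hθ)).2 _ (h'.sound hP hθ)
  | _, _, _, _, .caseBool (e := e) (r := r) (a := a) (b := b) (τ := τ) h hτ hl h1 h2, θ, hθ => by
      have ht := (HasType.caseBool h hτ hl h1 h2).simplyTyped_subst hθ
      have he := h.sound hP hθ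
      have hte := simplyTyped_of_mem he
      by_cases hw : ∃ w, EvaluatesTo (e.subst θ) w
      · obtain ⟨w, hs, hv⟩ := hw
        have hm := (hs.mem_Den hte).1 he
        obtain ⟨x, rfl, -⟩ | ⟨z, -, h⟩ | ⟨T, i, args, -, h, -⟩ := (hte.steps hs).canonical hv
        · cases x with
          | true =>
            have h1 := h1.sound hP (snoc_mem_snoc.2 ⟨hθ, literal_mem_eq true hm⟩)
            rw [Den_wk, ← Term.subst_liftSub_inst] at h1
            exact (Steps.mem_Den ((hs.caseBool _ _).tail (.caseTrue _ _)) ht).2 h1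
          | false =>
            have h2 := h2.sound hP (snoc_mem_snoc.2 ⟨hθ, literal_mem_eq false hm⟩)
            rw [Den_wk, ← Term.subst_liftSub_inst] at h2
            exact (Steps.mem_Den ((hs.caseBool _ _).tail (.caseFalse _ _)) ht).2 h2
        · cases h
        · cases h
      · obtain rfl | hl := hl
        · exact absurd ((mem_Den_base.1 he).2.2 rfl) hw
        · exact mem_Den_of_diverges hl ht fun w hw' => hw (hw'.1.caseBool_value hw'.2)
  | _, _, _, _, .caseData (T := T) (e := e) (l := l) (r := r) (br := br) (τ := τ) h hτ hl hb,
      θ, hθ => by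
      have ht := (HasType.caseData h hτ hl hb).simplyTyped_subst hθ
      have he := h.sound hP hθ
      have hte := simplyTyped_of_mem he
      have key : ∀ i (args : Fin (P.sig.arity T i) → Term P.sig 0),
          Steps (e.subst θ) (.conApp T i args) →
          (l = .tot → ∀ j, ∃ w, EvaluatesTo (args j) w) →
          (Term.caseData T e br).subst θ ∈ Den τ θ := by
        intro i args hs hw
        have hm := (hb i).sound hP (hP.branch_mem hθ ((hs.mem_Den hte).1 he) hw)
        rw [Den_wk, Den_rename] at hm
        simp only [snoc_succ, extend_wkRen] at hm
        have h' := (hs.caseData fun i => (br i).subst (liftSub (liftSubN θ _))).tail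
          (.caseCon _ _ _ _)
        rw [Term.branch_subst] at h'
        simp only [Term.subst_var] at h'
        exact (Steps.mem_Den h' ht).2 hm
      by_cases hw : ∃ w, EvaluatesTo (e.subst θ) w
      · obtain ⟨w, hs, hv⟩ := hw
        obtain ⟨b, -, h⟩ | ⟨z, -, h⟩ | ⟨T', i, args, rfl, h, ha⟩ := (hte.steps hs).canonical hv
        · cases h
        · cases h
        · cases h
          exact key i args hs fun _ j => ⟨_, .refl, (ha j).1⟩
      · obtain rfl | hl' := hl
        · exact absurd ((mem_Den_base.1 he).2.2 rfl) hw
        · by_cases hl : l = .tot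
          · subst hl
            exact absurd ((mem_Den_base.1 he).2.2 rfl) hw
          · by_cases hc : ∃ i, ∃ args : Fin (P.sig.arity T i) → Term P.sig 0,
                Steps (e.subst θ) (.conApp T i args)
            · obtain ⟨i, args, hs⟩ := hc
              exact key i args hs fun h => absurd h hl
            · exact mem_Den_of_diverges hl' ht fun w hw' => hc (hw'.1.caseData_value hw'.2)
  | _, _, _, _, .letRec hb hr h hτ, θ, hθ => by
      have ht := (HasType.letRec hb hr h hτ).simplyTyped_subst hθ
      have hF := hr.fix_mem hb.simplyTyped (fun θ hθ => hb.sound hP hθ) hθ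
      have hm := h.sound hP (snoc_mem_snocRec.2 ⟨hθ, hF⟩)
      rw [Den_wk, ← Term.subst_liftSub_inst] at hm
      exact Den_conv (Step.letRec _ _ _).par.conv.symm ht hm
  | _, _, _, _, .reflect hr h, θ, hθ => by
      have ht := (HasType.reflect hr h).simplyTyped_subst hθ
      have hm := h.sound hP hθ
      exact Den_conv ((Step.letRec _ _ _).par.conv.trans (Step.reflect _ _ _).par.conv.symm) ht hm
  | _, _, _, _, .fix hb hr, θ, hθ => by
      rw [Den_inst]
      exact hr.fix_mem hb.simplyTyped (fun θ hθ => hb.sound hP hθ) hθ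

end Soundness

section Substitution

/-! ### Substitution in the ingredients of typing -/

theorem Const.ty_subst {S : DataSig} {n m : ℕ} (c : Const S) (σ : Fin n → Term S m) :
    (c.ty : Ty S n).subst σ = c.ty := by
  cases c <;> rfl

theorem Ty.fnFields_subst {S : DataSig} {n m k : ℕ} (l : Label) (s : Fin k → SimpleTy S.Data)
    (τ : Ty S (n + k)) (σ : Fin n → Term S m) :
    (Ty.fnFields l s τ).subst σ = .fnFields l s (τ.subst (liftSubN σ k)) := by
  induction k with
  | zero => rfl
  | succ k ih =>
    refine (ih _ _).trans ?_
    rw [Ty.subst, SimpleTy.toTy_subst]; rfl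

theorem liftSubN_castLE {S : DataSig} {n m k : ℕ} (σ : Fin n → Term S m) (h : k ≤ n + k)
    (h' : k ≤ m + k) (j : Fin k) : liftSubN σ k (j.castLE h) = .var (j.castLE h') := by
  induction k with
  | zero => exact j.elim0
  | succ k ih =>
    induction j using Fin.cases with
    | zero => rfl
    | succ j =>
      exact congrArg Term.wk (ih (Nat.le_add_left _ _) (Nat.le_add_left _ _) j)

theorem Signature.refIn_subst_lift (P : Signature) {n m : ℕ} (T : P.sig.Data)
    (i : Fin (P.sig.ctors T)) (σ : Fin n → Term P.sig m) :
    (P.refIn n T i).subst (liftSub (liftSubN σ (P.sig.arity T i))) = P.refIn m T i := by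
  rw [Signature.refIn, Signature.refIn, Term.rename_subst, ← Term.subst_ren]
  congr 1
  exact funext fun j => liftSubN_castLE (k := P.sig.arity T i + 1) σ _ _ j

theorem Signature.conTy_subst (P : Signature) {n m : ℕ} (l : Label) (T : P.sig.Data)
    (i : Fin (P.sig.ctors T)) (σ : Fin n → Term P.sig m) :
    (P.conTy l T i).subst σ = P.conTy l T i := by
  rw [Signature.conTy, Ty.fnFields_subst, Ty.subst, Signature.refIn_subst_lift]; rfl

theorem Ty.resultLabel_subst {S : DataSig} : ∀ {n m : ℕ} (τ : Ty S n) (σ : Fin n → Term S m),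
    (τ.subst σ).resultLabel = τ.resultLabel
  | _, _, .base _ _ _, _ => rfl
  | _, _, .fn _ τ₂, _ => Ty.resultLabel_subst τ₂ _

theorem liftSubN_wkRen {S : DataSig} {n m : ℕ} (σ : Fin n → Term S m) (k : ℕ) (i : Fin n) :
    liftSubN σ k (wkRen k i) = (σ i).rename (wkRen k) := by
  induction k with
  | zero => exact (Term.subst_ren id (σ i)).symm.trans (σ i).subst_var |>.symm
  | succ k ih =>
    refine (congrArg Term.wk ih).trans ?_
    rw [Term.wk, Term.rename_rename]; rfl

theorem Ty.rename_wkRen_subst {S : DataSig} {n m : ℕ} (τ : Ty S n) (σ : Fin n → Term S m) (k : ℕ) :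
    (τ.rename (wkRen k)).subst (liftSubN σ k) = (τ.subst σ).rename (wkRen k) := by
  rw [Ty.rename_subst, Ty.subst_rename]
  simp only [liftSubN_wkRen]

theorem Term.rename_wkRen_subst {S : DataSig} {n m : ℕ} (t : Term S (n + 1))
    (σ : Fin n → Term S m) (k : ℕ) :
    (t.rename (liftRen (wkRen k))).subst (liftSub (liftSubN σ k)) =
      (t.subst (liftSub σ)).rename (liftRen (wkRen k)) := by
  rw [Term.rename_subst, Term.subst_rename, liftSub_liftRen, liftSub_rename]
  simp only [liftSubN_wkRen]

theorem Ty.ArgsAlong.subst {S : DataSig} : ∀ {n n' m m' : ℕ} {τ : Ty S n} {ρ : Fin m → Fin n}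
    {ρ' : Fin m' → Fin n'} {σ : Fin n → Term S n'} {σ' : Fin m → Term S m'}, τ.ArgsAlong ρ →
    (∀ i, σ (ρ i) = (σ' i).rename ρ') → (τ.subst σ).ArgsAlong ρ'
  | _, _, _, _, .base l B r, _, _, _, _, _, _ => by rw [Ty.subst, Ty.ArgsAlong]; trivial
  | _, _, _, _, .fn τ₁ τ₂, ρ, ρ', σ, σ', h, hσ => by
      rw [Ty.ArgsAlong] at h
      obtain ⟨⟨τ₁', rfl⟩, h₂⟩ := h
      rw [Ty.subst, Ty.ArgsAlong]
      refine ⟨⟨τ₁'.subst σ', ?_⟩, h₂.subst (σ' := liftSub σ') (Fin.cases rfl fun i => ?_)⟩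
      · rw [Ty.rename_subst, Ty.subst_rename, funext hσ]
      · exact (congrArg Term.wk (hσ i)).trans (Term.wk_rename ρ' (σ' i)).symm

theorem Reflect.subst {S : DataSig} {n : ℕ} {τ τ' : Ty S n} {e : Term S n} (h : Reflect τ e τ') :
    ∀ {m : ℕ} (σ : Fin n → Term S m), Reflect (τ.subst σ) (e.subst σ) (τ'.subst σ) := by
  induction h with
  | @base n l B h r e =>
    intro m σ
    have := Reflect.base (l := l) h (r := r.subst (liftSub σ)) (e := e.subst σ)
    rw [← Term.wk_subst_liftSub] at this
    exact this
  | fn _ ih => exact fun σ => .fn (ih _)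

/-- A substitution under which closing substitutions pull back. -/
def PullsBack {S : DataSig} {n m : ℕ} (Γ : Ctx S n) (Δ : Ctx S m) (σ : Fin n → Term S m) : Prop :=
  ∀ θ ∈ Δ.den, (fun i => (σ i).subst θ) ∈ Γ.den

theorem PullsBack.snocRec {S : DataSig} {n m : ℕ} {Γ : Ctx S n} {Δ : Ctx S m}
    {σ : Fin n → Term S m} (h : PullsBack Γ Δ σ) (τ : Ty S (n + 1)) :
    PullsBack (Γ.snocRec τ) (Δ.snocRec (τ.subst (liftSub σ))) (liftSub σ) := by
  intro θ hθ
  rw [← snoc_tail θ] at hθ ⊢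
  obtain ⟨h1, h2⟩ := snoc_mem_snocRec.1 hθ
  rw [liftSub_snoc]
  rw [Den_subst, liftSub_snoc] at h2
  exact snoc_mem_snocRec.2 ⟨h _ h1, h2⟩

theorem PullsBack.snoc {S : DataSig} {n m : ℕ} {Γ : Ctx S n} {Δ : Ctx S m}
    {σ : Fin n → Term S m} (h : PullsBack Γ Δ σ) (τ : Ty S n) :
    PullsBack (Γ.snoc τ) (Δ.snoc (τ.subst σ)) (liftSub σ) := by
  rw [Ctx.snoc, Ctx.snoc, ← Ty.wk_subst_liftSub]
  exact h.snocRec _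

theorem Subtype.subst {S : DataSig} {n : ℕ} {Γ : Ctx S n} {τ τ' : Ty S n} (h : Subtype Γ τ τ') :
    ∀ {m : ℕ} {Δ : Ctx S m} {σ : Fin n → Term S m}, PullsBack Γ Δ σ →
      Subtype Δ (τ.subst σ) (τ'.subst σ) := by
  induction h with
  | base h =>
    intro m Δ σ hσ
    refine .base fun θ hθ => ?_
    have := h _ (hσ θ hθ)
    rwa [← Den_subst, ← Den_subst] at this
  | fn _ _ ih₁ ih₂ => exact fun hσ => .fn (ih₁ hσ) (ih₂ (hσ.snoc _))

theorem RecursionOk.subst {S : DataSig} {n m : ℕ} {Γ : Ctx S n} {Δ : Ctx S m} {τ : Ty S (n + 1)}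
    {b : Term S (n + 1)} {σ : Fin n → Term S m} (h : RecursionOk Γ τ b) (hσ : PullsBack Γ Δ σ) :
    RecursionOk Δ (τ.subst (liftSub σ)) (b.subst (liftSub σ)) := by
  obtain ⟨hl, ha⟩ | h := h
  · exact .inl ⟨(Ty.resultLabel_subst _ _).trans hl, ha.subst (σ' := σ) fun _ => rfl⟩
  · refine .inr fun θ hθ hb => ?_
    have := h _ (hσ θ hθ)
    rw [← Term.subst_subst] at this
    simp only [Den_subst, liftSub_snoc, Term.subst_liftSub_snoc] at hb ⊢
    exact this hb

/-! ### The substitution lemma -/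

/-- Typing is stable under every class of substitutions that are typed, pull closing substitutions
back, and pass binders. -/
structure SubstClass (P : Signature)
    (K : ∀ {n m : ℕ}, Ctx P.sig n → Ctx P.sig m → (Fin n → Term P.sig m) → Prop) : Prop where
  typed {n m : ℕ} {Γ : Ctx P.sig n} {Δ : Ctx P.sig m} {σ : Fin n → Term P.sig m} :
    K Γ Δ σ → ∀ i, HasType P Δ (σ i) ((Γ i).subst σ)
  pullsBack {n m : ℕ} {Γ : Ctx P.sig n} {Δ : Ctx P.sig m} {σ : Fin n → Term P.sig m} :
    K Γ Δ σ → PullsBack Γ Δ σ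
  snocRec {n m : ℕ} {Γ : Ctx P.sig n} {Δ : Ctx P.sig m} {σ : Fin n → Term P.sig m} :
    K Γ Δ σ → ∀ τ, K (Γ.snocRec τ) (Δ.snocRec (τ.subst (liftSub σ))) (liftSub σ)

variable {P : Signature}
  {K : ∀ {n m : ℕ}, Ctx P.sig n → Ctx P.sig m → (Fin n → Term P.sig m) → Prop}

theorem SubstClass.snoc (hK : SubstClass P K) {n m : ℕ} {Γ : Ctx P.sig n} {Δ : Ctx P.sig m}
    {σ : Fin n → Term P.sig m} (h : K Γ Δ σ) (τ : Ty P.sig n) :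
    K (Γ.snoc τ) (Δ.snoc (τ.subst σ)) (liftSub σ) := by
  rw [Ctx.snoc, Ctx.snoc, ← Ty.wk_subst_liftSub]
  exact hK.snocRec h _

theorem SubstClass.snocFields (hK : SubstClass P K) {n m k : ℕ} {Γ : Ctx P.sig n}
    {Δ : Ctx P.sig m} {σ : Fin n → Term P.sig m} (h : K Γ Δ σ) (l : Label)
    (s : Fin k → SimpleTy P.sig.Data) :
    K (Γ.snocFields l s) (Δ.snocFields l s) (liftSubN σ k) := by
  induction k with
  | zero => exact h
  | succ k ih =>
    have := hK.snoc (ih fun j => s j.castSucc) ((s (Fin.last k)).toTy l)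
    rw [SimpleTy.toTy_subst] at this
    exact this

mutual

theorem HasType.subst_of (hK : SubstClass P K) : ∀ {n : ℕ} {Γ : Ctx P.sig n} {p : Term P.sig n}
    {τ : Ty P.sig n}, HasType P Γ p τ → ∀ {m : ℕ} {Δ : Ctx P.sig m} {σ : Fin n → Term P.sig m},
    K Γ Δ σ → HasType P Δ (p.subst σ) (τ.subst σ)
  | _, Γ, _, _, .var i, _, _, _, h => hK.typed h i
  | _, _, _, _, .const c, _, _, _, _ => by rw [Const.ty_subst]; exact .const c
  | _, _, _, _, .con l T i hl, _, _, _, _ => by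
      rw [Signature.conTy_subst]; exact .con l T i hl
  | _, _, _, _, .sub hp hs, _, _, _, h => .sub (hp.subst_of hK h) (hs.subst (hK.pullsBack h))
  | _, _, _, _, .exact hB he, _, _, _, h => by
      have := HasType.exact hB (he.subst_of hK h)
      rw [← Term.wk_subst_liftSub] at this
      exact this
  | _, _, _, _, .lam hτ he, _, _, _, h =>
      .lam (hτ.subst_of hK h) (he.subst_of hK (hK.snoc h _))
  | _, _, _, _, .app hf ha, _, _, _, h => by
      rw [Ty.inst_subst_liftSub]
      exact .app (hf.subst_of hK h) (ha.subst_of hK h)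
  | _, _, _, _, .caseBool he hτ hl ha hb, _, _, _, h => by
      have ha' := ha.subst_of hK (hK.snoc h _)
      have hb' := hb.subst_of hK (hK.snoc h _)
      rw [Ty.wk_subst_liftSub] at ha' hb'
      exact .caseBool (he.subst_of hK h) (hτ.subst_of hK h)
        (hl.imp id (Ty.resultLabel_subst _ _).trans) ha' hb'
  | _, _, _, _, .caseData (T := T) he hτ hl hb, m, Δ, σ, h => by
      refine .caseData (he.subst_of hK h) (hτ.subst_of hK h)
        (hl.imp id (Ty.resultLabel_subst _ _).trans) fun i => ?_
      have hb' := (hb i).subst_of hK (hK.snoc (hK.snocFields h _ _) _)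
      rw [Ty.wk_subst_liftSub, Ty.rename_wkRen_subst, Ty.subst] at hb'
      have he : ∀ r r' : Term P.sig _, (Term.and r r').subst (liftSub (liftSubN σ _)) =
        .and (r.subst (liftSub (liftSubN σ (P.sig.arity T i)))) (r'.subst _) := fun _ _ => rfl
      rw [he, Term.rename_wkRen_subst, Signature.refIn_subst_lift] at hb'
      exact hb'
  | _, _, _, _, .letRec hb hr hp hτ, _, _, _, h => by
      have hp' := hp.subst_of hK (hK.snocRec h _)
      rw [Ty.wk_subst_liftSub] at hp'
      exact .letRec (hb.subst_of hK (hK.snocRec h _)) (hr.subst (hK.pullsBack h)) hp'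
        (hτ.subst_of hK h)
  | _, _, _, _, .reflect hr hp, _, _, σ, h => by
      have hr' := hr.subst (liftSub σ)
      rw [Ty.wk_subst_liftSub] at hr'
      exact .reflect hr' (hp.subst_of hK h)
  | _, _, _, _, .fix hb hr, _, _, _, h => by
      rw [Ty.inst_subst_liftSub]
      exact .fix (hb.subst_of hK (hK.snocRec h _)) (hr.subst (hK.pullsBack h))

theorem WellFormed.subst_of (hK : SubstClass P K) : ∀ {n : ℕ} {Γ : Ctx P.sig n}
    {τ : Ty P.sig n}, WellFormed P Γ τ → ∀ {m : ℕ} {Δ : Ctx P.sig m} {σ : Fin n → Term P.sig m},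
    K Γ Δ σ → WellFormed P Δ (τ.subst σ)
  | _, _, _, .base hr, _, _, _, h => .base (hr.subst_of hK (hK.snoc h _))
  | _, _, _, .fn h₁ h₂, _, _, _, h => .fn (h₁.subst_of hK h) (h₂.subst_of hK (hK.snoc h _))

end

/-- Typing is stable under renaming. -/
theorem HasType.rename {n m : ℕ} {Γ : Ctx P.sig n} {Δ : Ctx P.sig m} {ρ : Fin n → Fin m}
    (hρ : ∀ i, Δ (ρ i) = (Γ i).rename ρ) {p : Term P.sig n} {τ : Ty P.sig n}
    (h : HasType P Γ p τ) : HasType P Δ (p.rename ρ) (τ.rename ρ) := by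
  rw [← Term.subst_ren, ← Ty.subst_ren]
  refine h.subst_of (K := fun {n m} Γ Δ σ => ∃ ρ : Fin n → Fin m,
    (∀ i, Δ (ρ i) = (Γ i).rename ρ) ∧ σ = fun i => .var (ρ i)) ⟨?_, ?_, ?_⟩ ⟨ρ, hρ, rfl⟩
  · rintro n m Γ Δ _ ⟨ρ, hρ, rfl⟩ i
    rw [Ty.subst_ren, ← hρ]
    exact .var _
  · rintro n m Γ Δ _ ⟨ρ, hρ, rfl⟩ θ hθ i
    have := hθ (ρ i)
    rw [hρ, Den_rename] at this
    exact this
  · rintro n m Γ Δ _ ⟨ρ, hρ, rfl⟩ τ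
    refine ⟨liftRen ρ, Fin.cases ?_ fun i => ?_, liftSub_var ρ⟩
    · rw [liftSub_var, Ty.subst_ren]; rfl
    · exact (congrArg Ty.wk (hρ i)).trans (Ty.wk_rename ρ (Γ i)).symm

/-- The substitution lemma. -/
theorem HasType.subst (hP : P.Sound) {n m : ℕ} {Γ : Ctx P.sig n} {Δ : Ctx P.sig m}
    {σ : Fin n → Term P.sig m} (hσ : ∀ i, HasType P Δ (σ i) ((Γ i).subst σ)) {p : Term P.sig n}
    {τ : Ty P.sig n} (h : HasType P Γ p τ) : HasType P Δ (p.subst σ) (τ.subst σ) := by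
  refine h.subst_of (K := fun Γ Δ σ => ∀ i, HasType P Δ (σ i) ((Γ i).subst σ))
    ⟨id, fun hσ θ hθ i => ?_, fun {n m Γ Δ σ} hσ τ => Fin.cases ?_ fun i => ?_⟩ hσ
  · rw [← Den_subst]; exact (hσ i).sound hP hθ
  · exact .var _
  · have := (hσ i).rename (ρ := Fin.succ)
      (Δ := Ctx.snocRec Δ (τ.subst (liftSub σ))) fun _ => rfl
    have he : (Γ.snocRec τ i.succ).subst (liftSub σ) = ((Γ i).subst σ).wk :=
      Ty.wk_subst_liftSub σ (Γ i)
    rw [he]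
    exact this

theorem pullsBack_of_hasType (hP : P.Sound) {n m : ℕ} {Γ : Ctx P.sig n} {Δ : Ctx P.sig m}
    {σ : Fin n → Term P.sig m} (hσ : ∀ i, HasType P Δ (σ i) ((Γ i).subst σ)) :
    PullsBack Γ Δ σ := by
  intro θ hθ i
  rw [← Den_subst]; exact (hσ i).sound hP hθ

theorem hasType_snoc_var {n : ℕ} {Γ : Ctx P.sig n} {τ : Ty P.sig (n + 1)} {a : Term P.sig n}
    (ha : HasType P Γ a (τ.inst a)) :
    ∀ i, HasType P Γ (snoc Term.var a i) ((Γ.snocRec τ i).subst (snoc Term.var a)) := by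
  refine Fin.cases ha fun i => ?_
  have := HasType.var (P := P) (Γ := Γ) i
  rw [← Ty.wk_inst (Γ i) a] at this
  exact this

theorem HasType.inst (hP : P.Sound) {n : ℕ} {Γ : Ctx P.sig n} {τ τ' : Ty P.sig (n + 1)}
    {p : Term P.sig (n + 1)} {a : Term P.sig n} (h : HasType P (Γ.snocRec τ) p τ')
    (ha : HasType P Γ a (τ.inst a)) : HasType P Γ (p.inst a) (τ'.inst a) :=
  h.subst hP (hasType_snoc_var ha)

end Substitution

section Preservation

/-! ### Subtyping -/

section Subtyping

variable {S : DataSig}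

theorem Subtype.refl : ∀ {n : ℕ} (Γ : Ctx S n) (τ : Ty S n), Subtype Γ τ τ
  | _, _, .base _ _ _ => .base fun _ _ => subset_rfl
  | _, _, .fn τ₁ τ₂ => .fn (Subtype.refl _ τ₁) (Subtype.refl _ τ₂)

theorem Ctx.snoc_den_mono {n : ℕ} {Γ Γ' : Ctx S n} {τ τ' : Ty S n} (h : Γ'.den ⊆ Γ.den)
    (hτ : ∀ θ ∈ Γ'.den, Den τ' θ ⊆ Den τ θ) : (Γ'.snoc τ').den ⊆ (Γ.snoc τ).den := by
  intro θ hθ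
  rw [← snoc_tail θ] at hθ ⊢
  obtain ⟨h1, h2⟩ := snoc_mem_snoc.1 hθ
  exact snoc_mem_snoc.2 ⟨h h1, hτ _ h1 h2⟩

theorem Subtype.mono {n : ℕ} {Γ : Ctx S n} {τ τ' : Ty S n} (h : Subtype Γ τ τ') :
    ∀ {Γ' : Ctx S n}, Γ'.den ⊆ Γ.den → Subtype Γ' τ τ' := by
  induction h with
  | base h => exact fun hΓ => .base fun θ hθ => h θ (hΓ hθ)
  | fn _ _ ih₁ ih₂ =>
    exact fun hΓ => .fn (ih₁ hΓ) (ih₂ (Ctx.snoc_den_mono hΓ fun _ _ => subset_rfl))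

theorem Subtype.trans : ∀ {n : ℕ} {Γ : Ctx S n} {τ τ' τ'' : Ty S n}, Subtype Γ τ τ' →
    Subtype Γ τ' τ'' → Subtype Γ τ τ''
  | _, _, _, .base _ _ _, _, h, h' => by
      cases h with
      | base h => cases h' with
        | base h' => exact .base fun θ hθ => (h θ hθ).trans (h' θ hθ)
  | _, _, _, .fn _ _, _, h, h' => by
      cases h with
      | fn h₁ h₂ => cases h' with
        | fn h₁' h₂' =>
          exact .fn (h₁'.trans h₁)
            ((h₂.mono (Ctx.snoc_den_mono subset_rfl h₁'.den_subset)).trans h₂')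

theorem Subtype.inst {P : Signature} (hP : P.Sound) {n : ℕ} {Γ : Ctx P.sig n} {τ₁ : Ty P.sig n}
    {τ τ' : Ty P.sig (n + 1)} {a : Term P.sig n} (h : Subtype (Γ.snoc τ₁) τ τ')
    (ha : HasType P Γ a τ₁) : Subtype Γ (τ.inst a) (τ'.inst a) := by
  rw [← Ty.wk_inst τ₁ a] at ha
  exact h.subst (pullsBack_of_hasType hP (hasType_snoc_var ha))

/-- Types that differ by parallel reduction of subterms are subtypes of each other. -/
theorem Subtype.par : ∀ {n m : ℕ} {Γ : Ctx S m} (τ : Ty S n) {σ σ' : Fin n → Term S m},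
    (∀ i, Par (σ i) (σ' i)) →
      Subtype Γ (τ.subst σ) (τ.subst σ') ∧ Subtype Γ (τ.subst σ') (τ.subst σ)
  | _, _, _, .base l B r, σ, σ', h => by
      have key : ∀ θ : Fin _ → Term S 0, Den ((Ty.base l B r).subst σ) θ =
          Den ((Ty.base l B r).subst σ') θ := fun θ => by
        rw [Den_subst, Den_subst]
        exact Den_par _ fun i => (h i).subst fun _ => .refl _
      exact ⟨.base fun θ _ => (key θ).subset, .base fun θ _ => (key θ).superset⟩
  | _, _, _, .fn τ₁ τ₂, σ, σ', h =>
      ⟨.fn (Subtype.par τ₁ h).2 (Subtype.par τ₂ (Par.liftSub h)).1,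
        .fn (Subtype.par τ₁ h).1 (Subtype.par τ₂ (Par.liftSub h)).2⟩

theorem Subtype.toTy {n : ℕ} {Γ : Ctx S n} {l l' : Label} (h : l = .tot → l' = .tot) :
    ∀ s : SimpleTy S.Data, Subtype Γ (s.toTy l') (s.toTy l)
  | .base B => .base fun θ _ e he => by
      have he := mem_Den_toTy (s := .base B).1 he
      exact mem_Den_toTy (s := .base B).2 ⟨he.1, fun B hB hl => he.2 B hB (h hl)⟩
  | .arr _ _ => Subtype.refl _ _

theorem omega_mem {n : ℕ} {θ : Fin n → Term S 0} {B : BaseTy S.Data} {r : Term S (n + 1)} :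
    Term.fix (.var 0) ∈ Den (.base .part B r) θ ∧ ∀ w : Term S 0, ¬ EvaluatesTo (.fix (.var 0)) w := by
  have hd : ∀ w : Term S 0, ¬ EvaluatesTo (.fix (.var 0)) w := by
    intro w hw
    obtain ⟨hs, hv⟩ := hw
    have key : w = .fix (.var 0) := by
      clear hv
      induction hs with
      | refl => rfl
      | tail _ hs ih =>
        subst ih
        cases hs with
        | fix e => rfl
        | delta hd => obtain ⟨⟨b, h⟩ | ⟨c, w, w', h, -⟩, -⟩ := hd.shape <;> cases h
    subst key
    exact hv.not_step (.fix _)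
  exact ⟨mem_Den_of_diverges rfl (.fix (.var 0)) hd, hd⟩

/-- Subtyping does not add the label `⇓`. -/
theorem Subtype.label {n : ℕ} {Γ : Ctx S n} (hΓ : Γ.den.Nonempty) {l : Label}
    {B : BaseTy S.Data} {r : Term S (n + 1)} {τ : Ty S n} (h : Subtype Γ τ (.base l B r)) :
    ∃ l' r', τ = .base l' B r' ∧ (l = .tot → l' = .tot) := by
  cases h with
  | @base _ _ l' _ _ r' _ h =>
    refine ⟨l', r', rfl, fun hl => ?_⟩
    obtain ⟨θ, hθ⟩ := hΓ
    subst hl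
    cases l' with
    | tot => rfl
    | part =>
      obtain ⟨h1, h2⟩ := omega_mem (θ := θ) (B := B) (r := r')
      obtain ⟨w, hw⟩ := (mem_Den_base.1 (h θ hθ h1)).2.2 rfl
      exact absurd hw (h2 w)

/-- The relation between the type that a syntax directed rule gives to a term and its other types:
subtyping, or, at a first order type, strengthening by the rule `exact`. -/
def Ty.Le {n : ℕ} (Γ : Ctx S n) (τ τ' : Ty S n) : Prop :=
  Subtype Γ τ τ' ∨ ∃ l l' B r r', τ = .base l B r ∧ τ' = .base l' B r' ∧ FirstOrder S B ∧
    (l' = .tot → l = .tot)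

theorem Ty.Le.sub {n : ℕ} {Γ : Ctx S n} (hΓ : Γ.den.Nonempty) {τ τ' τ'' : Ty S n}
    (h : Ty.Le Γ τ τ') (h' : Subtype Γ τ' τ'') : Ty.Le Γ τ τ'' := by
  obtain h | ⟨l, l', B, r, r', rfl, rfl, hB, hl⟩ := h
  · exact .inl (h.trans h')
  · cases τ'' with
    | base l'' B' r'' =>
      obtain ⟨_, _, he, hl'⟩ := h'.label hΓ
      cases he
      exact .inr ⟨_, _, _, _, _, rfl, rfl, hB, fun h => hl (hl' h)⟩
    | fn => cases h'

theorem Ty.Le.of_subtype {n : ℕ} {Γ : Ctx S n} (hΓ : Γ.den.Nonempty) {τ τ' τ'' : Ty S n}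
    (h : Subtype Γ τ τ') (h' : Ty.Le Γ τ' τ'') : Ty.Le Γ τ τ'' := by
  obtain h' | ⟨l, l', B, r, r', rfl, rfl, hB, hl⟩ := h'
  · exact .inl (h.trans h')
  · obtain ⟨l₀, r₀, rfl, hl'⟩ := h.label hΓ
    exact .inr ⟨_, _, _, _, _, rfl, rfl, hB, fun h => hl' (hl h)⟩

theorem Ty.Le.exact {n : ℕ} {Γ : Ctx S n} (hΓ : Γ.den.Nonempty) {τ : Ty S n} {l : Label}
    {B : BaseTy S.Data} {r r' : Term S (n + 1)} (hB : FirstOrder S B)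
    (h : Ty.Le Γ τ (.base l B r)) : Ty.Le Γ τ (.base l B r') := by
  obtain h | ⟨l₁, l', B, r, r', rfl, he, -, hl⟩ := h
  · obtain ⟨l₀, r₀, rfl, hl⟩ := h.label hΓ
    exact .inr ⟨_, _, _, _, _, rfl, rfl, hB, hl⟩
  · cases he
    exact .inr ⟨_, _, _, _, _, rfl, rfl, hB, hl⟩

end Subtyping

variable {P : Signature}

/-! ### Inversion of typing -/

theorem HasType.lam_inv : ∀ {n : ℕ} {Γ : Ctx P.sig n} {p : Term P.sig n} {τ : Ty P.sig n},
    HasType P Γ p τ → ∀ {τ₁ e}, p = .lam τ₁ e →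
    ∃ τ₂, HasType P (Γ.snoc τ₁) e τ₂ ∧ Subtype Γ (.fn τ₁ τ₂) τ
  | _, _, _, _, .sub h hs, _, _, hp => by
      obtain ⟨τ₂, h, hs'⟩ := h.lam_inv hp
      exact ⟨τ₂, h, hs'.trans hs⟩
  | _, _, _, _, .exact _ h, _, _, hp => by
      obtain ⟨τ₂, h, hs⟩ := h.lam_inv hp
      cases hs
  | _, _, _, _, .lam hτ h, _, _, hp => by
      cases hp
      exact ⟨_, h, .refl _ _⟩

theorem HasType.app_inv : ∀ {n : ℕ} {Γ : Ctx P.sig n} {p : Term P.sig n} {τ : Ty P.sig n},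
    HasType P Γ p τ → Γ.den.Nonempty → ∀ {f a}, p = .app f a →
    ∃ τ₁ τ₂, HasType P Γ f (.fn τ₁ τ₂) ∧ HasType P Γ a τ₁ ∧ Ty.Le Γ (τ₂.inst a) τ
  | _, _, _, _, .sub h hs, hΓ, _, _, hp => by
      obtain ⟨τ₁, τ₂, hf, ha, hl⟩ := h.app_inv hΓ hp
      exact ⟨τ₁, τ₂, hf, ha, hl.sub hΓ hs⟩
  | _, _, _, _, .exact hB h, hΓ, _, _, hp => by
      obtain ⟨τ₁, τ₂, hf, ha, hl⟩ := h.app_inv hΓ hp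
      exact ⟨τ₁, τ₂, hf, ha, hl.exact hΓ hB⟩
  | _, _, _, _, .app hf ha, _, _, _, hp => by
      cases hp
      exact ⟨_, _, hf, ha, .inl (.refl _ _)⟩

theorem HasType.con_inv : ∀ {n : ℕ} {Γ : Ctx P.sig n} {p : Term P.sig n} {τ : Ty P.sig n},
    HasType P Γ p τ → Γ.den.Nonempty → ∀ {T i}, p = .con T i →
    ∃ l : Label, (l = .tot → ∀ j, ∃ B, P.sig.field T i j = .base B) ∧ Ty.Le Γ (P.conTy l T i) τ
  | _, _, _, _, .sub h hs, hΓ, _, _, hp => by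
      obtain ⟨l, h, hl⟩ := h.con_inv hΓ hp
      exact ⟨l, h, hl.sub hΓ hs⟩
  | _, _, _, _, .exact hB h, hΓ, _, _, hp => by
      obtain ⟨l, h, hl⟩ := h.con_inv hΓ hp
      exact ⟨l, h, hl.exact hΓ hB⟩
  | _, _, _, _, .con l T i h, _, _, _, hp => by
      cases hp
      exact ⟨l, h, .inl (.refl _ _)⟩

/-- Peeling off the arguments of a constructor type from the outside. -/
theorem Ty.fnFields_peel {S : DataSig} {n k : ℕ} (l : Label) (s : Fin k → SimpleTy S.Data)
    (τ : Ty S (n + k)) : ∃ G : (j : ℕ) → j ≤ k → Ty S (n + j),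
      G 0 (Nat.zero_le k) = .fnFields l s τ ∧ G k le_rfl = τ ∧
      ∀ j (h : j < k), G j h.le = .fn ((s ⟨j, h⟩).toTy l) (G (j + 1) h) := by
  induction k with
  | zero =>
    exact ⟨fun j hj => (Nat.le_zero.1 hj) ▸ τ, rfl, rfl, fun j hj => absurd hj (Nat.not_lt_zero j)⟩
  | succ k ih =>
    obtain ⟨G, h0, hk, hG⟩ := ih (fun j => s j.castSucc) (.fn ((s (Fin.last _)).toTy l) τ)
    refine ⟨fun j hj => if h : j ≤ k then G j h else
      (show k + 1 = j by omega) ▸ τ, ?_, ?_, fun j hj => ?_⟩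
    · simp only [Nat.zero_le, dite_true]
      exact h0
    · simp
    · have hj' : j ≤ k := by omega
      simp only [hj', dite_true]
      obtain hlt | rfl := hj'.lt_or_eq
      · have : j + 1 ≤ k := hlt
        simp only [this, dite_true]
        exact hG j hlt
      · simp only [Nat.not_succ_le_self, dite_false]
        exact hk

theorem HasType.conApp_inv (hP : P.Sound) {n : ℕ} {Γ : Ctx P.sig n} (hΓ : Γ.den.Nonempty)
    {T : P.sig.Data} {i : Fin (P.sig.ctors T)} {args : Fin (P.sig.arity T i) → Term P.sig n}
    {τ : Ty P.sig n} (h : HasType P Γ (.conApp T i args) τ) :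
    ∃ l : Label, (l = .tot → ∀ j, ∃ B, P.sig.field T i j = .base B) ∧
      (∀ j, HasType P Γ (args j) ((P.sig.field T i j).toTy l)) ∧
      Ty.Le Γ ((Ty.base l (.data T) (P.refIn n T i)).subst (extend Term.var args)) τ := by
  choose G hG0 hGN hG using fun l =>
    Ty.fnFields_peel l (P.sig.field T i) (.base l (.data T) (P.refIn n T i))
  have key : ∀ k (hk : k ≤ P.sig.arity T i) (args : Fin k → Term P.sig n) (τ : Ty P.sig n),
      HasType P Γ (.conApp T i args) τ →
      ∃ l : Label, (l = .tot → ∀ j, ∃ B, P.sig.field T i j = .base B) ∧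
        (∀ j, HasType P Γ (args j) ((P.sig.field T i (j.castLE hk)).toTy l)) ∧
        Ty.Le Γ ((G l k hk).subst (extend Term.var args)) τ := by
    intro k
    induction k with
    | zero =>
      intro hk args τ h
      obtain ⟨l, hl, hle⟩ := h.con_inv hΓ rfl
      refine ⟨l, hl, fun j => j.elim0, ?_⟩
      rw [← Ty.subst_var (P.conTy l T i), Signature.conTy, ← hG0] at hle
      exact hle
    | succ k ih =>
      intro hk args τ h
      obtain ⟨τ₁, τ₂, hf, ha, hle⟩ := h.app_inv hΓ rfl
      obtain ⟨l, hl, hargs, hle'⟩ := ih (Nat.le_of_succ_le hk) _ _ hf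
      rw [hG l k hk, Ty.subst, SimpleTy.toTy_subst] at hle'
      obtain hs | ⟨_, _, _, _, _, h, -⟩ := hle'
      · cases hs with
        | fn h₁ h₂ =>
          refine ⟨l, hl, Fin.lastCases (.sub ha h₁) hargs, ?_⟩
          have := h₂.inst hP ha
          rw [Ty.subst_liftSub_inst] at this
          exact .of_subtype hΓ this hle
      · cases h
  obtain ⟨l, hl, ha, hle⟩ := key _ le_rfl args τ h
  exact ⟨l, hl, ha, by rwa [hGN] at hle⟩

/-! ### Preservation -/

theorem HasType.apps {n k : ℕ} {Γ : Ctx P.sig n} {l : Label} {s : Fin k → SimpleTy P.sig.Data}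
    {τ : Ty P.sig (n + k)} {e : Term P.sig n} {args : Fin k → Term P.sig n}
    (h : HasType P Γ e (.fnFields l s τ)) (ha : ∀ j, HasType P Γ (args j) ((s j).toTy l)) :
    HasType P Γ (e.apps args) (τ.subst (extend Term.var args)) := by
  induction k with
  | zero => rw [extend, Ty.subst_var]; exact h
  | succ k ih =>
    have hf := ih h fun j => ha _
    rw [Ty.subst, SimpleTy.toTy_subst] at hf
    have := HasType.app hf (ha (Fin.last k))
    rw [Ty.subst_liftSub_inst] at this
    exact this

/-- A literal has every type that contains it. -/
theorem HasType.literal {n : ℕ} {Γ : Ctx P.sig n} {c : Const P.sig} {τ : Ty P.sig n}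
    (hΓ : Γ.den.Nonempty) (hc : c.arity = 0) (h : ∀ θ ∈ Γ.den, .const c ∈ Den τ θ) :
    HasType P Γ (.const c) τ := by
  have key : ∀ B hB, c.simpleTy = .base B → Ground (.const c : Term P.sig 0) →
      (c.ty : Ty P.sig n) = .base .tot B (.eq B hB (.var 0) (.const c)) →
      HasType P Γ (.const c) τ := by
    intro B hB hs hg hty
    have hc := HasType.const (P := P) (Γ := Γ) c
    rw [hty] at hc
    obtain ⟨θ₀, hθ₀⟩ := hΓ
    cases τ with
    | fn τ₁ τ₂ =>
      have := (simplyTyped_of_mem (h θ₀ hθ₀)).const_inv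
      rw [hs] at this
      cases this
    | base l B' r =>
      have := (simplyTyped_of_mem (h θ₀ hθ₀)).const_inv
      rw [hs] at this
      cases this
      refine .sub hc (.base fun θ hθ e he => ?_)
      obtain ⟨h1, h2, h3⟩ := mem_Den_base.1 he
      refine mem_Den_base.2 ⟨h1, fun w hw => ?_, fun _ => h3 rfl⟩
      obtain ⟨g, -, hwg, hcg⟩ := Steps.eq_tt_inv (h2 w hw)
      obtain rfl := hw.2.steps_eq hwg
      obtain rfl := hg.value.steps_eq hcg
      exact (mem_Den_base.1 (h θ hθ)).2.1 _ ⟨.refl, hg.value⟩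
  cases c with
  | bool b => exact key _ _ rfl (.bool b) rfl
  | int z => exact key _ _ rfl (.int z) rfl
  | _ => cases hc

/-- The type of the scrutinee and the output refinement of the constructor can be combined. -/
theorem HasType.conApp_and (hP : P.Sound) {n : ℕ} {Γ : Ctx P.sig n} {l l' : Label}
    {B : BaseTy P.sig.Data} {r r' : Term P.sig (n + 1)} {e : Term P.sig n}
    (h : HasType P Γ e (.base l B r)) (h' : HasType P Γ e (.base l' B r'))
    (hl : l = .tot → l' = .tot)
    (hle : Subtype Γ (.base l' B r') (.base l B r) ∨ FirstOrder P.sig B) :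
    HasType P Γ e (.base l B (.and r r')) := by
  obtain hs | hB := hle
  · refine .sub h' (.base fun θ hθ x hx => mem_Den_and (hs.den_subset θ hθ hx) hx)
  · refine .sub (.exact hB h') (.base fun θ hθ x hx => ?_)
    obtain ⟨h1, h2, h3⟩ := mem_Den_base.1 hx
    refine mem_Den_base.2 ⟨h1, fun w hw => ?_, fun h => h3 (hl h)⟩
    obtain ⟨h4, h5⟩ := Steps.and_tt_inv (h2 w hw)
    refine Steps.and_tt ?_ h4
    obtain ⟨g, hg, hwg, heg⟩ := Steps.eq_tt_inv h5
    obtain rfl := hw.2.steps_eq hwg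
    have heg : Steps (e.wk.subst (snoc θ g)) g := heg
    rw [Term.wk_subst] at heg
    exact (mem_Den_base.1 (h.sound hP hθ)).2.1 _ ⟨heg, hw.2⟩

theorem HasType.branch (hP : P.Sound) {n : ℕ} {Γ : Ctx P.sig n} (hΓ : Γ.den.Nonempty) {l : Label}
    {T : P.sig.Data} {i : Fin (P.sig.ctors T)} {r : Term P.sig (n + 1)}
    {args : Fin (P.sig.arity T i) → Term P.sig n} {b : Term P.sig (n + P.sig.arity T i + 1)}
    {τ : Ty P.sig n} (h : HasType P Γ (.conApp T i args) (.base l (.data T) r))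
    (hb : HasType P
        ((Γ.snocFields l (P.sig.field T i)).snoc (.base l (.data T)
          (.and (r.rename (liftRen (wkRen (P.sig.arity T i)))) (P.refIn n T i))))
        b (τ.rename (wkRen (P.sig.arity T i))).wk) :
    HasType P Γ (b.subst (snoc (extend Term.var args) (.conApp T i args))) τ := by
  obtain ⟨l', hl', ha, hle⟩ := h.conApp_inv hP hΓ
  have hl : l = .tot → l' = .tot := by
    obtain hs | ⟨_, _, _, _, _, h1, h2, -, hl⟩ := hle
    · obtain ⟨_, _, he, hl⟩ := hs.label hΓ
      cases he
      exact hl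
    · cases h1
      cases h2
      exact hl
  have hcon : HasType P Γ (.conApp T i args)
      ((Ty.base l' (.data T) (P.refIn n T i)).subst (extend Term.var args)) := by
    rw [← Term.apps_con]
    exact HasType.apps (.con l' T i hl') ha
  have hand := HasType.conApp_and hP h hcon hl
    (hle.imp id fun ⟨_, _, _, _, _, _, h2, hB, _⟩ => by cases h2; exact hB)
  have hfields : ∀ {k : ℕ} (s : Fin k → SimpleTy P.sig.Data) (args : Fin k → Term P.sig n),
      (∀ j, HasType P Γ (args j) ((s j).toTy l)) → ∀ x, HasType P Γ (extend Term.var args x)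
        ((Γ.snocFields l s x).subst (extend Term.var args)) := by
    intro k s args ha
    induction k with
    | zero => intro x; rw [extend, Ty.subst_var]; exact .var x
    | succ k ih =>
      refine Fin.cases ?_ fun x => ?_
      · have he : ((s (Fin.last k)).toTy l : Ty P.sig (n + k)).wk.subst
            (snoc (extend Term.var fun j => args j.castSucc) (args (Fin.last k))) =
              (s (Fin.last k)).toTy l := by
          rw [Ty.wk_subst]
          exact SimpleTy.toTy_subst l _ _
        exact he ▸ ha (Fin.last k)
      · have := ih (fun j => s j.castSucc) (fun j => args j.castSucc) (fun j => ha _) x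
        have he := Ty.wk_subst (snoc (extend Term.var fun j => args j.castSucc)
          (args (Fin.last k))) (Ctx.snocFields l Γ (fun j => s j.castSucc) x)
        exact he ▸ this
  have hσ : ∀ x, HasType P Γ (snoc (extend Term.var args) (.conApp T i args) x) (((Γ.snocFields l
      (P.sig.field T i)).snoc (.base l (.data T) (.and (r.rename (liftRen
        (wkRen (P.sig.arity T i)))) (P.refIn n T i))) x).subst
          (snoc (extend Term.var args) (.conApp T i args))) := by
    refine Fin.cases ?_ fun x => ?_
    · have he : ((Ty.base l (.data T) (.and (r.rename (liftRen (wkRen (P.sig.arity T i))))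
          (P.refIn n T i))).wk).subst (snoc (extend Term.var args) (.conApp T i args)) =
          .base l (.data T) (.and r ((P.refIn n T i).subst (liftSub (extend Term.var args)))) := by
        rw [Ty.wk_subst]
        have : (r.rename (liftRen (wkRen (P.sig.arity T i)))).subst
            (liftSub (extend Term.var args)) = r := by
          rw [Term.rename_subst, liftSub_liftRen]
          simp only [extend_wkRen]
          rw [show (fun i => (Term.var i : Term P.sig n)) = Term.var from rfl, liftSub_id,
            Term.subst_var]
        simp only [snoc_succ, Ty.subst, Term.and, Term.op, Term.subst, this]
      exact he ▸ hand
    · have := hfields (P.sig.field T i) args (fun j => .sub (ha j) (.toTy hl _)) x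
      have he := Ty.wk_subst (snoc (extend Term.var args) (.conApp T i args))
          (Ctx.snocFields l Γ (P.sig.field T i) x)
      exact he ▸ this
  have := hb.subst hP hσ
  rw [Ty.wk_subst, Ty.rename_subst] at this
  simp only [snoc_succ, extend_wkRen] at this
  rwa [show (fun i => (Term.var i : Term P.sig n)) = Term.var from rfl, Ty.subst_var] at this

/-- Subject reduction, in environments that have a closing substitution. -/
theorem HasType.step (hP : P.Sound) : ∀ {n : ℕ} {Γ : Ctx P.sig n} {p : Term P.sig n}
    {τ : Ty P.sig n}, HasType P Γ p τ → ∀ {p' : Term P.sig n}, Γ.den.Nonempty → Step p p' →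
    HasType P Γ p' τ
  | _, Γ, _, _, .var i, _, _, hs => by
      cases hs with
      | delta hd => obtain ⟨⟨b, h⟩ | ⟨c, w, w', h, -⟩, -⟩ := hd.shape <;> cases h
  | _, _, _, _, .const c, _, _, hs => absurd hs (Value.const c).not_step
  | _, _, _, _, .con l T i hl, _, _, hs =>
      absurd hs (Value.con T i Fin.elim0 (Nat.zero_le _) fun j => j.elim0).not_step
  | _, _, _, _, .sub h hs', _, hΓ, hs => .sub (h.step hP hΓ hs) hs'
  | _, _, _, _, .exact hB h, p', hΓ, hs => by
      refine .sub (.exact hB (h.step hP hΓ hs)) (.base fun θ hθ x hx => ?_)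
      obtain ⟨h1, h2, h3⟩ := mem_Den_base.1 hx
      refine mem_Den_base.2 ⟨h1, fun w hw => ?_, h3⟩
      obtain ⟨h4, h5⟩ := Steps.and_tt_inv (h2 w hw)
      obtain ⟨g, hg, hwg, heg⟩ := Steps.eq_tt_inv h5
      have heg : Steps (p'.wk.subst (snoc θ w)) g := heg
      refine Steps.and_tt h4 (Steps.eq_tt hB hg hwg ?_)
      rw [Term.wk_subst] at heg ⊢
      exact .head (hs.subst _) heg
  | _, _, _, _, .lam hτ h, _, _, hs => absurd hs (Value.lam _ _).not_step
  | _, Γ, _, _, .app (τ₂ := τ₂) (e := f) (a := a) hf ha, p', hΓ, hs => by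
      have harg : ∀ a', Step a a' → HasType P Γ (.app f a') (τ₂.inst a) := fun a' hs =>
        .sub (.app hf (ha.step hP hΓ hs))
          (Subtype.par τ₂ (Par.snoc (fun _ => .refl _) hs.par)).2
      generalize hp : Term.app f a = p at hs
      cases hs with
      | appFun hs => cases hp; exact .app (hf.step hP hΓ hs) ha
      | appConst hs => cases hp; exact harg _ hs
      | appPartialOp _ _ hs => cases hp; exact harg _ hs
      | appCon _ hs => cases hp; exact harg _ hs
      | delta hd =>
        subst hp
        obtain ⟨c, rfl, hc⟩ := hd.shape.2
        have happ := HasType.app hf ha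
        refine .literal hΓ hc fun θ hθ => ?_
        exact (Steps.mem_Den (.single ((Step.delta hd).subst θ))
          (happ.simplyTyped_subst hθ)).1 (happ.sound hP hθ)
      | beta τ e a =>
        cases hp
        obtain ⟨τ₂', he, hs⟩ := hf.lam_inv rfl
        cases hs with
        | fn h₁ h₂ =>
          have ha' := HasType.sub ha h₁
          rw [← Ty.wk_inst τ a] at ha'
          exact .sub (HasType.inst hP he ha') (h₂.inst hP ha)
      | _ => cases hp
  | _, Γ, _, τ, .caseBool (e := e) he hτ hl ha hb, p', hΓ, hs => by
      generalize hp : Term.caseBool e _ _ = p at hs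
      cases hs with
      | caseBoolScrut hs => cases hp; exact .caseBool (he.step hP hΓ hs) hτ hl ha hb
      | caseTrue =>
        cases hp
        have ht := HasType.literal (c := .bool true) hΓ rfl fun θ hθ =>
          literal_mem_eq true (he.sound hP hθ)
        rw [← Ty.wk_inst (.base _ _ _) (.const (.bool true))] at ht
        exact Ty.wk_inst τ _ ▸ HasType.inst hP ha ht
      | caseFalse =>
        cases hp
        have ht := HasType.literal (c := .bool false) hΓ rfl fun θ hθ =>
          literal_mem_eq false (he.sound hP hθ)
        rw [← Ty.wk_inst (.base _ _ _) (.const (.bool false))] at ht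
        exact Ty.wk_inst τ _ ▸ HasType.inst hP hb ht
      | delta hd =>
        subst hp
        obtain ⟨⟨b, h⟩ | ⟨c, w, w', h, -⟩, -⟩ := hd.shape <;> cases h
      | _ => cases hp
  | _, Γ, _, τ, .caseData (T := T) (e := e) (br := br) he hτ hl hb, p', hΓ, hs => by
      generalize hp : Term.caseData T e br = p at hs
      cases hs with
      | caseDataScrut hs => cases hp; exact .caseData (he.step hP hΓ hs) hτ hl hb
      | caseCon T i args br => cases hp; exact .branch hP hΓ he (hb i)
      | delta hd =>
        subst hp
        obtain ⟨⟨b, h⟩ | ⟨c, w, w', h, -⟩, -⟩ := hd.shape <;> cases h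
      | _ => cases hp
  | _, Γ, _, τ, .letRec (τx := τx) (b := b) hb hr hp hτ, p', hΓ, hs => by
      cases hs with
      | letRec => exact Ty.wk_inst τ (.fix b) ▸ HasType.inst hP hp (.fix hb hr)
      | delta hd => obtain ⟨⟨b, h⟩ | ⟨c, w, w', h, -⟩, -⟩ := hd.shape <;> cases h
  | _, _, _, _, .reflect hr h, p', hΓ, hs => by
      cases hs with
      | reflect => exact h.step hP hΓ (.letRec _ _ _)
      | delta hd => obtain ⟨⟨b, h⟩ | ⟨c, w, w', h, -⟩, -⟩ := hd.shape <;> cases h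
  | _, _, _, _, .fix hb hr, p', hΓ, hs => by
      cases hs with
      | fix => exact HasType.inst hP hb (.fix hb hr)
      | delta hd => obtain ⟨⟨b, h⟩ | ⟨c, w, w', h, -⟩, -⟩ := hd.shape <;> cases h

end Preservation
end RefinementReflection

/-- Preservation: if a closed program `p` has type `τ` and evaluates to a value `w`, then `w` has
type `τ`. -/
theorem mainTheorem2 (P : RefinementReflection.Signature) (hP : P.Sound)
    (p w : RefinementReflection.Term P.sig 0) (τ : RefinementReflection.Ty P.sig 0)
    (hp : RefinementReflection.HasType P RefinementReflection.Ctx.empty p τ)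
    (hw : RefinementReflection.EvaluatesTo p w) :
    RefinementReflection.HasType P RefinementReflection.Ctx.empty w τ := by
  obtain ⟨h, -⟩ := hw
  induction h with
  | refl => exact hp
  | tail _ hs ih => exact ih.step hP ⟨Fin.elim0, fun i => i.elim0⟩ hs
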